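/- Let $h\in[0,1)$ and let $\alpha\in(0,\frac{\pi}{2}]$ be given by $\cos\alpha=h$. For $m=(m_1,m_2)\in H^1_{\mathrm{loc}}(\mathbb{R};\mathbb{S}^1)$ (identified with its continuous representative) define $$E_h(m)=\frac12\int_{\mathbb{R}}\bigl(|m'|^2+(m_1-h)^2\bigr)\,dx_1+\frac12\int_{\mathbb{R}^2_+}|\nabla u|^2\,dx\in[0,\infty].$$ Here $\mathbb{R}^2_+=\mathbb{R}\times(0,\infty)$, and $u\in\dot H^1(\mathbb{R}^2_+)$, the completion of $C_0^\infty(\overline{\mathbb{R}^2_+})$ with respect to the inner product $\int_{\mathbb{R}^2_+}\nabla\phi\cdot\nabla\psi\,dx$, is the unique solution of $$\int_{\mathbb{R}^2_+}\nabla u\cdot\nabla\zeta\,dx=\int_{\mathbb{R}}m_1'\,\zeta(\cdot,0)\,dx_1\qquad\text{for all }\zeta\in C_0^\infty(\mathbb{R}^2)$$ (that is, the weak solution of $\Delta u=0$ in $\mathbb{R}^2_+$ with $\partial u/\partial x_2=-m_1'$ on $\mathbb{R}\times\{0\}$); it exists whenever the first integral in $E_h(m)$ is finite, and $E_h(m)=\infty$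 otherwise. If $E_h(m)<\infty$, then every continuous lifting $\phi\colon\mathbb{R}\to\mathbb{R}$ of $m$, $m=(\cos\phi,\sin\phi)$, has finite limits $\phi(\pm\infty)$ at $\pm\infty$, and the winding number of $m$ is $\deg(m)=\frac{1}{2\pi}\bigl(\phi(+\infty)-\phi(-\infty)\bigr)$. For $d\in\mathbb{R}$ put $$\mathcal{A}_h(d)=\{m\in H^1_{\mathrm{loc}}(\mathbb{R};\mathbb{S}^1):E_h(m)<\infty,\ \deg(m)=d\},\qquad \mathcal{E}_h(d)=\inf_{m\in\mathcal{A}_h(d)}E_h(m).$$ **Theorem.** For every $h\in[0,1)$, the number $\mathcal{E}_h(1)$ is finite, $$\mathcal{E}_h(1)=\mathcal{E}_h\Bigl(\frac{\alpha}{\pi}\Bigr)+\mathcal{E}_h\Bigl(1-\frac{\alpha}{\pi}\Bigr),$$ and $\mathcal{E}_h(1)$ is not attained: there is no $m\in\mathcal{A}_h(1)$ with $E_h(m)=\mathcal{E}_h(1)$. -/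

import Mathlib

open MeasureTheory Filter Topology
open scoped ENNReal ContDiff

noncomputable section

namespace NeelWall

/-! ### Function spaces -/

/-- The Euclidean plane, in which the maps `m = (m 0, m 1)` and the gradients take their values. -/
abbrev Plane : Type := EuclideanSpace ℝ (Fin 2)

/-- `f ∈ H¹_loc(ℝ)`, for the continuous representative `f`: it is locally absolutely continuous,
and its derivative (which exists almost everywhere and is the weak derivative)
is locally square integrable. -/
def IsH1Loc (f : ℝ → ℝ) : Prop :=
  ∀ a b : ℝ, a ≤ b →
    AbsolutelyContinuousOnInterval f a b ∧ MemLp (deriv f) 2 (volume.restrict (Set.Icc a b))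

/-- `m ∈ H¹_loc(ℝ; 𝕊¹)`. -/
def IsH1LocCircle (m : ℝ → Plane) : Prop :=
  (∀ x, m x ∈ Metric.sphere (0 : Plane) 1) ∧ ∀ i, IsH1Loc (fun x => m x i)

/-- Lebesgue measure on the open upper half-plane `ℝ × (0, ∞)`. -/
def halfPlaneVolume : Measure (ℝ × ℝ) :=
  volume.restrict {p : ℝ × ℝ | 0 < p.2}

/-- Test functions: `ζ ∈ C_0^∞(ℝ²)`. Their restrictions form `C_0^∞` of the closed half-plane. -/
def IsTestFunction (ζ : ℝ × ℝ → ℝ) : Prop :=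
  ContDiff ℝ ∞ ζ ∧ HasCompactSupport ζ

/-- The gradient `(∂ζ/∂x₁, ∂ζ/∂x₂)`. -/
def grad (ζ : ℝ × ℝ → ℝ) (p : ℝ × ℝ) : Plane :=
  !₂[fderiv ℝ ζ p (1, 0), fderiv ℝ ζ p (0, 1)]

/-- The set of the gradients of test functions, as elements of `L²` of the half-plane. -/
def testGradients : Set (Lp Plane 2 halfPlaneVolume) :=
  {v | ∃ ζ, IsTestFunction ζ ∧ v =ᵐ[halfPlaneVolume] grad ζ}

/-- The space `Ḣ¹` of the half-plane, the completion of `C_0^∞` of the closed half-plane for the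
inner product `∫ ∇φ · ∇ψ`. As `φ ↦ ∇φ` is an isometry from that inner product into `L²`, the
completion is the closure of the gradients in `L²`; an element `u` of it, which as a function is
only determined up to a constant, is represented by `∇u`. (The set `testGradients` is already
closed under linear combinations; `span` only serves to name it as a subspace.) -/
def HDot1 : Submodule ℝ (Lp Plane 2 halfPlaneVolume) :=
  (Submodule.span ℝ testGradients).topologicalClosure

/-! ### The stray field -/

/-- `gradU` is the gradient `∇u` of the weak solution `u ∈ Ḣ¹` of `Δu = 0` in the half-plane with
`∂u/∂x₂ = -f'` on the boundary: `∫ ∇u · ∇ζ dx = ∫ f' ζ(·, 0) dx₁` for all test functions `ζ`. -/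
def IsStrayField (f : ℝ → ℝ) (gradU : Lp Plane 2 halfPlaneVolume) : Prop :=
  gradU ∈ HDot1 ∧
    ∀ ζ : ℝ × ℝ → ℝ, IsTestFunction ζ →
      ∫ p, inner ℝ (gradU p) (grad ζ p) ∂halfPlaneVolume = ∫ x : ℝ, deriv f x * ζ (x, 0)

/-- The stray field is unique. -/
theorem IsStrayField.unique {f : ℝ → ℝ} {v w : Lp Plane 2 halfPlaneVolume}
    (hv : IsStrayField f v) (hw : IsStrayField f w) : v = w := by
  have hmem : v - w ∈ HDot1 := HDot1.sub_mem hv.1 hw.1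
  have horth : v - w ∈ HDot1ᗮ := by
    unfold HDot1
    rw [Submodule.orthogonal_closure, Submodule.mem_orthogonal']
    intro g hg
    induction hg using Submodule.span_induction with
    | mem g hg =>
      obtain ⟨ζ, hζ, hgζ⟩ := hg
      have key : ∀ u : Lp Plane 2 halfPlaneVolume,
          inner ℝ u g = ∫ p, inner ℝ (u p) (grad ζ p) ∂halfPlaneVolume := by
        intro u
        rw [L2.inner_def]
        refine integral_congr_ae ?_
        filter_upwards [hgζ] with p hp
        rw [hp]
      rw [inner_sub_left, key v, key w, hv.2 ζ hζ, hw.2 ζ hζ, sub_self]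
    | zero => exact inner_zero_right _
    | add x y _ _ hx hy => rw [inner_add_right, hx, hy, add_zero]
    | smul c x _ hx => rw [inner_smul_right, hx, mul_zero]
  have h0 : inner ℝ (v - w) (v - w) = 0 :=
    (Submodule.mem_orthogonal _ _).1 horth _ hmem
  exact sub_eq_zero.1 (inner_self_eq_zero.1 h0)

/-- The stray field energy `(1/2) ∫ |∇u|²`, where `u` is the stray field of `f`
(unique by `IsStrayField.unique`), with the value `∞` if there is none. -/
def strayFieldEnergy (f : ℝ → ℝ) : ℝ≥0∞ :=
  ⨅ (v : Lp Plane 2 halfPlaneVolume) (_ : IsStrayField f v),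
    2⁻¹ * ∫⁻ p, ‖v p‖ₑ ^ 2 ∂halfPlaneVolume

/-! ### The energy -/

/-- The anisotropy potential `W(m) = (m₁² - 2 h m₁ + 2 h k - k²) / 2`, where `k = min {h, 1}`;
it is nonnegative on the unit circle. -/
def W (h : ℝ) (m : Plane) : ℝ :=
  (m 0 ^ 2 - 2 * h * m 0 + 2 * h * min h 1 - min h 1 ^ 2) / 2

/-- The energy `E_h(m) = (1/2) ∫ (|m'|² + 2 W(m)) dx₁ + (1/2) ∫ |∇u|² dx`, with values in
`[0, ∞]`, where `u` is the stray field of the first component of `m`. -/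
def energy (h : ℝ) (m : ℝ → Plane) : ℝ≥0∞ :=
  2⁻¹ * (∫⁻ x : ℝ, ENNReal.ofReal
      (deriv (fun y => m y 0) x ^ 2 + deriv (fun y => m y 1) x ^ 2 + 2 * W h (m x)))
    + strayFieldEnergy (fun y => m y 0)

/-- The angle `α ∈ [0, π/2]` with `cos α = min {h, 1}`. -/
def wellAngle (h : ℝ) : ℝ := Real.arccos (min h 1)

/-- `deg(m) = d`: some continuous lifting `φ`, `m = (cos φ, sin φ)`, has limits at `±∞`, and
`d = (φ(+∞) - φ(-∞)) / 2π`. (Any two continuous liftings differ by a constant in `2πℤ`.) -/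
def HasDegree (m : ℝ → Plane) (d : ℝ) : Prop :=
  ∃ (φ : ℝ → ℝ) (a b : ℝ), Continuous φ ∧ (∀ x, m x = !₂[Real.cos (φ x), Real.sin (φ x)]) ∧
    Tendsto φ atBot (𝓝 a) ∧ Tendsto φ atTop (𝓝 b) ∧ d = (b - a) / (2 * Real.pi)

/-- The class `𝒜_h(d)` of the maps in `H¹_loc(ℝ; 𝕊¹)` with finite energy and degree `d`. -/
def admissible (h d : ℝ) : Set (ℝ → Plane) :=
  {m | IsH1LocCircle m ∧ energy h m < ⊤ ∧ HasDegree m d}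

/-- The infimum `ℰ_h(d)` of the energy over `𝒜_h(d)`. -/
def minEnergy (h d : ℝ) : ℝ≥0∞ :=
  ⨅ m ∈ admissible h d, energy h m

/-- `ℰ_h(d)` is attained. -/
def IsAttained (h d : ℝ) : Prop :=
  ∃ m ∈ admissible h d, energy h m = minEnergy h d

end NeelWall

end

/-!
The proof is by rearrangement of liftings. The energy is first reduced to the real line: for
a lifting `φ` of `m` it equals

`(1/2) ∫ (φ'² + (cos φ - h)²) + (1/4π) ∫∫ (cos φ(x) - cos φ(y))² / (x - y)² dx dy`

(`IsProfile.energy_eq`, `exists_profile`). The double integral is the stray field energy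
(`strayFieldEnergy_eq`). To see this without Fourier transform, superpose the gradients of conjugate
Poisson kernels with poles at depth `c` below the boundary; their Gram matrix is the explicit kernel
`(c² - τ²) / (π (τ² + c²)²)`, which tends to `-1 / (π τ²)` as `c → 0` and has mean zero, so that the
superpositions form a Cauchy sequence whose limit is the stray field (`exists_strayField`).

*Lower bound.* Let `φ` be a lifting of degree one, so that it passes from a well of `W` to the next
but one. Composing `φ` with the folding of the circle onto the arc `cos ≥ h` and with the folding
onto the complementary arc gives liftings `T` and `S` with `cos T = max (cos φ) h` and
`cos S = min (cos φ) h`, of total angles `2α` and `2π - 2α` up to sign. At almost every point `T` or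
`S` is stationary, so the local energies of `T` and `S` add up to at most that of `φ`. In the double
integral, the product of the increments of `max (cos φ) h` and `min (cos φ) h` is nonnegative and,
as `cos φ` takes values on both sides of `h`, positive on a nonempty open set. Hence the sum of the
energies of `T` and `S` is strictly smaller than that of `φ` (`minEnergy_add_minEnergy_lt`). This
strict inequality also excludes that the infimum is attained, once the upper bound is known.

*Upper bound.* Take profiles of angles `2α` and `2π - 2α`, fold them after stretching the angle by a
factor `s > 1`, which costs at most a factor `s⁴` in the energy (`IsProfile.comp`) and makes them
constant outside an interval, and glue the results at a distance `D`. The interaction energy is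
`O(D⁻²)` (`IsProfile.glue`). Let `D → ∞` and then `s → 1` (`minEnergy_one_le`).
-/

noncomputable section

namespace NeelWall

/-! ### A one-dimensional Gram kernel -/

/-- The kernel `κ_c(τ) = (c² - τ²) / (π (τ² + c²)²)`, the derivative of the conjugate Poisson kernel
`τ ↦ τ / (π (τ² + c²))`. Its integral vanishes, and `-κ_c(τ) → 1 / (π τ²)` as `c → 0`. -/
def gramKernel (c τ : ℝ) : ℝ := (c ^ 2 - τ ^ 2) / (Real.pi * (τ ^ 2 + c ^ 2) ^ 2)

/-- A primitive of `x ↦ 1 / (x - (σ + i d))` on the real line, for `d ≠ 0`. -/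
def logPrimitive (σ d x : ℝ) : ℂ :=
  ((Real.log ((x - σ) ^ 2 + d ^ 2) / 2 : ℝ) : ℂ) + ((Real.arctan ((x - σ) / d) : ℝ) : ℂ) * Complex.I

theorem ofReal_sub_ne_zero (σ x : ℝ) {d : ℝ} (hd : d ≠ 0) :
    (x : ℂ) - (σ + d * Complex.I) ≠ 0 := by
  intro h
  have := congrArg Complex.im h
  simp at this
  exact hd this

theorem hasDerivAt_logPrimitive (σ x : ℝ) {d : ℝ} (hd : d ≠ 0) :
    HasDerivAt (logPrimitive σ d) (1 / ((x : ℂ) - (σ + d * Complex.I))) x := by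
  have hD : (x - σ) ^ 2 + d ^ 2 ≠ 0 := by positivity
  have h1 : HasDerivAt (fun x : ℝ => Real.log ((x - σ) ^ 2 + d ^ 2) / 2)
      ((x - σ) / ((x - σ) ^ 2 + d ^ 2)) x := by
    have := (((((hasDerivAt_id x).sub_const σ).pow 2).add_const (d ^ 2)).log hD).div_const 2
    refine this.congr_deriv ?_
    simp only [id, Pi.pow_apply]
    field_simp
    simp [mul_comm]
  have h2 : HasDerivAt (fun x : ℝ => Real.arctan ((x - σ) / d))
      (d / ((x - σ) ^ 2 + d ^ 2)) x := by
    have := (((hasDerivAt_id x).sub_const σ).div_const d).arctan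
    convert! this using 1
    simp only [id]
    field_simp
    ring
  have h3 := h1.ofReal_comp.add (h2.ofReal_comp.mul_const Complex.I)
  convert! h3 using 1
  have hD' : (((x - σ) ^ 2 + d ^ 2 : ℝ) : ℂ) ≠ 0 := by exact_mod_cast hD
  rw [div_eq_iff (ofReal_sub_ne_zero σ x hd)]
  push_cast at hD' ⊢
  field_simp
  ring_nf
  simp only [Complex.I_sq]
  ring

theorem tendsto_log_ratio (σ τ d e : ℝ) (hd : d ≠ 0) (he : e ≠ 0) :
    Tendsto (fun x : ℝ => Real.log ((x - σ) ^ 2 + d ^ 2) / 2 - Real.log ((x - τ) ^ 2 + e ^ 2) / 2)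
      (cocompact ℝ) (𝓝 0) := by
  have hinv : Tendsto (fun x : ℝ => x⁻¹) (cocompact ℝ) (𝓝 0) := by
    rw [← Metric.cobounded_eq_cocompact]
    exact tendsto_inv₀_cobounded
  have h1 : ∀ σ d : ℝ, Tendsto (fun x : ℝ => (1 - σ * x⁻¹) ^ 2 + d ^ 2 * (x⁻¹) ^ 2)
      (cocompact ℝ) (𝓝 1) := by
    intro σ d
    have := ((tendsto_const_nhds (x := (1:ℝ))).sub (hinv.const_mul σ)).pow 2 |>.add
      ((hinv.pow 2).const_mul (d ^ 2))
    simpa using this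
  have h2 := (((h1 σ d).log one_ne_zero).sub ((h1 τ e).log one_ne_zero)).div_const 2
  simp only [Real.log_one, sub_zero, zero_div] at h2
  refine h2.congr' ?_
  have h0 : ∀ᶠ x : ℝ in cocompact ℝ, x ≠ 0 := by
    have := (Set.finite_singleton (0:ℝ)).isCompact.compl_mem_cocompact
    filter_upwards [this] with x hx using hx
  filter_upwards [h0] with x hx
  have e1 : ∀ σ d : ℝ, d ≠ 0 → Real.log ((x - σ) ^ 2 + d ^ 2) =
      Real.log (x ^ 2) + Real.log ((1 - σ * x⁻¹) ^ 2 + d ^ 2 * (x⁻¹) ^ 2) := by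
    intro σ d hd
    rw [← Real.log_mul (by positivity) (by positivity)]
    congr 1
    field_simp
  rw [e1 σ d hd, e1 τ e he]
  ring

theorem tendsto_arctan_div_atTop (σ d : ℝ) (hd : d ≠ 0) :
    Tendsto (fun x : ℝ => Real.arctan ((x - σ) / d)) atTop (𝓝 (SignType.sign d * (Real.pi / 2))) := by
  have hx : Tendsto (fun x : ℝ => x - σ) atTop atTop := tendsto_atTop_add_const_right _ _ tendsto_id
  rcases lt_or_gt_of_ne hd with h | h
  · have := (hx.atTop_div_const_of_neg h)
    simpa [sign_neg h, Function.comp_def] using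
      (Real.tendsto_arctan_atBot.mono_right nhdsWithin_le_nhds).comp this
  · have := (hx.atTop_div_const h)
    simpa [sign_pos h, Function.comp_def] using
      (Real.tendsto_arctan_atTop.mono_right nhdsWithin_le_nhds).comp this

theorem tendsto_arctan_div_atBot (σ d : ℝ) (hd : d ≠ 0) :
    Tendsto (fun x : ℝ => Real.arctan ((x - σ) / d)) atBot
      (𝓝 (-(SignType.sign d * (Real.pi / 2)))) := by
  have := (tendsto_arctan_div_atTop (-σ) d hd).neg.comp tendsto_neg_atBot_atTop
  refine this.congr fun x => ?_
  simp only [Function.comp]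
  rw [← Real.arctan_neg]
  congr 1
  ring

/-- The difference of two primitives `logPrimitive` has limits at both ends; the logarithms cancel. -/
theorem tendsto_logPrimitive_sub_atTop (σ τ d e : ℝ) (hd : d ≠ 0) (he : e ≠ 0) :
    Tendsto (fun x : ℝ => logPrimitive σ d x - logPrimitive τ e x) atTop
      (𝓝 (((SignType.sign d : ℝ) - (SignType.sign e : ℝ) : ℝ) * (Real.pi / 2) * Complex.I)) := by
  have h1 := (tendsto_log_ratio σ τ d e hd he).mono_left atTop_le_cocompact
  have h2 := (tendsto_arctan_div_atTop σ d hd).sub (tendsto_arctan_div_atTop τ e he)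
  have h3 := (Complex.continuous_ofReal.tendsto _).comp h1 |>.add
    (((Complex.continuous_ofReal.tendsto _).comp h2).mul_const Complex.I)
  convert h3 using 2
  · simp only [logPrimitive, Function.comp]
    push_cast
    ring
  · push_cast
    ring

theorem tendsto_logPrimitive_sub_atBot (σ τ d e : ℝ) (hd : d ≠ 0) (he : e ≠ 0) :
    Tendsto (fun x : ℝ => logPrimitive σ d x - logPrimitive τ e x) atBot
      (𝓝 (-(((SignType.sign d : ℝ) - (SignType.sign e : ℝ) : ℝ) * (Real.pi / 2) * Complex.I))) := by
  have h1 := (tendsto_log_ratio σ τ d e hd he).mono_left atBot_le_cocompact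
  have h2 := (tendsto_arctan_div_atBot σ d hd).sub (tendsto_arctan_div_atBot τ e he)
  have h3 := (Complex.continuous_ofReal.tendsto _).comp h1 |>.add
    (((Complex.continuous_ofReal.tendsto _).comp h2).mul_const Complex.I)
  convert h3 using 2
  · simp only [logPrimitive, Function.comp]
    push_cast
    ring
  · push_cast
    ring

theorem norm_ofReal_sub (σ d x : ℝ) :
    ‖(x : ℂ) - (σ + d * Complex.I)‖ = Real.sqrt ((x - σ) ^ 2 + d ^ 2) := by
  have : (x : ℂ) - (σ + d * Complex.I) = ((x - σ : ℝ) : ℂ) + ((-d : ℝ) : ℂ) * Complex.I := by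
    push_cast; ring
  rw [this, Complex.norm_add_mul_I]
  congr 1
  ring

theorem tendsto_inv_ofReal_sub (σ d : ℝ) :
    Tendsto (fun x : ℝ => 1 / ((x : ℂ) - (σ + d * Complex.I))) (cocompact ℝ) (𝓝 0) := by
  rw [tendsto_zero_iff_norm_tendsto_zero]
  have hinv : Tendsto (fun x : ℝ => |x|⁻¹) (cocompact ℝ) (𝓝 0) :=
    tendsto_inv_atTop_zero.comp (by simpa using! tendsto_norm_cocompact_atTop (E := ℝ))
  have hs : Tendsto (fun x : ℝ => |x - σ|⁻¹) (cocompact ℝ) (𝓝 0) :=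
    hinv.comp (Homeomorph.subRight σ).isClosedEmbedding.tendsto_cocompact
  have h0 : ∀ᶠ x : ℝ in cocompact ℝ, x ≠ σ := by
    have := (Set.finite_singleton σ).isCompact.compl_mem_cocompact
    filter_upwards [this] with x hx using hx
  refine squeeze_zero' (Eventually.of_forall fun _ => norm_nonneg _) ?_ hs
  filter_upwards [h0] with x hx
  rw [norm_div, norm_one, one_div, norm_ofReal_sub]
  have hx' : 0 < |x - σ| := abs_pos.2 (sub_ne_zero.2 hx)
  gcongr
  rw [← Real.sqrt_sq_eq_abs]
  apply Real.sqrt_le_sqrt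
  nlinarith [sq_nonneg d]

theorem integrable_inv_sq_add_sq (σ : ℝ) {d : ℝ} (hd : d ≠ 0) :
    Integrable fun x : ℝ => 1 / ((x - σ) ^ 2 + d ^ 2) := by
  have h := ((integrable_inv_one_add_sq.comp_div hd).comp_sub_right σ).const_mul (1 / d ^ 2)
  refine h.congr (Eventually.of_forall fun x => ?_)
  have : (x - σ) ^ 2 + d ^ 2 ≠ 0 := by positivity
  simp only
  field_simp
  ring

/-- Residue calculus for `-1 / ((x - a)² (x - b))` with `a = σ + i d`, `b = τ + i e`. -/
theorem integral_inv_sq_mul_inv (σ τ d e : ℝ) (hd : d ≠ 0) (he : e ≠ 0) :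
    Integrable (fun x : ℝ => -1 / (((x : ℂ) - (σ + d * Complex.I)) ^ 2 *
      ((x : ℂ) - (τ + e * Complex.I)))) ∧
    ∫ x : ℝ, -1 / (((x : ℂ) - (σ + d * Complex.I)) ^ 2 * ((x : ℂ) - (τ + e * Complex.I))) =
      -(((SignType.sign e : ℝ) - (SignType.sign d : ℝ) : ℝ) * Real.pi * Complex.I) /
        ((τ + e * Complex.I) - (σ + d * Complex.I)) ^ 2 := by
  have hI : Integrable (fun x : ℝ => -1 / (((x : ℂ) - (σ + d * Complex.I)) ^ 2 *
      ((x : ℂ) - (τ + e * Complex.I)))) := by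
    refine ((integrable_inv_sq_add_sq σ hd).mul_const (1 / |e|)).mono' ?_ ?_
    · apply Continuous.aestronglyMeasurable
      refine continuous_const.div (by fun_prop) fun x => ?_
      exact mul_ne_zero (pow_ne_zero _ (ofReal_sub_ne_zero _ _ hd)) (ofReal_sub_ne_zero _ _ he)
    · refine Eventually.of_forall fun x => ?_
      rw [norm_div, norm_neg, norm_one, norm_mul, norm_pow, norm_ofReal_sub, norm_ofReal_sub,
        Real.sq_sqrt (by positivity), ← one_div_mul_one_div]
      gcongr
      rw [← Real.sqrt_sq_eq_abs]
      apply Real.sqrt_le_sqrt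
      nlinarith [sq_nonneg (x - τ)]
  refine ⟨hI, ?_⟩
  set a : ℂ := σ + d * Complex.I with ha
  set b : ℂ := τ + e * Complex.I with hb
  have hxa : ∀ x : ℝ, (x : ℂ) - a ≠ 0 := fun x => ofReal_sub_ne_zero σ x hd
  have hxb : ∀ x : ℝ, (x : ℂ) - b ≠ 0 := fun x => ofReal_sub_ne_zero τ x he
  have hder : ∀ x : ℝ, HasDerivAt (fun x : ℝ => 1 / ((x : ℂ) - a)) (-1 / ((x : ℂ) - a) ^ 2) x := by
    intro x
    have := (((hasDerivAt_id (x : ℂ)).sub_const a).inv (hxa x)).comp_ofReal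
    simpa [one_div] using this
  by_cases hab : b - a = 0
  · -- a double pole on one side: the primitive is rational
    have hab' : b = a := sub_eq_zero.1 hab
    have hde : d = e := by
      have := congrArg Complex.im hab'
      simp [ha, hb] at this
      exact this.symm
    rw [hab]
    have hprim : ∀ x : ℝ, HasDerivAt (fun x : ℝ => (1 / ((x : ℂ) - a)) ^ 2 / 2)
        (-1 / (((x : ℂ) - a) ^ 2 * ((x : ℂ) - b))) x := by
      intro x
      have := ((hder x).pow 2).div_const 2
      convert! this using 1
      have := hxa x
      rw [hab']
      simp only [Nat.add_one_sub_one, pow_one, Nat.cast_ofNat]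
      field_simp
    have hlim : ∀ l ≤ cocompact ℝ, Tendsto (fun x : ℝ => (1 / ((x : ℂ) - a)) ^ 2 / 2) l (𝓝 0) := by
      intro l hl
      have := (((tendsto_inv_ofReal_sub σ d).mono_left hl).pow 2).div_const 2
      simpa using this
    rw [integral_of_hasDerivAt_of_tendsto hprim hI (hlim _ atBot_le_cocompact)
      (hlim _ atTop_le_cocompact)]
    simp [hde]
  · set k : ℂ := 1 / (b - a) with hk
    have hprim : ∀ x : ℝ, HasDerivAt
        (fun x : ℝ => -k ^ 2 * (logPrimitive τ e x - logPrimitive σ d x) - k * (1 / ((x : ℂ) - a)))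
        (-1 / (((x : ℂ) - a) ^ 2 * ((x : ℂ) - b))) x := by
      intro x
      have := (((hasDerivAt_logPrimitive τ x he).sub (hasDerivAt_logPrimitive σ x hd)).const_mul
        (-k ^ 2)).sub ((hder x).const_mul k)
      convert! this using 1
      have h1 := hxa x
      have h2 := hxb x
      rw [← ha, ← hb, hk]
      field_simp
      ring
    have ht := ((tendsto_logPrimitive_sub_atTop τ σ e d he hd).const_mul (-k ^ 2)).sub
      (((tendsto_inv_ofReal_sub σ d).mono_left atTop_le_cocompact).const_mul k)
    have hb' := ((tendsto_logPrimitive_sub_atBot τ σ e d he hd).const_mul (-k ^ 2)).sub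
      (((tendsto_inv_ofReal_sub σ d).mono_left atBot_le_cocompact).const_mul k)
    rw [integral_of_hasDerivAt_of_tendsto hprim hI hb' ht, hk]
    field_simp
    push_cast
    ring

/-- The convolution of the derivative of the Poisson kernel with the conjugate Poisson kernel. -/
theorem integral_poisson_deriv_mul_conj {c d : ℝ} (hc : 0 < c) (hd : 0 < d) (s t : ℝ) :
    ∫ x : ℝ, (2 * (x - s) * c / (Real.pi * ((x - s) ^ 2 + c ^ 2) ^ 2)) *
      ((x - t) / (Real.pi * ((x - t) ^ 2 + d ^ 2))) = gramKernel (c + d) (s - t) := by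
  -- with `X = x - (s - i c)` and `Y = x - (t + i d)`, the integrand is the imaginary part of
  -- `-(1 / (X² Y) + 1 / (X² Y'))` up to a factor, where `Y'` is the conjugate of `Y`
  obtain ⟨hi1, h1⟩ := integral_inv_sq_mul_inv s t (-c) d (neg_ne_zero.2 hc.ne') hd.ne'
  obtain ⟨hi2, h2⟩ := integral_inv_sq_mul_inv s t (-c) (-d) (neg_ne_zero.2 hc.ne')
    (neg_ne_zero.2 hd.ne')
  have him := Complex.imCLM.integral_comp_comm (hi1.add hi2)
  simp only [Pi.add_apply] at him
  rw [integral_add hi1 hi2, h1, h2] at him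
  simp only [sign_neg (neg_lt_zero.2 hc), sign_neg (neg_lt_zero.2 hd), sign_pos hd] at him
  have hpt : ∀ x : ℝ, (2 * (x - s) * c / (Real.pi * ((x - s) ^ 2 + c ^ 2) ^ 2)) *
      ((x - t) / (Real.pi * ((x - t) ^ 2 + d ^ 2))) = (1 / (2 * Real.pi ^ 2)) *
      Complex.imCLM (-1 / (((x : ℂ) - (s + (-c : ℝ) * Complex.I)) ^ 2 *
        ((x : ℂ) - (t + d * Complex.I))) + -1 / (((x : ℂ) - (s + (-c : ℝ) * Complex.I)) ^ 2 *
        ((x : ℂ) - (t + (-d : ℝ) * Complex.I)))) := by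
    intro x
    have e1 := ofReal_sub_ne_zero s x (neg_ne_zero.2 hc.ne')
    have e2 := ofReal_sub_ne_zero t x hd.ne'
    have e3 := ofReal_sub_ne_zero t x (neg_ne_zero.2 hd.ne')
    have hA : (x - s) ^ 2 + c ^ 2 ≠ 0 := by positivity
    have hB : (x - t) ^ 2 + d ^ 2 ≠ 0 := by positivity
    have key : (-1 / (((x : ℂ) - (s + (-c : ℝ) * Complex.I)) ^ 2 *
        ((x : ℂ) - (t + d * Complex.I))) + -1 / (((x : ℂ) - (s + (-c : ℝ) * Complex.I)) ^ 2 *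
        ((x : ℂ) - (t + (-d : ℝ) * Complex.I)))) =
        ((-2 * (x - t) / (((x - s) ^ 2 + c ^ 2) ^ 2 * ((x - t) ^ 2 + d ^ 2)) : ℝ) : ℂ) *
        ((((x - s) ^ 2 - c ^ 2 : ℝ) : ℂ) + ((-2 * (x - s) * c : ℝ) : ℂ) * Complex.I) := by
      have hA' : (((x - s) ^ 2 + c ^ 2 : ℝ) : ℂ) ≠ 0 := by exact_mod_cast hA
      have hB' : (((x - t) ^ 2 + d ^ 2 : ℝ) : ℂ) ≠ 0 := by exact_mod_cast hB
      have f1 : (((x - s) ^ 2 + c ^ 2 : ℝ) : ℂ) = ((x : ℂ) - (s + (-c : ℝ) * Complex.I)) *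
          ((x : ℂ) - (s + (c : ℝ) * Complex.I)) := by
        push_cast; ring_nf; simp only [Complex.I_sq]; ring
      have f2 : (((x - t) ^ 2 + d ^ 2 : ℝ) : ℂ) = ((x : ℂ) - (t + d * Complex.I)) *
          ((x : ℂ) - (t + (-d : ℝ) * Complex.I)) := by
        push_cast; ring_nf; simp only [Complex.I_sq]; ring
      have e4 := ofReal_sub_ne_zero s x hc.ne'
      rw [Complex.ofReal_div, Complex.ofReal_mul _ ((x - t) ^ 2 + d ^ 2), Complex.ofReal_pow, f1,
        f2]
      have f3 : ((((x - s) ^ 2 - c ^ 2 : ℝ) : ℂ) + ((-2 * (x - s) * c : ℝ) : ℂ) * Complex.I) =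
          ((x : ℂ) - (s + (c : ℝ) * Complex.I)) ^ 2 := by
        push_cast; ring_nf; simp only [Complex.I_sq]; ring
      rw [f3]
      have f4 : ((-2 * (x - t) : ℝ) : ℂ) = -(((x : ℂ) - (t + d * Complex.I)) +
          ((x : ℂ) - (t + (-d : ℝ) * Complex.I))) := by
        push_cast; ring
      rw [f4]
      generalize (x : ℂ) - (s + (-c : ℝ) * Complex.I) = X at e1 ⊢
      generalize (x : ℂ) - (s + c * Complex.I) = X' at e4 ⊢
      generalize (x : ℂ) - (t + d * Complex.I) = Y at e2 ⊢
      generalize (x : ℂ) - (t + (-d : ℝ) * Complex.I) = Z at e3 ⊢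
      field_simp
      ring
    rw [key, Complex.imCLM_apply, Complex.im_ofReal_mul]
    simp only [Complex.add_im, Complex.ofReal_im, Complex.im_ofReal_mul, Complex.I_im]
    field_simp
    ring
  simp_rw [hpt]
  rw [integral_const_mul, him, Complex.imCLM_apply]
  have hE : (s - t) ^ 2 + (c + d) ^ 2 ≠ 0 := by positivity
  have e6 : (t : ℂ) + d * Complex.I - (s + (-c : ℝ) * Complex.I) =
      -(((s - t : ℝ) : ℂ) - ((c + d : ℝ) : ℂ) * Complex.I) := by
    push_cast; ring
  have e7 : (((s - t) ^ 2 + (c + d) ^ 2 : ℝ) : ℂ) = (((s - t : ℝ) : ℂ) - ((c + d : ℝ) : ℂ) *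
      Complex.I) * (((s - t : ℝ) : ℂ) + ((c + d : ℝ) : ℂ) * Complex.I) := by
    push_cast; ring_nf; simp only [Complex.I_sq]; ring
  have hE' : (((s - t) ^ 2 + (c + d) ^ 2 : ℝ) : ℂ) ≠ 0 := by exact_mod_cast hE
  have e8 : -(((((1 : SignType) : ℝ) - ((-1 : SignType) : ℝ) : ℝ) : ℂ) * Real.pi * Complex.I) /
      ((t : ℂ) + d * Complex.I - (s + (-c : ℝ) * Complex.I)) ^ 2 =
      ((-2 * Real.pi / ((s - t) ^ 2 + (c + d) ^ 2) ^ 2 : ℝ) : ℂ) *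
        (((-2 * (s - t) * (c + d) : ℝ) : ℂ) +
          (((s - t) ^ 2 - (c + d) ^ 2 : ℝ) : ℂ) * Complex.I) := by
    have e9 : (((-2 * (s - t) * (c + d) : ℝ) : ℂ) +
          (((s - t) ^ 2 - (c + d) ^ 2 : ℝ) : ℂ) * Complex.I) =
        (((s - t : ℝ) : ℂ) + ((c + d : ℝ) : ℂ) * Complex.I) ^ 2 * Complex.I := by
      push_cast; ring_nf; simp only [Complex.I_sq, Complex.I_pow_three]; ring
    rw [e9, e6, Complex.ofReal_div, Complex.ofReal_pow, e7]
    rw [e7] at hE'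
    have g1 := left_ne_zero_of_mul hE'
    have g2 := right_ne_zero_of_mul hE'
    simp only [SignType.coe_one, SignType.coe_neg_one]
    generalize ((s - t : ℝ) : ℂ) - ((c + d : ℝ) : ℂ) * Complex.I = X at g1 ⊢
    generalize ((s - t : ℝ) : ℂ) + ((c + d : ℝ) : ℂ) * Complex.I = Y at g2 ⊢
    field_simp
    push_cast
    ring
  rw [e8]
  simp only [sub_self, Complex.ofReal_zero, zero_mul, neg_zero, zero_div, add_zero]
  rw [Complex.im_ofReal_mul]
  simp only [Complex.add_im, Complex.ofReal_im, Complex.im_ofReal_mul, Complex.I_im, gramKernel]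
  field_simp
  ring

/-! ### Gradients and cut-offs in the half-plane -/

theorem halfPlaneVolume_le : halfPlaneVolume ≤ volume := Measure.restrict_le_self

theorem measurableSet_halfPlane : MeasurableSet {p : ℝ × ℝ | 0 < p.2} :=
  measurableSet_lt measurable_const measurable_snd

theorem ae_halfPlane_pos : ∀ᵐ p ∂halfPlaneVolume, 0 < p.2 :=
  ae_restrict_mem measurableSet_halfPlane

theorem continuous_plane_mk {X : Type*} [TopologicalSpace X] {a b : X → ℝ} (ha : Continuous a)
    (hb : Continuous b) : Continuous fun x => (!₂[a x, b x] : Plane) := by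
  refine (PiLp.continuous_toLp 2 _).comp (continuous_pi fun i => ?_)
  fin_cases i
  · exact ha
  · exact hb

theorem norm_plane_mk (a b : ℝ) : ‖(!₂[a, b] : Plane)‖ = Real.sqrt (a ^ 2 + b ^ 2) := by
  simp [EuclideanSpace.norm_eq]

theorem norm_plane_mk_le (a b : ℝ) : ‖(!₂[a, b] : Plane)‖ ≤ |a| + |b| := by
  rw [norm_plane_mk, Real.sqrt_le_left (by positivity)]
  nlinarith [sq_abs a, sq_abs b, abs_nonneg a, abs_nonneg b]

theorem inner_plane_mk (a b c d : ℝ) :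
    inner ℝ (!₂[a, b] : Plane) !₂[c, d] = a * c + b * d := by
  simp [PiLp.inner_apply, Fin.sum_univ_two]
  ring

theorem norm_grad_le (f : ℝ × ℝ → ℝ) (p : ℝ × ℝ) : ‖grad f p‖ ≤ 2 * ‖fderiv ℝ f p‖ := by
  have h1 := (fderiv ℝ f p).le_opNorm (1, 0)
  have h2 := (fderiv ℝ f p).le_opNorm (0, 1)
  have h3 := norm_plane_mk_le (fderiv ℝ f p (1, 0)) (fderiv ℝ f p (0, 1))
  simp [Prod.norm_def] at h1 h2
  unfold grad
  linarith

theorem continuous_grad {f : ℝ × ℝ → ℝ} (hf : ContDiff ℝ ∞ f) : Continuous (grad f) := by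
  have := hf.continuous_fderiv (by simp)
  exact continuous_plane_mk (by fun_prop) (by fun_prop)

theorem grad_mul {f g : ℝ × ℝ → ℝ} {p : ℝ × ℝ} (hf : DifferentiableAt ℝ f p)
    (hg : DifferentiableAt ℝ g p) :
    grad (fun q => f q * g q) p = f p • grad g p + g p • grad f p := by
  unfold grad
  rw [fderiv_fun_mul hf hg]
  ext i
  fin_cases i <;> simp

theorem grad_eq_zero_of_notMem_tsupport {f : ℝ × ℝ → ℝ} {p : ℝ × ℝ} (hp : p ∉ tsupport f) :
    grad f p = 0 := by
  have h : fderiv ℝ f p = 0 := by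
    by_contra h
    exact hp (support_fderiv_subset ℝ h)
  unfold grad
  rw [h]
  ext i
  fin_cases i <;> simp

theorem IsTestFunction.hasCompactSupport_grad {ζ : ℝ × ℝ → ℝ} (hζ : IsTestFunction ζ) :
    HasCompactSupport (grad ζ) :=
  HasCompactSupport.intro' hζ.2 (isClosed_tsupport ζ)
    fun _ hp => grad_eq_zero_of_notMem_tsupport hp

theorem IsTestFunction.memLp_grad {ζ : ℝ × ℝ → ℝ} (hζ : IsTestFunction ζ) :
    MemLp (grad ζ) 2 halfPlaneVolume :=
  ((continuous_grad hζ.1).memLp_of_hasCompactSupport hζ.hasCompactSupport_grad).mono_measure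
    halfPlaneVolume_le

theorem IsTestFunction.toLp_mem {ζ : ℝ × ℝ → ℝ} (hζ : IsTestFunction ζ) :
    hζ.memLp_grad.toLp (grad ζ) ∈ HDot1 :=
  Submodule.le_topologicalClosure _ (Submodule.subset_span ⟨ζ, hζ, hζ.memLp_grad.coeFn_toLp⟩)

theorem integral_inner_eq {v : Lp Plane 2 halfPlaneVolume} {F : ℝ × ℝ → Plane}
    (hF : MemLp F 2 halfPlaneVolume) :
    ∫ p, inner ℝ (v p) (F p) ∂halfPlaneVolume = inner ℝ v (hF.toLp F) := by
  rw [L2.inner_def]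
  refine integral_congr_ae ?_
  filter_upwards [hF.coeFn_toLp] with p hp
  rw [hp]

/-- The decay `(1 + |p|)⁻²` is square integrable in the plane. -/
theorem integrable_decay :
    Integrable (fun p : ℝ × ℝ => ((1 + ‖p‖)⁻¹ ^ 2) ^ 2) halfPlaneVolume := by
  have h := integrable_one_add_norm (E := ℝ × ℝ) (μ := volume) (r := 4) (by simp; norm_num)
  refine (h.mono_measure halfPlaneVolume_le).congr (Eventually.of_forall fun p => ?_)
  have : (0:ℝ) ≤ 1 + ‖p‖ := by positivity
  simp only
  rw [Real.rpow_neg this, show (4:ℝ) = ((4:ℕ):ℝ) by norm_num, Real.rpow_natCast, ← pow_mul,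
    inv_pow]

theorem memLp_of_decay {F : ℝ × ℝ → Plane} (hF : AEStronglyMeasurable F halfPlaneVolume) {C : ℝ}
    (hC : ∀ p : ℝ × ℝ, 0 < p.2 → ‖F p‖ ≤ C * (1 + ‖p‖)⁻¹ ^ 2) : MemLp F 2 halfPlaneVolume := by
  rw [memLp_two_iff_integrable_sq_norm hF]
  refine (integrable_decay.const_mul (C ^ 2)).mono' (hF.norm.pow 2) ?_
  filter_upwards [ae_halfPlane_pos] with p hp
  rw [Real.norm_of_nonneg (by positivity), ← mul_pow]
  exact pow_le_pow_left₀ (norm_nonneg _) (hC p hp) 2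

theorem norm_toLp_sq {F : ℝ × ℝ → Plane} (hF : MemLp F 2 halfPlaneVolume) :
    ‖hF.toLp F‖ ^ 2 = ∫ p, ‖F p‖ ^ 2 ∂halfPlaneVolume := by
  rw [← real_inner_self_eq_norm_sq, L2.inner_def]
  refine integral_congr_ae ?_
  filter_upwards [hF.coeFn_toLp] with p hp
  rw [hp, real_inner_self_eq_norm_sq]

/-- A smooth function that decays like `1 / |p|`, with gradient decaying like `1 / |p|²`, is
approximated by the test functions that arise from it by cutting off at larger and larger scales. -/
theorem exists_test_approx {U : ℝ × ℝ → ℝ} (hU : ContDiff ℝ ∞ U) {C : ℝ}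
    (h0 : ∀ p : ℝ × ℝ, 0 < p.2 → |U p| ≤ C * (1 + ‖p‖)⁻¹)
    (h1 : ∀ p : ℝ × ℝ, 0 < p.2 → ‖grad U p‖ ≤ C * (1 + ‖p‖)⁻¹ ^ 2)
    (hL : MemLp (grad U) 2 halfPlaneVolume) :
    ∃ ζ : ℕ → ℝ × ℝ → ℝ, ∃ hζ : ∀ n, IsTestFunction (ζ n),
      Tendsto (fun n => (hζ n).memLp_grad.toLp (grad (ζ n))) atTop (𝓝 (hL.toLp (grad U))) ∧
      (∀ p, Tendsto (fun n => ζ n p) atTop (𝓝 (U p))) ∧ ∀ n p, |ζ n p| ≤ |U p| := by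
  let η : ContDiffBump (0 : ℝ × ℝ) := ⟨1, 2, one_pos, one_lt_two⟩
  have hηs : ContDiff ℝ ∞ η := η.contDiff
  obtain ⟨M, hM⟩ : ∃ M : ℝ, ∀ p, ‖fderiv ℝ η p‖ ≤ M := by
    have hc := hηs.continuous_fderiv (by simp)
    obtain ⟨M, hM⟩ := hc.bounded_above_of_compact_support (η.hasCompactSupport.fderiv ℝ)
    exact ⟨M, hM⟩
  have hM0 : 0 ≤ M := (norm_nonneg _).trans (hM 0)
  let r : ℕ → ℝ := fun n => 1 / ((n : ℝ) + 1)
  have hr : ∀ n, 0 < r n := fun n => by positivity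
  let χ : ℕ → ℝ × ℝ → ℝ := fun n p => η (r n • p)
  have hχs : ∀ n, ContDiff ℝ ∞ (χ n) := fun n => hηs.comp (contDiff_const_smul (r n))
  have hχd : ∀ n p, fderiv ℝ (χ n) p = r n • fderiv ℝ η (r n • p) := by
    intro n p
    exact fderiv_comp_smul (r n)
  -- on the region where the cut-off varies, `r n` is comparable to `(1 + |p|)⁻¹`
  have hχg : ∀ n p, ‖grad (χ n) p‖ ≤ 6 * M * (1 + ‖p‖)⁻¹ := by
    intro n p
    refine (norm_grad_le _ _).trans ?_
    rw [hχd]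
    by_cases hp : r n * ‖p‖ ≤ 2
    · rw [norm_smul, Real.norm_of_nonneg (hr n).le]
      have h3 : r n ≤ 3 * (1 + ‖p‖)⁻¹ := by
        rw [← div_eq_mul_inv, le_div_iff₀ (by positivity)]
        have : r n ≤ 1 := by
          simp only [r]
          rw [div_le_one (by positivity)]
          linarith [(Nat.cast_nonneg n : (0:ℝ) ≤ n)]
        linarith
      calc 2 * (r n * ‖fderiv ℝ η (r n • p)‖) ≤ 2 * (3 * (1 + ‖p‖)⁻¹ * M) := by
            gcongr
            exact hM _
        _ = _ := by ring
    · have : fderiv ℝ η (r n • p) = 0 := by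
        by_contra h
        have := support_fderiv_subset ℝ h
        rw [η.tsupport_eq] at this
        simp only [Metric.mem_closedBall, dist_zero_right, norm_smul,
          Real.norm_of_nonneg (hr n).le] at this
        exact hp this
      rw [this]
      simp
      positivity
  have hζ : ∀ n, IsTestFunction (fun p => χ n p * U p) := by
    intro n
    refine ⟨(hχs n).mul hU, ?_⟩
    have : HasCompactSupport (χ n) :=
      η.hasCompactSupport.comp_homeomorph (Homeomorph.smulOfNeZero (r n) (hr n).ne')
    exact this.mul_right
  have hev : ∀ p, ∀ᶠ n in atTop, ∀ᶠ q in 𝓝 p, χ n q = 1 := by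
    intro p
    have ht : Tendsto (fun n => r n * (‖p‖ + 1)) atTop (𝓝 0) := by
      simpa [r] using tendsto_one_div_add_atTop_nhds_zero_nat.mul_const (‖p‖ + 1)
    filter_upwards [ht.eventually (gt_mem_nhds one_pos)] with n hn
    filter_upwards [Metric.ball_mem_nhds p one_pos] with q hq
    refine η.one_of_mem_closedBall ?_
    simp only [Metric.mem_closedBall, dist_zero_right, norm_smul, Real.norm_of_nonneg (hr n).le]
    have : ‖q‖ ≤ ‖p‖ + 1 := by
      have := norm_le_norm_add_norm_sub' q p
      rw [Metric.mem_ball, dist_eq_norm] at hq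
      linarith
    exact (mul_le_mul_of_nonneg_left this (hr n).le).trans hn.le
  refine ⟨fun n p => χ n p * U p, hζ, ?_, ?_, ?_⟩
  · rw [tendsto_iff_norm_sub_tendsto_zero]
    have hsq : Tendsto (fun n => ∫ p, ‖grad (fun p => χ n p * U p) p - grad U p‖ ^ 2
        ∂halfPlaneVolume) atTop (𝓝 (∫ _, (0:ℝ) ∂halfPlaneVolume)) := by
      refine tendsto_integral_of_dominated_convergence
        (fun p => ((2 + 6 * M) * |C|) ^ 2 * ((1 + ‖p‖)⁻¹ ^ 2) ^ 2) ?_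
        (integrable_decay.const_mul _) ?_ ?_
      · intro n
        exact (((continuous_grad (hζ n).1).sub (continuous_grad hU)).norm.pow 2).aestronglyMeasurable
      · intro n
        filter_upwards [ae_halfPlane_pos] with p hp
        rw [Real.norm_of_nonneg (by positivity), ← mul_pow]
        refine pow_le_pow_left₀ (norm_nonneg _) ?_ 2
        rw [grad_mul ((hχs n).differentiable (by simp) p) (hU.differentiable (by simp) p)]
        have e1 : ‖χ n p • grad U p‖ ≤ |C| * (1 + ‖p‖)⁻¹ ^ 2 := by
          rw [norm_smul, Real.norm_of_nonneg η.nonneg]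
          calc χ n p * ‖grad U p‖ ≤ 1 * ‖grad U p‖ := by
                gcongr
                exact η.le_one
            _ ≤ C * (1 + ‖p‖)⁻¹ ^ 2 := by rw [one_mul]; exact h1 p hp
            _ ≤ _ := by gcongr; exact le_abs_self C
        have e2 : ‖U p • grad (χ n) p‖ ≤ 6 * M * |C| * (1 + ‖p‖)⁻¹ ^ 2 := by
          rw [norm_smul, Real.norm_eq_abs]
          calc |U p| * ‖grad (χ n) p‖ ≤ (|C| * (1 + ‖p‖)⁻¹) * (6 * M * (1 + ‖p‖)⁻¹) := by
                gcongr
                · exact (h0 p hp).trans (by gcongr; exact le_abs_self C)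
                · exact hχg n p
            _ = _ := by ring
        have e3 : ‖grad U p‖ ≤ |C| * (1 + ‖p‖)⁻¹ ^ 2 :=
          (h1 p hp).trans (by gcongr; exact le_abs_self C)
        calc _ ≤ ‖χ n p • grad U p + U p • grad (χ n) p‖ + ‖grad U p‖ := norm_sub_le _ _
          _ ≤ ‖χ n p • grad U p‖ + ‖U p • grad (χ n) p‖ + ‖grad U p‖ := by
            gcongr; exact norm_add_le _ _
          _ ≤ _ := by linarith
      · refine Eventually.of_forall fun p => ?_
        refine tendsto_const_nhds.congr' ?_
        filter_upwards [hev p] with n hn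
        have : grad (fun p => χ n p * U p) p = grad U p := by
          have : (fun p => χ n p * U p) =ᶠ[𝓝 p] U := by
            filter_upwards [hn] with q hq
            rw [hq, one_mul]
          unfold grad
          rw [this.fderiv_eq]
        rw [this]
        simp
    rw [integral_zero] at hsq
    have := hsq.sqrt
    rw [Real.sqrt_zero] at this
    refine this.congr fun n => ?_
    rw [← MemLp.toLp_sub, ← Real.sqrt_sq (norm_nonneg _), norm_toLp_sq]
    rfl
  · intro p
    refine tendsto_const_nhds.congr' ?_
    filter_upwards [hev p] with n hn
    rw [hn.self_of_nhds, one_mul]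
  · intro n p
    rw [abs_mul, abs_of_nonneg η.nonneg]
    exact mul_le_of_le_one_left (abs_nonneg _) η.le_one

/-! ### Potentials with Poisson kernels as boundary charges -/

/-- The conjugate Poisson kernel `(x - t) / (π ((x - t)² + (y + c)²))` with pole `(t, -c)`. The term
`expNegInvGlue (-y)`, which vanishes for `y ≥ 0`, removes the pole, so that the function is smooth
on the whole plane. -/
def conjPoisson (c t : ℝ) (p : ℝ × ℝ) : ℝ :=
  (p.1 - t) / (Real.pi * ((p.1 - t) ^ 2 + (p.2 + c) ^ 2 + expNegInvGlue (-p.2)))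

/-- First component of the gradient of the conjugate Poisson kernel. -/
def fieldFst (c t : ℝ) (p : ℝ × ℝ) : ℝ :=
  ((p.2 + c) ^ 2 - (p.1 - t) ^ 2) / (Real.pi * ((p.1 - t) ^ 2 + (p.2 + c) ^ 2) ^ 2)

/-- Second component of the gradient of the conjugate Poisson kernel. -/
def fieldSnd (c t : ℝ) (p : ℝ × ℝ) : ℝ :=
  -(2 * (p.1 - t) * (p.2 + c)) / (Real.pi * ((p.1 - t) ^ 2 + (p.2 + c) ^ 2) ^ 2)

theorem conjPoisson_denom_pos {c : ℝ} (hc : 0 < c) (t : ℝ) (p : ℝ × ℝ) :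
    0 < (p.1 - t) ^ 2 + (p.2 + c) ^ 2 + expNegInvGlue (-p.2) := by
  rcases lt_or_ge p.2 0 with h | h
  · have := expNegInvGlue.pos_of_pos (neg_pos.2 h)
    positivity
  · have := expNegInvGlue.nonneg (-p.2)
    positivity

theorem contDiff_conjPoisson {c : ℝ} (hc : 0 < c) (t : ℝ) : ContDiff ℝ ∞ (conjPoisson c t) := by
  unfold conjPoisson
  refine ContDiff.div (by fun_prop) ?_ fun p =>
    (mul_pos Real.pi_pos (conjPoisson_denom_pos hc t p)).ne'
  have := (expNegInvGlue.contDiff (n := ⊤)).comp (contDiff_snd (𝕜 := ℝ) (E := ℝ) (F := ℝ)).neg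
  exact contDiff_const.mul (ContDiff.add (by fun_prop) this)

theorem conjPoisson_of_nonneg (c t : ℝ) {p : ℝ × ℝ} (hp : 0 ≤ p.2) :
    conjPoisson c t p = (p.1 - t) / (Real.pi * ((p.1 - t) ^ 2 + (p.2 + c) ^ 2)) := by
  rw [conjPoisson, expNegInvGlue.zero_of_nonpos (neg_nonpos.2 hp), add_zero]

theorem fderiv_apply_fst {f : ℝ × ℝ → ℝ} {p : ℝ × ℝ} {d : ℝ} (hf : DifferentiableAt ℝ f p)
    (h : HasDerivAt (fun x => f (x, p.2)) d p.1) : fderiv ℝ f p (1, 0) = d := by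
  have h1 : HasDerivAt (fun x : ℝ => (x, p.2)) (1, 0) p.1 :=
    (hasDerivAt_id p.1).prodMk (hasDerivAt_const _ _)
  exact (hf.hasFDerivAt.comp_hasDerivAt p.1 h1).unique h

theorem fderiv_apply_snd {f : ℝ × ℝ → ℝ} {p : ℝ × ℝ} {d : ℝ} (hf : DifferentiableAt ℝ f p)
    (h : HasDerivAt (fun y => f (p.1, y)) d p.2) : fderiv ℝ f p (0, 1) = d := by
  have h1 : HasDerivAt (fun y : ℝ => (p.1, y)) (0, 1) p.2 :=
    (hasDerivAt_const _ _).prodMk (hasDerivAt_id p.2)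
  exact (hf.hasFDerivAt.comp_hasDerivAt p.2 h1).unique h

section

variable {c : ℝ} (hc : 0 < c) (t : ℝ) {p : ℝ × ℝ}
include hc

theorem denom_ne_zero (hp : 0 ≤ p.2) : (p.1 - t) ^ 2 + (p.2 + c) ^ 2 ≠ 0 := by positivity

theorem differentiableAt_fieldFst (hp : 0 ≤ p.2) : DifferentiableAt ℝ (fieldFst c t) p := by
  have := denom_ne_zero hc t hp
  unfold fieldFst
  fun_prop (disch := positivity)

theorem differentiableAt_fieldSnd (hp : 0 ≤ p.2) : DifferentiableAt ℝ (fieldSnd c t) p := by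
  have := denom_ne_zero hc t hp
  unfold fieldSnd
  fun_prop (disch := positivity)

theorem grad_conjPoisson (hp : 0 < p.2) :
    grad (conjPoisson c t) p = !₂[fieldFst c t p, fieldSnd c t p] := by
  have hD := denom_ne_zero hc t hp.le
  have hev : conjPoisson c t =ᶠ[𝓝 p]
      fun p => (p.1 - t) / (Real.pi * ((p.1 - t) ^ 2 + (p.2 + c) ^ 2)) := by
    filter_upwards [(isOpen_lt continuous_const continuous_snd).mem_nhds hp] with q hq
    exact conjPoisson_of_nonneg c t (le_of_lt hq)
  have hd : DifferentiableAt ℝ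
      (fun p : ℝ × ℝ => (p.1 - t) / (Real.pi * ((p.1 - t) ^ 2 + (p.2 + c) ^ 2))) p :=
    by fun_prop (disch := positivity)
  have hpi := Real.pi_ne_zero
  unfold grad
  rw [hev.fderiv_eq, fderiv_apply_fst (d := fieldFst c t p) hd,
    fderiv_apply_snd (d := fieldSnd c t p) hd]
  · have h1 : HasDerivAt (fun y : ℝ => Real.pi * ((p.1 - t) ^ 2 + (y + c) ^ 2))
        (Real.pi * (2 * (p.2 + c))) p.2 := by
      have := ((((hasDerivAt_id p.2).add_const c).pow 2).const_add ((p.1 - t) ^ 2)).const_mul Real.pi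
      simpa using! this
    refine ((hasDerivAt_const p.2 (p.1 - t)).div h1 (by positivity)).congr_deriv ?_
    unfold fieldSnd
    field_simp
    ring
  · have h1 : HasDerivAt (fun x : ℝ => Real.pi * ((x - t) ^ 2 + (p.2 + c) ^ 2))
        (Real.pi * (2 * (p.1 - t))) p.1 := by
      have := ((((hasDerivAt_id p.1).sub_const t).pow 2).add_const ((p.2 + c) ^ 2)).const_mul
        Real.pi
      simpa using! this
    refine (((hasDerivAt_id p.1).sub_const t).div h1 (by positivity)).congr_deriv ?_
    unfold fieldFst
    simp only [id]
    field_simp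
    ring

/-- The field is divergence free: the conjugate Poisson kernel is harmonic. -/
theorem divergence_field (hp : 0 ≤ p.2) :
    fderiv ℝ (fieldFst c t) p (1, 0) + fderiv ℝ (fieldSnd c t) p (0, 1) = 0 := by
  have hD := denom_ne_zero hc t hp
  have hpi := Real.pi_ne_zero
  set D := (p.1 - t) ^ 2 + (p.2 + c) ^ 2 with hDdef
  rw [fderiv_apply_fst (d := (-(2 * (p.1 - t)) * D - 4 * (p.1 - t) * ((p.2 + c) ^ 2 - (p.1 - t) ^ 2))
      / (Real.pi * D ^ 3)) (differentiableAt_fieldFst hc t hp),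
    fderiv_apply_snd (d := (-(2 * (p.1 - t)) * D + 8 * (p.1 - t) * (p.2 + c) ^ 2)
      / (Real.pi * D ^ 3)) (differentiableAt_fieldSnd hc t hp)]
  · field_simp
    rw [hDdef]
    ring
  · have h1 : HasDerivAt (fun y : ℝ => Real.pi * ((p.1 - t) ^ 2 + (y + c) ^ 2) ^ 2)
        (Real.pi * (2 * D * (2 * (p.2 + c)))) p.2 := by
      have := (((((hasDerivAt_id p.2).add_const c).pow 2).const_add ((p.1 - t) ^ 2)).pow 2).const_mul
        Real.pi
      simpa using! this
    have h2 : HasDerivAt (fun y : ℝ => -(2 * (p.1 - t) * (y + c))) (-(2 * (p.1 - t))) p.2 := by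
      have := (((hasDerivAt_id p.2).add_const c).const_mul (2 * (p.1 - t))).neg
      simpa using! this
    refine (h2.div h1 (by positivity)).congr_deriv ?_
    rw [← hDdef]
    field_simp
    ring
  · have h1 : HasDerivAt (fun x : ℝ => Real.pi * ((x - t) ^ 2 + (p.2 + c) ^ 2) ^ 2)
        (Real.pi * (2 * D * (2 * (p.1 - t)))) p.1 := by
      have := (((((hasDerivAt_id p.1).sub_const t).pow 2).add_const ((p.2 + c) ^ 2)).pow 2).const_mul
        Real.pi
      simpa using! this
    have h2 : HasDerivAt (fun x : ℝ => (p.2 + c) ^ 2 - (x - t) ^ 2) (-(2 * (p.1 - t))) p.1 := by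
      have := (((hasDerivAt_id p.1).sub_const t).pow 2).const_sub ((p.2 + c) ^ 2)
      simpa using! this
    refine (h2.div h1 (by positivity)).congr_deriv ?_
    rw [← hDdef]
    field_simp
    ring

/-- The denominator of the kernel is comparable to `(1 + |p|)²` in the half-plane. -/
theorem denom_lower_bound :
    ∃ K : ℝ, 0 < K ∧ ∀ p : ℝ × ℝ, 0 < p.2 →
      1 / ((p.1 - t) ^ 2 + (p.2 + c) ^ 2) ≤ K ^ 2 * (1 + ‖p‖)⁻¹ ^ 2 := by
  refine ⟨2 * ((1 + |t|) / c + 1), by positivity, fun p hp => ?_⟩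
  set k := (1 + |t|) / c + 1 with hk
  have hk1 : 1 ≤ k := by rw [hk]; linarith [show 0 ≤ (1 + |t|) / c by positivity]
  have h1 : 1 + |t| ≤ (k - 1) * (p.2 + c) := by
    rw [hk, add_sub_cancel_right, div_mul_eq_mul_div, le_div_iff₀ hc]
    have : 0 ≤ |t| := abs_nonneg t
    nlinarith
  have h2 : ‖p‖ ≤ |p.1 - t| + |t| + p.2 := by
    rw [Prod.norm_def]
    refine max_le ?_ ?_
    · rw [Real.norm_eq_abs]
      have := abs_add_le (p.1 - t) t
      rw [sub_add_cancel] at this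
      linarith
    · rw [Real.norm_eq_abs, abs_of_pos hp]
      linarith [abs_nonneg (p.1 - t), abs_nonneg t]
  have h3 : 1 + ‖p‖ ≤ k * (|p.1 - t| + (p.2 + c)) := by
    nlinarith [abs_nonneg (p.1 - t)]
  have hD : 0 < (p.1 - t) ^ 2 + (p.2 + c) ^ 2 := by positivity
  rw [inv_pow, ← div_eq_mul_inv, div_le_div_iff₀ hD (by positivity), one_mul]
  calc (1 + ‖p‖) ^ 2 ≤ (k * (|p.1 - t| + (p.2 + c))) ^ 2 :=
        pow_le_pow_left₀ (by positivity) h3 2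
    _ ≤ _ := by
      rw [mul_pow, mul_pow, mul_right_comm, mul_comm]
      refine mul_le_mul_of_nonneg_right ?_ (by positivity)
      nlinarith [sq_abs (p.1 - t), sq_nonneg (|p.1 - t| - (p.2 + c)), sq_nonneg (p.1 - t),
        sq_nonneg (p.2 + c)]

theorem norm_field (hp : 0 < p.2) :
    ‖(!₂[fieldFst c t p, fieldSnd c t p] : Plane)‖ =
      1 / (Real.pi * ((p.1 - t) ^ 2 + (p.2 + c) ^ 2)) := by
  have hD := denom_ne_zero hc t hp.le
  have hpi := Real.pi_ne_zero
  rw [norm_plane_mk, ← Real.sqrt_sq (show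
    0 ≤ 1 / (Real.pi * ((p.1 - t) ^ 2 + (p.2 + c) ^ 2)) by positivity)]
  congr 1
  unfold fieldFst fieldSnd
  field_simp
  ring

theorem conjPoisson_decay :
    ∃ C : ℝ, (∀ p : ℝ × ℝ, 0 < p.2 → |conjPoisson c t p| ≤ C * (1 + ‖p‖)⁻¹) ∧
      ∀ p : ℝ × ℝ, 0 < p.2 → ‖(!₂[fieldFst c t p, fieldSnd c t p] : Plane)‖ ≤
        C * (1 + ‖p‖)⁻¹ ^ 2 := by
  obtain ⟨K, hK0, hK⟩ := denom_lower_bound hc t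
  refine ⟨max K (K ^ 2), fun p hp => ?_, fun p hp => ?_⟩
  · have hD : 0 < (p.1 - t) ^ 2 + (p.2 + c) ^ 2 := by positivity
    have h1 : |conjPoisson c t p| ≤ K * (1 + ‖p‖)⁻¹ := by
      refine abs_le_of_sq_le_sq ?_ (by positivity)
      rw [mul_pow]
      refine le_trans ?_ (hK p hp)
      rw [conjPoisson_of_nonneg c t hp.le, div_pow, div_le_div_iff₀ (by positivity) hD, one_mul,
        mul_pow, sq ((p.1 - t) ^ 2 + (p.2 + c) ^ 2), ← mul_assoc]
      refine mul_le_mul_of_nonneg_right ?_ hD.le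
      have : 1 ≤ Real.pi ^ 2 := one_le_pow₀ (by linarith [Real.pi_gt_three])
      nlinarith [sq_nonneg (p.1 - t), sq_nonneg (p.2 + c)]
    exact h1.trans (by gcongr; exact le_max_left _ _)
  · rw [norm_field hc t hp]
    have hD : 0 < (p.1 - t) ^ 2 + (p.2 + c) ^ 2 := by positivity
    calc 1 / (Real.pi * ((p.1 - t) ^ 2 + (p.2 + c) ^ 2)) ≤ 1 / ((p.1 - t) ^ 2 + (p.2 + c) ^ 2) := by
          gcongr
          exact le_mul_of_one_le_left hD.le (by linarith [Real.pi_gt_three])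
      _ ≤ K ^ 2 * (1 + ‖p‖)⁻¹ ^ 2 := hK p hp
      _ ≤ _ := by gcongr; exact le_max_right _ _

theorem memLp_grad_conjPoisson : MemLp (grad (conjPoisson c t)) 2 halfPlaneVolume := by
  obtain ⟨C, -, hC⟩ := conjPoisson_decay hc t
  refine memLp_of_decay (C := C) (continuous_grad (contDiff_conjPoisson hc t)).aestronglyMeasurable
    fun p hp => ?_
  rw [grad_conjPoisson hc t hp]
  exact hC p hp

theorem exists_test_approx_conjPoisson :
    ∃ ζ : ℕ → ℝ × ℝ → ℝ, ∃ hζ : ∀ n, IsTestFunction (ζ n),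
      Tendsto (fun n => (hζ n).memLp_grad.toLp (grad (ζ n))) atTop
        (𝓝 ((memLp_grad_conjPoisson hc t).toLp _)) ∧
      (∀ p, Tendsto (fun n => ζ n p) atTop (𝓝 (conjPoisson c t p))) ∧
      ∀ n p, |ζ n p| ≤ |conjPoisson c t p| := by
  obtain ⟨C, h0, h1⟩ := conjPoisson_decay hc t
  refine exists_test_approx (contDiff_conjPoisson hc t) h0 (fun p hp => ?_) _
  rw [grad_conjPoisson hc t hp]
  exact h1 p hp

/-- The boundary condition: the field is the stray field of minus the Poisson kernel. -/
theorem integral_inner_grad_conjPoisson {ζ : ℝ × ℝ → ℝ} (hζ : IsTestFunction ζ) :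
    ∫ p, inner ℝ (grad (conjPoisson c t) p) (grad ζ p) ∂halfPlaneVolume =
      ∫ x : ℝ, (2 * (x - t) * c / (Real.pi * ((x - t) ^ 2 + c ^ 2) ^ 2)) * ζ (x, 0) := by
  obtain ⟨R, hR0, hR⟩ : ∃ R : ℝ, 0 < R ∧ ∀ p : ℝ × ℝ, R ≤ ‖p‖ → p ∉ tsupport ζ := by
    obtain ⟨R, hR⟩ := hζ.2.isBounded.subset_ball 0
    refine ⟨max R 1, by positivity, fun p hp hm => ?_⟩
    have := hR hm
    rw [mem_ball_zero_iff] at this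
    exact absurd this (not_lt.2 ((le_max_left _ _).trans hp))
  have hz : ∀ p : ℝ × ℝ, R ≤ ‖p‖ → ζ p = 0 := fun p hp => image_eq_zero_of_notMem_tsupport (hR p hp)
  have hzd : Differentiable ℝ ζ := hζ.1.differentiable (by simp)
  let f : ℝ × ℝ → ℝ := fun p => ζ p * fieldFst c t p
  let g : ℝ × ℝ → ℝ := fun p => ζ p * fieldSnd c t p
  have hf : ∀ p : ℝ × ℝ, 0 ≤ p.2 → DifferentiableAt ℝ f p := fun p hp =>
    (hzd p).mul (differentiableAt_fieldFst hc t hp)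
  have hg : ∀ p : ℝ × ℝ, 0 ≤ p.2 → DifferentiableAt ℝ g p := fun p hp =>
    (hzd p).mul (differentiableAt_fieldSnd hc t hp)
  have hdiv : ∀ p : ℝ × ℝ, 0 ≤ p.2 → fderiv ℝ f p (1, 0) + fderiv ℝ g p (0, 1) =
      fieldFst c t p * fderiv ℝ ζ p (1, 0) + fieldSnd c t p * fderiv ℝ ζ p (0, 1) := by
    intro p hp
    have e1 : fderiv ℝ f p = _ := fderiv_fun_mul (hzd p) (differentiableAt_fieldFst hc t hp)
    have e2 : fderiv ℝ g p = _ := fderiv_fun_mul (hzd p) (differentiableAt_fieldSnd hc t hp)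
    rw [e1, e2]
    simp only [add_apply, smul_apply, smul_eq_mul]
    linear_combination ζ p * divergence_field hc t hp
  set a : ℝ × ℝ := (-R, 0) with ha
  set b : ℝ × ℝ := (R, R) with hb
  have hIcc : ∀ p ∈ Set.Icc a b, 0 ≤ p.2 := fun p hp => hp.1.2
  have hcont : ContinuousOn (fun p => fieldFst c t p * fderiv ℝ ζ p (1, 0) +
      fieldSnd c t p * fderiv ℝ ζ p (0, 1)) (Set.Icc a b) := by
    have h1 := hζ.1.continuous_fderiv (by simp)
    intro p hp
    have e1 := (differentiableAt_fieldFst hc t (hIcc p hp)).continuousAt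
    have e2 := (differentiableAt_fieldSnd hc t (hIcc p hp)).continuousAt
    have e3 : Continuous fun p => fderiv ℝ ζ p (1, 0) := by fun_prop
    have e4 : Continuous fun p => fderiv ℝ ζ p (0, 1) := by fun_prop
    exact ((e1.mul e3.continuousAt).add (e2.mul e4.continuousAt)).continuousWithinAt
  have hIntOn : IntegrableOn (fun p => fderiv ℝ f p (1, 0) + fderiv ℝ g p (0, 1))
      (Set.Icc a b) := by
    refine (hcont.integrableOn_compact isCompact_Icc).congr_fun (fun p hp => ?_) measurableSet_Icc
    exact (hdiv p (hIcc p hp)).symm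
  have hdivthm := integral_divergence_prod_Icc_of_hasFDerivAt_of_le f g (fderiv ℝ f) (fderiv ℝ g)
    a b (by rw [ha, hb, Prod.mk_le_mk]; constructor <;> linarith)
    (fun p hp => (hf p (hIcc p hp)).continuousAt.continuousWithinAt)
    (fun p hp => (hg p (hIcc p hp)).continuousAt.continuousWithinAt)
    (fun p hp => (hf p hp.2.1.le).hasFDerivAt) (fun p hp => (hg p hp.2.1.le).hasFDerivAt) hIntOn
  have z1 : ∀ x, g (x, b.2) = 0 := fun x => by
    simp only [g]
    rw [hz _ (by rw [Prod.norm_def, hb]; exact le_max_of_le_right (le_abs_self R)), zero_mul]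
  have z2 : ∀ y, f (b.1, y) = 0 := fun y => by
    simp only [f]
    rw [hz _ (by rw [Prod.norm_def, hb]; exact le_max_of_le_left (le_abs_self R)), zero_mul]
  have z3 : ∀ y, f (a.1, y) = 0 := fun y => by
    simp only [f]
    rw [hz _ (by rw [Prod.norm_def, ha]; exact le_max_of_le_left (neg_le_abs (-R) |>.trans' (by simp))),
      zero_mul]
  simp only [z1, z2, z3, intervalIntegral.integral_zero, zero_sub, add_zero, sub_zero] at hdivthm
  have hLHS : ∫ p, inner ℝ (grad (conjPoisson c t) p) (grad ζ p) ∂halfPlaneVolume =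
      ∫ p in Set.Icc a b, fderiv ℝ f p (1, 0) + fderiv ℝ g p (0, 1) := by
    have e1 : ∫ p, inner ℝ (grad (conjPoisson c t) p) (grad ζ p) ∂halfPlaneVolume =
        ∫ p in {p : ℝ × ℝ | 0 < p.2}, fderiv ℝ f p (1, 0) + fderiv ℝ g p (0, 1) := by
      refine setIntegral_congr_fun measurableSet_halfPlane fun p hp => ?_
      have hp' : 0 < p.2 := hp
      rw [grad_conjPoisson hc t hp', hdiv p hp'.le, grad, inner_plane_mk]
    have e2 : ∫ p in {p : ℝ × ℝ | 0 < p.2}, fderiv ℝ f p (1, 0) + fderiv ℝ g p (0, 1) =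
        ∫ p in {p : ℝ × ℝ | 0 < p.2} ∩ Set.Icc a b, fderiv ℝ f p (1, 0) + fderiv ℝ g p (0, 1) := by
      refine setIntegral_eq_of_subset_of_forall_sdiff_eq_zero measurableSet_halfPlane
        Set.inter_subset_left fun p hp => ?_
      have hp' : 0 < p.2 := hp.1
      have hpR : R ≤ ‖p‖ := by
        by_contra hlt
        rw [not_le, Prod.norm_def, max_lt_iff, Real.norm_eq_abs, Real.norm_eq_abs, abs_lt,
          abs_lt] at hlt
        exact hp.2 ⟨hp.1, ⟨hlt.1.1.le, hp'.le⟩, ⟨hlt.1.2.le, hlt.2.2.le⟩⟩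
      have hz' : fderiv ℝ ζ p = 0 := by
        by_contra h
        exact hR p hpR (support_fderiv_subset ℝ h)
      rw [hdiv p hp'.le, hz']
      simp
    have e3 : ({p : ℝ × ℝ | 0 < p.2} ∩ Set.Icc a b : Set (ℝ × ℝ)) =ᵐ[volume] Set.Icc a b := by
      have hnull : volume {p : ℝ × ℝ | p.2 = 0} = 0 := by
        have : {p : ℝ × ℝ | p.2 = 0} = Set.univ ×ˢ {0} := by ext p; simp
        rw [this, Measure.volume_eq_prod, Measure.prod_prod]
        simp
      refine ae_eq_set.2 ⟨by simp [Set.inter_sdiff_assoc], measure_mono_null ?_ hnull⟩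
      intro p hp
      by_contra hne
      exact hp.2 ⟨lt_of_le_of_ne (hIcc p hp.1) (Ne.symm hne), hp.1⟩
    rw [e1, e2, setIntegral_congr_set e3]
  rw [hLHS, hdivthm, intervalIntegral.integral_of_le (by simp [ha, hb]; linarith),
    setIntegral_eq_integral_of_forall_compl_eq_zero, ← integral_neg]
  · refine integral_congr_ae (Eventually.of_forall fun x => ?_)
    simp only [g, ha, fieldSnd, zero_add]
    ring
  · intro x hx
    simp only [g]
    rw [hz, zero_mul]
    rw [Prod.norm_def]
    refine le_max_of_le_left ?_
    by_contra hlt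
    rw [not_le, Real.norm_eq_abs, abs_lt] at hlt
    exact hx ⟨hlt.1, hlt.2.le⟩

theorem integrable_boundary_charge (s : ℝ) :
    Integrable fun x : ℝ => 2 * (x - s) * c / (Real.pi * ((x - s) ^ 2 + c ^ 2) ^ 2) := by
  refine (integrable_inv_sq_add_sq s hc.ne').mono' ?_ (Eventually.of_forall fun x => ?_)
  · exact (Continuous.div (by fun_prop) (by fun_prop)
      fun x => by positivity).aestronglyMeasurable
  · have hD : 0 < (x - s) ^ 2 + c ^ 2 := by positivity
    rw [norm_div, Real.norm_of_nonneg (show 0 ≤ Real.pi * ((x - s) ^ 2 + c ^ 2) ^ 2 by positivity),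
      div_le_div_iff₀ (by positivity) hD, one_mul, Real.norm_eq_abs, sq ((x - s) ^ 2 + c ^ 2),
      ← mul_assoc]
    refine mul_le_mul_of_nonneg_right ?_ hD.le
    have h1 : |2 * (x - s) * c| ≤ (x - s) ^ 2 + c ^ 2 := by
      rw [abs_le]
      constructor <;> nlinarith [sq_nonneg (x - s + c), sq_nonneg (x - s - c)]
    nlinarith [Real.pi_gt_three]

/-- The gradient of the conjugate Poisson kernel, as an element of `L²` of the half-plane. The value
for `c ≤ 0` is a dummy. -/
def poissonField (c t : ℝ) : Lp Plane 2 halfPlaneVolume :=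
  if hc : 0 < c then (memLp_grad_conjPoisson hc t).toLp _ else 0

theorem poissonField_eq : poissonField c t = (memLp_grad_conjPoisson hc t).toLp _ := by
  rw [poissonField, dif_pos hc]

theorem poissonField_mem : poissonField c t ∈ HDot1 := by
  obtain ⟨ζ, hζ, h1, -, -⟩ := exists_test_approx_conjPoisson hc t
  rw [poissonField_eq hc]
  exact (Submodule.isClosed_topologicalClosure _).mem_of_tendsto h1
    (Eventually.of_forall fun n => (hζ n).toLp_mem)

theorem inner_poissonField_grad {ζ : ℝ × ℝ → ℝ} (hζ : IsTestFunction ζ) :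
    inner ℝ (poissonField c t) (hζ.memLp_grad.toLp (grad ζ)) =
      ∫ x : ℝ, (2 * (x - t) * c / (Real.pi * ((x - t) ^ 2 + c ^ 2) ^ 2)) * ζ (x, 0) := by
  rw [← integral_inner_grad_conjPoisson hc t hζ, ← integral_inner_eq, poissonField_eq hc]
  refine integral_congr_ae ?_
  filter_upwards [(memLp_grad_conjPoisson hc t).coeFn_toLp] with p hp
  rw [hp]

/-- The Gram matrix of the Poisson fields. The second field is approximated by gradients of test
functions, for which the inner product is an integral over the boundary. -/
theorem inner_poissonField {d : ℝ} (hd : 0 < d) (s t : ℝ) :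
    inner ℝ (poissonField c s) (poissonField d t) = gramKernel (c + d) (s - t) := by
  obtain ⟨ζ, hζ, h1, h2, h3⟩ := exists_test_approx_conjPoisson hd t
  have hlim := (tendsto_const_nhds (x := poissonField c s)).inner (𝕜 := ℝ) h1
  rw [← poissonField_eq hd t] at hlim
  refine tendsto_nhds_unique hlim ?_
  rw [← integral_poisson_deriv_mul_conj hc hd]
  refine Tendsto.congr (fun n => (inner_poissonField_grad hc s (hζ n)).symm) ?_
  have hval : ∀ x : ℝ, conjPoisson d t (x, 0) = (x - t) / (Real.pi * ((x - t) ^ 2 + d ^ 2)) := by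
    intro x
    rw [conjPoisson_of_nonneg d t le_rfl]
    simp
  obtain ⟨B, hB⟩ : ∃ B : ℝ, ∀ x : ℝ, |conjPoisson d t (x, 0)| ≤ B := by
    refine ⟨1 / d, fun x => ?_⟩
    have hD : 0 < (x - t) ^ 2 + d ^ 2 := by positivity
    rw [hval, abs_div, abs_of_pos (mul_pos Real.pi_pos hD), div_le_div_iff₀ (by positivity) hd]
    have h1 : |x - t| * d ≤ (x - t) ^ 2 + d ^ 2 := by
      nlinarith [sq_abs (x - t), sq_nonneg (|x - t| - d), abs_nonneg (x - t)]
    nlinarith [Real.pi_gt_three]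
  refine tendsto_integral_of_dominated_convergence
    (fun x => ‖2 * (x - s) * c / (Real.pi * ((x - s) ^ 2 + c ^ 2) ^ 2)‖ * B) ?_
    ((integrable_boundary_charge hc s).norm.mul_const B) ?_ ?_
  · intro n
    have : Continuous fun x : ℝ => ζ n (x, 0) := (hζ n).1.continuous.comp (by fun_prop)
    exact (integrable_boundary_charge hc s).aestronglyMeasurable.mul this.aestronglyMeasurable
  · intro n
    refine Eventually.of_forall fun x => ?_
    rw [norm_mul]
    gcongr
    exact (h3 n _).trans (hB x)
  · refine Eventually.of_forall fun x => ?_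
    rw [← hval]
    exact (h2 (x, 0)).const_mul _

end

/-! ### Properties of the Gram kernel -/

theorem gramKernel_neg (c τ : ℝ) : gramKernel c (-τ) = gramKernel c τ := by
  simp [gramKernel]

theorem continuous_gramKernel {c : ℝ} (hc : 0 < c) : Continuous (gramKernel c) := by
  unfold gramKernel
  exact Continuous.div (by fun_prop) (by fun_prop) fun τ => by
    have := Real.pi_pos
    positivity

theorem abs_gramKernel_le {c : ℝ} (hc : 0 < c) (τ : ℝ) :
    |gramKernel c τ| ≤ 1 / (Real.pi * (τ ^ 2 + c ^ 2)) := by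
  have hD : 0 < τ ^ 2 + c ^ 2 := by positivity
  have hpi := Real.pi_pos
  rw [gramKernel, abs_div, abs_of_pos (show 0 < Real.pi * (τ ^ 2 + c ^ 2) ^ 2 by positivity),
    div_le_div_iff₀ (by positivity) (by positivity), one_mul, sq (τ ^ 2 + c ^ 2), ← mul_assoc,
    ← mul_assoc]
  refine mul_le_mul_of_nonneg_right ?_ hD.le
  rw [mul_comm]
  refine mul_le_mul_of_nonneg_left ?_ hpi.le
  rw [abs_le]
  constructor <;> nlinarith [sq_nonneg τ, sq_nonneg c]

theorem integrable_gramKernel {c : ℝ} (hc : 0 < c) : Integrable (gramKernel c) := by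
  have h := ((integrable_inv_sq_add_sq 0 hc.ne').const_mul (1 / Real.pi))
  refine h.mono' (continuous_gramKernel hc).aestronglyMeasurable (Eventually.of_forall fun τ => ?_)
  refine (abs_gramKernel_le hc τ).trans (le_of_eq ?_)
  simp only [sub_zero]
  rw [div_mul_div_comm, one_mul]

theorem integral_gramKernel {c : ℝ} (hc : 0 < c) : ∫ τ, gramKernel c τ = 0 := by
  have hpi := Real.pi_pos
  have hder : ∀ τ : ℝ, HasDerivAt (fun τ : ℝ => τ / (Real.pi * (τ ^ 2 + c ^ 2)))
      (gramKernel c τ) τ := by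
    intro τ
    have hD : τ ^ 2 + c ^ 2 ≠ 0 := by positivity
    have h1 : HasDerivAt (fun τ : ℝ => Real.pi * (τ ^ 2 + c ^ 2)) (Real.pi * (2 * τ)) τ := by
      have := (((hasDerivAt_id τ).pow 2).add_const (c ^ 2)).const_mul Real.pi
      simpa using! this
    refine ((hasDerivAt_id τ).div h1 (by positivity)).congr_deriv ?_
    unfold gramKernel
    simp only [id]
    field_simp
    ring
  have hlim : Tendsto (fun τ : ℝ => τ / (Real.pi * (τ ^ 2 + c ^ 2))) (cocompact ℝ) (𝓝 0) := by
    have hinv : Tendsto (fun x : ℝ => |x⁻¹|) (cocompact ℝ) (𝓝 0) := by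
      rw [← Metric.cobounded_eq_cocompact]
      simpa using (tendsto_inv₀_cobounded (α := ℝ)).abs
    refine squeeze_zero_norm (fun τ => ?_) hinv
    rcases eq_or_ne τ 0 with rfl | hτ
    · simp
    rw [norm_div, Real.norm_eq_abs, Real.norm_of_nonneg (by positivity), abs_inv,
      div_le_iff₀ (by positivity), ← div_eq_inv_mul, le_div_iff₀ (abs_pos.2 hτ)]
    nlinarith [sq_abs τ, Real.pi_gt_three, sq_nonneg τ, sq_nonneg c]
  rw [integral_of_hasDerivAt_of_tendsto hder (integrable_gramKernel hc)
    (hlim.mono_left atBot_le_cocompact) (hlim.mono_left atTop_le_cocompact), sub_zero]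

theorem tendsto_gramKernel {τ : ℝ} (hτ : τ ≠ 0) :
    Tendsto (fun c => gramKernel c τ) (𝓝 0) (𝓝 (-(1 / (Real.pi * τ ^ 2)))) := by
  have hpi := Real.pi_pos
  have : ContinuousAt (fun c => gramKernel c τ) 0 := by
    unfold gramKernel
    exact ContinuousAt.div (by fun_prop) (by fun_prop) (by positivity)
  convert this.tendsto using 2
  unfold gramKernel
  field_simp
  ring

section Bilinear

variable {a b : ℝ → ℝ} {c : ℝ}

theorem integrable_mul_kernel (hc : 0 < c) (ha : Integrable a) (hb : Continuous b)
    {M : ℝ} (hM : ∀ x, |b x| ≤ M) (φ : ℝ × ℝ → ℝ) (hφ : Continuous φ) :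
    Integrable (fun p : ℝ × ℝ => a p.2 * gramKernel c (p.1 - p.2) * b (φ p)) := by
  have h := ha.convolution_integrand (ContinuousLinearMap.mul ℝ ℝ) (integrable_gramKernel hc)
  simp only [ContinuousLinearMap.mul_apply'] at h
  exact h.mul_bdd (c := M) (hb.comp hφ).aestronglyMeasurable (Eventually.of_forall fun p => hM _)

/-- As the kernel has mean zero, the bilinear form that it defines is a form in the increments. -/
theorem integral_bilinear_gramKernel (hc : 0 < c) (ha : Integrable a)
    (hb : Continuous b) {M : ℝ} (hM : ∀ x, |b x| ≤ M) :
    ∫ s, a s * ∫ t, b t * gramKernel c (s - t) =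
      ∫ p : ℝ × ℝ, -(1 / 2) * ((a p.1 - a p.2) * (b p.1 - b p.2) * gramKernel c (p.1 - p.2)) := by
  have hsymm : ∀ x y : ℝ, gramKernel c (x - y) = gramKernel c (y - x) := fun x y => by
    rw [← gramKernel_neg, neg_sub]
  have i1 := integrable_mul_kernel hc ha hb hM Prod.fst continuous_fst
  have i2 := integrable_mul_kernel hc ha hb hM Prod.snd continuous_snd
  have i1' := i1.swap
  have i2' := i2.swap
  simp only [Function.comp_def, Prod.fst_swap, Prod.snd_swap] at i1' i2'
  have e1 : ∫ p : ℝ × ℝ, a p.2 * gramKernel c (p.1 - p.2) * b p.1 =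
      ∫ s, a s * ∫ t, b t * gramKernel c (s - t) := by
    rw [Measure.volume_eq_prod] at i1 ⊢
    rw [integral_prod_symm _ i1]
    refine integral_congr_ae (Eventually.of_forall fun s => ?_)
    simp only
    rw [← integral_const_mul]
    refine integral_congr_ae (Eventually.of_forall fun t => ?_)
    simp only
    rw [hsymm]
    ring
  have e2 : ∫ p : ℝ × ℝ, a p.2 * gramKernel c (p.1 - p.2) * b p.2 = 0 := by
    rw [Measure.volume_eq_prod] at i2 ⊢
    rw [integral_prod_symm _ i2]
    refine integral_eq_zero_of_ae (Eventually.of_forall fun s => ?_)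
    simp only [Pi.zero_apply]
    rw [integral_mul_const, integral_const_mul, integral_sub_right_eq_self (gramKernel c) s,
      integral_gramKernel hc]
    simp
  have e1' : ∫ p : ℝ × ℝ, a p.1 * gramKernel c (p.2 - p.1) * b p.2 =
      ∫ p : ℝ × ℝ, a p.2 * gramKernel c (p.1 - p.2) * b p.1 :=
    integral_prod_swap (μ := volume) (ν := volume)
      (f := fun p : ℝ × ℝ => a p.2 * gramKernel c (p.1 - p.2) * b p.1)
  have e2' : ∫ p : ℝ × ℝ, a p.1 * gramKernel c (p.2 - p.1) * b p.1 =
      ∫ p : ℝ × ℝ, a p.2 * gramKernel c (p.1 - p.2) * b p.2 :=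
    integral_prod_swap (μ := volume) (ν := volume)
      (f := fun p : ℝ × ℝ => a p.2 * gramKernel c (p.1 - p.2) * b p.2)
  have hsplit : ∀ p : ℝ × ℝ, -(1 / 2) * ((a p.1 - a p.2) * (b p.1 - b p.2) *
      gramKernel c (p.1 - p.2)) = (1 / 2) *
      ((a p.2 * gramKernel c (p.1 - p.2) * b p.1 + a p.1 * gramKernel c (p.2 - p.1) * b p.2) -
      (a p.2 * gramKernel c (p.1 - p.2) * b p.2 + a p.1 * gramKernel c (p.2 - p.1) * b p.1)) := by
    intro p
    rw [hsymm p.2 p.1]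
    ring
  simp_rw [hsplit]
  have j1 := integral_sub (i1.add i1') (i2.add i2')
  have j2 := integral_add i1 i1'
  have j3 := integral_add i2 i2'
  simp only [Pi.add_apply] at j1
  rw [integral_const_mul, j1, j2, j3, e1', e2', e1, e2]
  ring

end Bilinear

/-! ### Superposition of Poisson fields -/

theorem continuous_poissonField {c : ℝ} (hc : 0 < c) : Continuous (poissonField c) := by
  rw [continuous_iff_continuousAt]
  intro s
  rw [ContinuousAt, tendsto_iff_norm_sub_tendsto_zero]
  have h : ∀ t, ‖poissonField c t - poissonField c s‖ =
      Real.sqrt (2 * gramKernel (c + c) 0 - 2 * gramKernel (c + c) (t - s)) := by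
    intro t
    rw [← Real.sqrt_sq (norm_nonneg (_ - _)), norm_sub_sq_real, ← real_inner_self_eq_norm_sq,
      ← real_inner_self_eq_norm_sq, inner_poissonField hc hc, inner_poissonField hc hc,
      inner_poissonField hc hc, sub_self, sub_self]
    congr 1
    ring
  simp_rw [h]
  have hk := continuous_gramKernel (add_pos hc hc)
  have hcont : Continuous fun t => Real.sqrt (2 * gramKernel (c + c) 0 -
      2 * gramKernel (c + c) (t - s)) := by fun_prop
  have := hcont.tendsto s
  simpa using this

theorem norm_poissonField {c : ℝ} (hc : 0 < c) (t : ℝ) :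
    ‖poissonField c t‖ = Real.sqrt (gramKernel (c + c) 0) := by
  rw [← Real.sqrt_sq (norm_nonneg (poissonField c t)), ← real_inner_self_eq_norm_sq,
    inner_poissonField hc hc, sub_self]

/-- The stray field of the convolution of `a` with the Poisson kernel at height `c`. -/
def smoothedField (c : ℝ) (a : ℝ → ℝ) : Lp Plane 2 halfPlaneVolume :=
  -∫ t, a t • poissonField c t

section

variable {a : ℝ → ℝ} {c : ℝ} (hc : 0 < c) (ha : Integrable a)
include hc ha

theorem integrable_smul_poissonField : Integrable fun t => a t • poissonField c t :=
  ha.smul_bdd (Real.sqrt (gramKernel (c + c) 0))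
    (continuous_poissonField hc).aestronglyMeasurable
    (Eventually.of_forall fun t => (norm_poissonField hc t).le)

theorem inner_smoothedField (v : Lp Plane 2 halfPlaneVolume) :
    inner ℝ (smoothedField c a) v = -∫ t, a t * inner ℝ (poissonField c t) v := by
  rw [smoothedField, inner_neg_left, real_inner_comm,
    ← integral_inner (integrable_smul_poissonField hc ha) v]
  congr 1
  refine integral_congr_ae (Eventually.of_forall fun t => ?_)
  simp only
  rw [inner_smul_right, real_inner_comm]

theorem smoothedField_mem : smoothedField c a ∈ HDot1 := by
  have : CompleteSpace HDot1 := (Submodule.isClosed_topologicalClosure _).completeSpace_coe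
  rw [← Submodule.orthogonal_orthogonal HDot1, Submodule.mem_orthogonal']
  intro v hv
  rw [inner_smoothedField hc ha]
  have : ∀ t, inner ℝ (poissonField c t) v = 0 := fun t =>
    (Submodule.mem_orthogonal _ _).1 hv _ (poissonField_mem hc t)
  simp [this]

theorem inner_smoothedField_smoothedField {b : ℝ → ℝ} {d : ℝ} (hd : 0 < d)
    (hb : Integrable b) (hbc : Continuous b) {M : ℝ} (hM : ∀ x, |b x| ≤ M) :
    inner ℝ (smoothedField c a) (smoothedField d b) = ∫ p : ℝ × ℝ,
      -(1 / 2) * ((a p.1 - a p.2) * (b p.1 - b p.2) * gramKernel (c + d) (p.1 - p.2)) := by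
  rw [inner_smoothedField hc ha, ← integral_bilinear_gramKernel (add_pos hc hd) ha hbc hM,
    ← integral_neg]
  refine integral_congr_ae (Eventually.of_forall fun s => ?_)
  simp only
  rw [real_inner_comm, inner_smoothedField hd hb, mul_neg, neg_neg]
  congr 1
  refine integral_congr_ae (Eventually.of_forall fun t => ?_)
  simp only
  rw [inner_poissonField hd hc, ← gramKernel_neg, neg_sub, add_comm]

end

/-! ### The stray field as a limit of smoothed fields -/

/-- Soft thresholding: `x` is moved by at most `ε` towards `0`. -/
def softThreshold (ε x : ℝ) : ℝ := x - max (-ε) (min x ε)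

theorem continuous_softThreshold (ε : ℝ) : Continuous (softThreshold ε) := by
  unfold softThreshold
  fun_prop

theorem softThreshold_eq_zero {ε x : ℝ} (h : |x| ≤ ε) : softThreshold ε x = 0 := by
  rw [abs_le] at h
  rw [softThreshold, min_eq_left h.2, max_eq_right h.1, sub_self]

theorem abs_softThreshold_sub_le {ε : ℝ} (hε : 0 ≤ ε) (x : ℝ) : |softThreshold ε x - x| ≤ ε := by
  rw [softThreshold, sub_sub_cancel_left, abs_neg, abs_le]
  exact ⟨le_max_left _ _, max_le (by linarith) (min_le_right _ _)⟩

theorem abs_softThreshold_sub_softThreshold_le {ε : ℝ} (hε : 0 ≤ ε) (x y : ℝ) :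
    |softThreshold ε x - softThreshold ε y| ≤ |x - y| := by
  unfold softThreshold
  rcases max_cases (-ε) (min x ε) with ⟨h1, h1'⟩ | ⟨h1, h1'⟩ <;>
  rcases max_cases (-ε) (min y ε) with ⟨h2, h2'⟩ | ⟨h2, h2'⟩ <;>
  rcases min_cases x ε with ⟨h3, h3'⟩ | ⟨h3, h3'⟩ <;>
  rcases min_cases y ε with ⟨h4, h4'⟩ | ⟨h4, h4'⟩ <;>
  rw [h1, h2] <;>
  rcases abs_cases (x - y) with ⟨h5, h5'⟩ | ⟨h5, h5'⟩ <;>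
  rw [h5, abs_le] <;> constructor <;> linarith

theorem abs_softThreshold_le {ε : ℝ} (hε : 0 ≤ ε) (x : ℝ) : |softThreshold ε x| ≤ |x| := by
  have := abs_softThreshold_sub_softThreshold_le hε x 0
  rwa [softThreshold_eq_zero (x := 0) (by simpa using hε), sub_zero, sub_zero] at this

/-- A sequence in a Hilbert space converges if its Gram matrix converges. -/
theorem exists_tendsto_of_tendsto_inner {E : Type*} [NormedAddCommGroup E] [InnerProductSpace ℝ E]
    [CompleteSpace E] {w : ℕ → E} {L : ℝ}
    (h : Tendsto (fun k : ℕ × ℕ => inner ℝ (w k.1) (w k.2)) atTop (𝓝 L)) :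
    ∃ v, Tendsto w atTop (𝓝 v) ∧ ‖v‖ ^ 2 = L := by
  have hfst : Tendsto (Prod.fst : ℕ × ℕ → ℕ) atTop atTop := by
    rw [← prod_atTop_atTop_eq]; exact tendsto_fst
  have hsnd : Tendsto (Prod.snd : ℕ × ℕ → ℕ) atTop atTop := by
    rw [← prod_atTop_atTop_eq]; exact tendsto_snd
  have hdiag : Tendsto (fun n : ℕ => inner ℝ (w n) (w n)) atTop (𝓝 L) :=
    h.comp tendsto_atTop_diagonal
  have h1 : Tendsto (fun k : ℕ × ℕ => inner ℝ (w k.1) (w k.1)) atTop (𝓝 L) := hdiag.comp hfst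
  have h2 : Tendsto (fun k : ℕ × ℕ => inner ℝ (w k.2) (w k.2)) atTop (𝓝 L) := hdiag.comp hsnd
  have hcauchy : CauchySeq w := by
    rw [cauchySeq_iff_tendsto_dist_atTop_0]
    have hs := ((h1.sub (h.const_mul 2)).add h2).sqrt
    rw [show L - 2 * L + L = 0 by ring, Real.sqrt_zero] at hs
    refine hs.congr fun k => ?_
    rw [dist_eq_norm, ← Real.sqrt_sq (norm_nonneg (_ - _)), norm_sub_sq_real]
    simp only [real_inner_self_eq_norm_sq]
  obtain ⟨v, hv⟩ := cauchySeq_tendsto_of_complete hcauchy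
  refine ⟨v, hv, ?_⟩
  rw [← real_inner_self_eq_norm_sq]
  exact tendsto_nhds_unique (hv.inner hv) hdiag

section Smoothing

variable {a : ℝ → ℝ} {c : ℝ} (hc : 0 < c) (ha : Integrable a) (hac : Continuous a)
  {ζ : ℝ × ℝ → ℝ} (hζ : IsTestFunction ζ)

/-- The derivative along the boundary of a test function. -/
def boundaryDeriv (ζ : ℝ × ℝ → ℝ) (x : ℝ) : ℝ := fderiv ℝ ζ (x, 0) (1, 0)

include hζ in
theorem continuous_boundaryDeriv : Continuous (boundaryDeriv ζ) := by
  have := hζ.1.continuous_fderiv (by simp)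
  unfold boundaryDeriv
  fun_prop

include hζ in
theorem hasDerivAt_boundary (x : ℝ) : HasDerivAt (fun x => ζ (x, 0)) (boundaryDeriv ζ x) x := by
  have h1 : HasDerivAt (fun x : ℝ => (x, (0:ℝ))) (1, 0) x :=
    (hasDerivAt_id x).prodMk (hasDerivAt_const _ _)
  exact ((hζ.1.differentiable (by simp)) (x, 0)).hasFDerivAt.comp_hasDerivAt x h1

include hζ in
theorem hasCompactSupport_boundary : HasCompactSupport fun x : ℝ => ζ (x, 0) := by
  have hcl : IsClosedEmbedding fun x : ℝ => (x, (0:ℝ)) :=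
    Topology.IsClosedEmbedding.of_continuous_injective_isClosedMap (by fun_prop)
      (fun x y h => (Prod.mk.inj h).1) (isClosedMap_prodMk_right 0)
  exact hζ.2.comp_isClosedEmbedding hcl

include hζ in
theorem hasCompactSupport_boundaryDeriv : HasCompactSupport (boundaryDeriv ζ) := by
  have := (hasCompactSupport_boundary hζ).deriv
  rwa [show deriv (fun x : ℝ => ζ (x, 0)) = boundaryDeriv ζ from
    funext fun x => (hasDerivAt_boundary hζ x).deriv] at this

include hζ in
theorem integrable_boundaryDeriv : Integrable (boundaryDeriv ζ) :=
  (continuous_boundaryDeriv hζ).integrable_of_hasCompactSupport (hasCompactSupport_boundaryDeriv hζ)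

/-- The Poisson kernel at height one. -/
def poissonOne (y : ℝ) : ℝ := Real.pi⁻¹ * (1 + y ^ 2)⁻¹

theorem integrable_poissonOne : Integrable poissonOne := integrable_inv_one_add_sq.const_mul _

theorem integral_poissonOne : ∫ y, poissonOne y = 1 := by
  unfold poissonOne
  rw [integral_const_mul, integral_univ_inv_one_add_sq, inv_mul_cancel₀ Real.pi_ne_zero]

theorem poissonOne_nonneg (y : ℝ) : 0 ≤ poissonOne y := by
  unfold poissonOne
  have := Real.pi_pos
  positivity

include hc hζ in
/-- The charge of the Poisson field at `t`, tested against `ζ`, is a Poisson average of `∂₁ζ`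
around `t` at scale `c`. -/
theorem integral_charge_mul (t : ℝ) :
    ∫ x : ℝ, (2 * (x - t) * c / (Real.pi * ((x - t) ^ 2 + c ^ 2) ^ 2)) * ζ (x, 0) =
      ∫ y, poissonOne y * boundaryDeriv ζ (t + c * y) := by
  have hpi := Real.pi_pos
  let P : ℝ → ℝ := fun x => c / (Real.pi * ((x - t) ^ 2 + c ^ 2))
  have hP : ∀ x, HasDerivAt P (-(2 * (x - t) * c / (Real.pi * ((x - t) ^ 2 + c ^ 2) ^ 2))) x := by
    intro x
    have hD : (x - t) ^ 2 + c ^ 2 ≠ 0 := by positivity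
    have h1 : HasDerivAt (fun x : ℝ => Real.pi * ((x - t) ^ 2 + c ^ 2)) (Real.pi * (2 * (x - t))) x := by
      have := ((((hasDerivAt_id x).sub_const t).pow 2).add_const (c ^ 2)).const_mul Real.pi
      simpa using! this
    refine ((hasDerivAt_const x c).div h1 (by positivity)).congr_deriv ?_
    field_simp
    ring
  have hPc : Continuous P := continuous_iff_continuousAt.2 fun x => (hP x).continuousAt
  have hζc : Continuous fun x : ℝ => ζ (x, 0) := hζ.1.continuous.comp (by fun_prop)
  have hs := hasCompactSupport_boundary hζ
  have hQc : Continuous fun x : ℝ =>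
      -(2 * (x - t) * c / (Real.pi * ((x - t) ^ 2 + c ^ 2) ^ 2)) :=
    (Continuous.div (by fun_prop) (by fun_prop) fun x => by positivity).neg
  have hparts := integral_mul_deriv_eq_deriv_mul_of_integrable (u := P) (v := fun x => ζ (x, 0))
    (fun x _ => hP x) (fun x _ => hasDerivAt_boundary hζ x)
    ((hPc.mul (continuous_boundaryDeriv hζ)).integrable_of_hasCompactSupport
      (hasCompactSupport_boundaryDeriv hζ).mul_left)
    ((hQc.mul hζc).integrable_of_hasCompactSupport hs.mul_left)
    ((hPc.mul hζc).integrable_of_hasCompactSupport hs.mul_left)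
  have h1 : ∫ x : ℝ, (2 * (x - t) * c / (Real.pi * ((x - t) ^ 2 + c ^ 2) ^ 2)) * ζ (x, 0) =
      ∫ x, P x * boundaryDeriv ζ x := by
    rw [hparts, ← integral_neg]
    refine integral_congr_ae (Eventually.of_forall fun x => ?_)
    simp only
    ring
  rw [h1]
  have h2 := integral_add_left_eq_self (μ := volume) (fun x => P x * boundaryDeriv ζ x) t
  have h3 := Measure.integral_comp_mul_left (fun x => P (t + x) * boundaryDeriv ζ (t + x)) c
  rw [← h2]
  rw [smul_eq_mul, abs_of_pos (inv_pos.2 hc), eq_inv_mul_iff_mul_eq₀ hc.ne'] at h3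
  rw [← h3, ← integral_const_mul]
  refine integral_congr_ae (Eventually.of_forall fun y => ?_)
  have : c * P (t + c * y) = poissonOne y := by
    simp only [P, poissonOne, add_sub_cancel_left]
    field_simp
    ring
  simp only
  rw [← mul_assoc, this]

include hc hζ ha in
theorem inner_smoothedField_grad :
    inner ℝ (smoothedField c a) (hζ.memLp_grad.toLp (grad ζ)) =
      -∫ y, poissonOne y * ∫ x, a (x - c * y) * boundaryDeriv ζ x := by
  rw [inner_smoothedField hc ha]
  congr 1
  simp_rw [inner_poissonField_grad hc _ hζ, integral_charge_mul hc hζ, ← integral_const_mul]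
  obtain ⟨B, hB⟩ := (continuous_boundaryDeriv hζ).bounded_above_of_compact_support
    (hasCompactSupport_boundaryDeriv hζ)
  have hint : Integrable (fun p : ℝ × ℝ =>
      a p.1 * (poissonOne p.2 * boundaryDeriv ζ (p.1 + c * p.2))) (volume.prod volume) := by
    have := (ha.mul_prod integrable_poissonOne).mul_bdd (c := B)
      (g := fun p : ℝ × ℝ => boundaryDeriv ζ (p.1 + c * p.2))
      (((continuous_boundaryDeriv hζ).comp (by fun_prop)).aestronglyMeasurable)
      (Eventually.of_forall fun p => hB _)
    refine this.congr (Eventually.of_forall fun p => ?_)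
    simp only
    ring
  rw [integral_integral_swap hint]
  refine integral_congr_ae (Eventually.of_forall fun y => ?_)
  simp only
  rw [← integral_add_right_eq_self
    (fun x => poissonOne y * (a (x - c * y) * boundaryDeriv ζ x)) (c * y)]
  refine integral_congr_ae (Eventually.of_forall fun x => ?_)
  simp only [add_sub_cancel_right]
  ring

end Smoothing

/-- The stray field of `g`, for `g` bounded, continuous, vanishing at infinity and with finite
Gagliardo energy, together with its energy. It is the limit of the smoothed fields of compactly
supported approximations of `g`, which form a Cauchy sequence as their inner products converge. -/
theorem exists_strayField {g : ℝ → ℝ} (hg : Continuous g) {M : ℝ} (hM : ∀ x, |g x| ≤ M)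
    (hlim : Tendsto g (cocompact ℝ) (𝓝 0))
    (hG : Integrable fun p : ℝ × ℝ => (g p.1 - g p.2) ^ 2 / (p.1 - p.2) ^ 2) :
    ∃ v ∈ HDot1, ‖v‖ ^ 2 =
        (1 / (2 * Real.pi)) * ∫ p : ℝ × ℝ, (g p.1 - g p.2) ^ 2 / (p.1 - p.2) ^ 2 ∧
      ∀ ζ, ∀ hζ : IsTestFunction ζ,
        inner ℝ v (hζ.memLp_grad.toLp (grad ζ)) = -∫ x, g x * boundaryDeriv ζ x := by
  have hpi := Real.pi_pos
  let ε : ℕ → ℝ := fun n => 1 / ((n : ℝ) + 1)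
  have hε : ∀ n, 0 < ε n := fun n => by positivity
  have hεlim : Tendsto ε atTop (𝓝 0) := tendsto_one_div_add_atTop_nhds_zero_nat
  let a : ℕ → ℝ → ℝ := fun n x => softThreshold (ε n) (g x)
  have hac : ∀ n, Continuous (a n) := fun n => (continuous_softThreshold _).comp hg
  have has : ∀ n, HasCompactSupport (a n) := by
    intro n
    have : ∀ᶠ x in cocompact ℝ, a n x = 0 := by
      filter_upwards [hlim.eventually (Metric.ball_mem_nhds 0 (hε n))] with x hx
      rw [dist_zero_right] at hx
      exact softThreshold_eq_zero (le_of_lt hx)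
    rw [hasCompactSupport_iff_eventuallyEq, coclosedCompact_eq_cocompact]
    exact this
  have hai : ∀ n, Integrable (a n) := fun n => (hac n).integrable_of_hasCompactSupport (has n)
  have haM : ∀ n x, |a n x| ≤ M := fun n x => (abs_softThreshold_le (hε n).le _).trans (hM x)
  have hag : ∀ n x, |a n x - g x| ≤ ε n := fun n x => abs_softThreshold_sub_le (hε n).le _
  have hal : ∀ x, Tendsto (fun n => a n x) atTop (𝓝 (g x)) := fun x => by
    rw [tendsto_iff_norm_sub_tendsto_zero]
    exact squeeze_zero (fun _ => norm_nonneg _) (fun n => hag n x) hεlim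
  let w : ℕ → Lp Plane 2 halfPlaneVolume := fun n => smoothedField (ε n) (a n)
  set L := (1 / (2 * Real.pi)) * ∫ p : ℝ × ℝ, (g p.1 - g p.2) ^ 2 / (p.1 - p.2) ^ 2 with hL
  have hinner : ∀ k : ℕ × ℕ, inner ℝ (w k.1) (w k.2) = ∫ p : ℝ × ℝ,
      -(1 / 2) * ((a k.1 p.1 - a k.1 p.2) * (a k.2 p.1 - a k.2 p.2) *
        gramKernel (ε k.1 + ε k.2) (p.1 - p.2)) := fun k =>
    inner_smoothedField_smoothedField (hε _) (hai _) (hε _) (hai _) (hac _) (haM _)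
  have hfst : Tendsto (Prod.fst : ℕ × ℕ → ℕ) atTop atTop := by
    rw [← prod_atTop_atTop_eq]; exact tendsto_fst
  have hsnd : Tendsto (Prod.snd : ℕ × ℕ → ℕ) atTop atTop := by
    rw [← prod_atTop_atTop_eq]; exact tendsto_snd
  have hconv : Tendsto (fun k : ℕ × ℕ => inner ℝ (w k.1) (w k.2)) atTop (𝓝 L) := by
    simp_rw [hinner]
    rw [hL, ← integral_const_mul]
    refine tendsto_integral_filter_of_dominated_convergence
      (fun p : ℝ × ℝ => (1 / (2 * Real.pi)) * ((g p.1 - g p.2) ^ 2 / (p.1 - p.2) ^ 2))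
      (Eventually.of_forall fun k => ?_) (Eventually.of_forall fun k => ?_)
      (hG.const_mul _) (Eventually.of_forall fun p => ?_)
    · have h1 := continuous_gramKernel (add_pos (hε k.1) (hε k.2))
      have h2 := hac k.1
      have h3 := hac k.2
      exact Continuous.aestronglyMeasurable (by fun_prop)
    · refine Eventually.of_forall fun p => ?_
      rcases eq_or_ne (p.1 - p.2) 0 with h0 | h0
      · have : p.1 = p.2 := sub_eq_zero.1 h0
        simp [this]
      have h1 := abs_softThreshold_sub_softThreshold_le (hε k.1).le (g p.1) (g p.2)
      have h2 := abs_softThreshold_sub_softThreshold_le (hε k.2).le (g p.1) (g p.2)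
      have h3 : |gramKernel (ε k.1 + ε k.2) (p.1 - p.2)| ≤ 1 / (Real.pi * (p.1 - p.2) ^ 2) := by
        refine (abs_gramKernel_le (add_pos (hε k.1) (hε k.2)) _).trans ?_
        gcongr
        nlinarith [sq_nonneg (ε k.1 + ε k.2)]
      rw [norm_mul, norm_mul, norm_mul, Real.norm_eq_abs, Real.norm_eq_abs, Real.norm_eq_abs,
        Real.norm_eq_abs]
      calc |-(1 / 2 : ℝ)| * (|a k.1 p.1 - a k.1 p.2| * |a k.2 p.1 - a k.2 p.2| *
            |gramKernel (ε k.1 + ε k.2) (p.1 - p.2)|)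
          ≤ (1 / 2) * (|g p.1 - g p.2| * |g p.1 - g p.2| * (1 / (Real.pi * (p.1 - p.2) ^ 2))) := by
            rw [abs_neg, abs_of_pos (by norm_num)]
            gcongr
        _ = _ := by
            rw [abs_mul_abs_self]
            field_simp
    · rcases eq_or_ne (p.1 - p.2) 0 with h0 | h0
      · have : p.1 = p.2 := sub_eq_zero.1 h0
        simp [this]
      have h1 := ((hal p.1).sub (hal p.2)).comp hfst
      have h2 := ((hal p.1).sub (hal p.2)).comp hsnd
      have h3 : Tendsto (fun k : ℕ × ℕ => ε k.1 + ε k.2) atTop (𝓝 0) := by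
        simpa using (hεlim.comp hfst).add (hεlim.comp hsnd)
      have h4 := ((h1.mul h2).mul ((tendsto_gramKernel h0).comp h3)).const_mul (-(1 / 2))
      have e : (1 / (2 * Real.pi)) * ((g p.1 - g p.2) ^ 2 / (p.1 - p.2) ^ 2) =
          -(1 / 2) * ((g p.1 - g p.2) * (g p.1 - g p.2) * -(1 / (Real.pi * (p.1 - p.2) ^ 2))) := by
        field_simp
      rw [e]
      exact h4
  obtain ⟨v, hv, hvL⟩ := exists_tendsto_of_tendsto_inner hconv
  refine ⟨v, ?_, hvL, ?_⟩
  · exact (Submodule.isClosed_topologicalClosure _).mem_of_tendsto hv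
      (Eventually.of_forall fun n => smoothedField_mem (hε n) (hai n))
  · intro ζ hζ
    have h1 : Tendsto (fun n : ℕ => inner ℝ (w n) (hζ.memLp_grad.toLp (grad ζ))) atTop
        (𝓝 (inner ℝ v (hζ.memLp_grad.toLp (grad ζ)))) := hv.inner tendsto_const_nhds
    refine tendsto_nhds_unique h1 ?_
    have hz := continuous_boundaryDeriv hζ
    have hzi := integrable_boundaryDeriv hζ
    simp only [w, inner_smoothedField_grad (hε _) (hai _) hζ]
    refine Tendsto.neg ?_
    have hrhs : ∫ x, g x * boundaryDeriv ζ x =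
        ∫ y, poissonOne y * ∫ x, g x * boundaryDeriv ζ x := by
      rw [integral_mul_const, integral_poissonOne, one_mul]
    rw [hrhs]
    have hM0 : 0 ≤ M := (abs_nonneg _).trans (hM 0)
    refine tendsto_integral_of_dominated_convergence
      (fun y => poissonOne y * ∫ x, M * ‖boundaryDeriv ζ x‖) (fun n => ?_)
      (integrable_poissonOne.mul_const _) (fun n => Eventually.of_forall fun y => ?_)
      (Eventually.of_forall fun y => Tendsto.const_mul _ ?_)
    · refine integrable_poissonOne.aestronglyMeasurable.mul ?_
      have : StronglyMeasurable fun y : ℝ => ∫ x, a n (x - ε n * y) * boundaryDeriv ζ x := by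
        refine StronglyMeasurable.integral_prod_right (f := fun y x =>
          a n (x - ε n * y) * boundaryDeriv ζ x) ?_
        refine Continuous.stronglyMeasurable ?_
        have := hac n
        fun_prop
      exact this.aestronglyMeasurable
    · rw [norm_mul, Real.norm_of_nonneg (poissonOne_nonneg y)]
      refine mul_le_mul_of_nonneg_left ?_ (poissonOne_nonneg y)
      refine norm_integral_le_of_norm_le (hzi.norm.const_mul M) (Eventually.of_forall fun x => ?_)
      rw [norm_mul]
      gcongr
      exact haM n _
    · refine tendsto_integral_of_dominated_convergence (fun x => M * ‖boundaryDeriv ζ x‖)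
        (fun n => ?_) (hzi.norm.const_mul M) (fun n => Eventually.of_forall fun x => ?_)
        (Eventually.of_forall fun x => Tendsto.mul_const _ ?_)
      · have := hac n
        exact Continuous.aestronglyMeasurable (by fun_prop)
      · rw [norm_mul]
        gcongr
        exact haM n _
      · have h2 : Tendsto (fun n => g (x - ε n * y)) atTop (𝓝 (g x)) := by
          have : Tendsto (fun n => x - ε n * y) atTop (𝓝 (x - 0 * y)) :=
            tendsto_const_nhds.sub (hεlim.mul_const y)
          rw [zero_mul, sub_zero] at this
          exact (hg.tendsto x).comp this
        have h3 : Tendsto (fun n => a n (x - ε n * y) - g (x - ε n * y)) atTop (𝓝 0) :=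
          squeeze_zero_norm (fun n => hag n _) hεlim
        simpa using h3.add h2

/-! ### The stray field energy as a Gagliardo seminorm -/

/-- The Gagliardo (semi)norm `∫∫ (f(x) - f(y))² / (x - y)² dx dy` of `H^{1/2}(ℝ)`. -/
def gagliardo (f : ℝ → ℝ) : ℝ≥0∞ :=
  ∫⁻ p : ℝ × ℝ, ENNReal.ofReal ((f p.1 - f p.2) ^ 2 / (p.1 - p.2) ^ 2)

theorem measurable_gagliardo_integrand {f : ℝ → ℝ} (hf : Continuous f) :
    Measurable fun p : ℝ × ℝ => (f p.1 - f p.2) ^ 2 / (p.1 - p.2) ^ 2 := by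
  have := hf.measurable
  fun_prop

theorem integrable_gagliardo {f : ℝ → ℝ} (hf : Continuous f) (hG : gagliardo f < ⊤) :
    Integrable fun p : ℝ × ℝ => (f p.1 - f p.2) ^ 2 / (p.1 - p.2) ^ 2 := by
  refine ⟨(measurable_gagliardo_integrand hf).aestronglyMeasurable, ?_⟩
  rw [hasFiniteIntegral_iff_ofReal (Eventually.of_forall fun p => by positivity)]
  exact hG

theorem lintegral_enorm_sq (v : Lp Plane 2 halfPlaneVolume) :
    ∫⁻ p, ‖v p‖ₑ ^ 2 ∂halfPlaneVolume = ENNReal.ofReal (‖v‖ ^ 2) := by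
  have h1 : Integrable (fun p => ‖v p‖ ^ 2) halfPlaneVolume :=
    (Lp.memLp v).integrable_norm_pow two_ne_zero
  have h2 : ‖v‖ ^ 2 = ∫ p, ‖v p‖ ^ 2 ∂halfPlaneVolume := by
    rw [← real_inner_self_eq_norm_sq, L2.inner_def]
    simp only [real_inner_self_eq_norm_sq]
  rw [h2, ofReal_integral_eq_lintegral_ofReal h1 (Eventually.of_forall fun p => by positivity)]
  refine lintegral_congr fun p => ?_
  rw [ENNReal.ofReal_pow (norm_nonneg _), ofReal_norm]

/-- Integration by parts for a locally absolutely continuous function against a test function. -/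
theorem integral_deriv_mul_boundary {f : ℝ → ℝ}
    (hac : ∀ a b : ℝ, a ≤ b → AbsolutelyContinuousOnInterval f a b) (h : ℝ) {ζ : ℝ × ℝ → ℝ}
    (hζ : IsTestFunction ζ) :
    ∫ x : ℝ, deriv f x * ζ (x, 0) = -∫ x, (f x - h) * boundaryDeriv ζ x := by
  obtain ⟨R, hR0, hR⟩ : ∃ R : ℝ, 0 < R ∧ ∀ x : ℝ, R ≤ |x| → x ∉ tsupport fun x : ℝ => ζ (x, 0) := by
    obtain ⟨R, hR⟩ := (hasCompactSupport_boundary hζ).isBounded.subset_ball 0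
    refine ⟨max R 1, by positivity, fun p hp hm => ?_⟩
    have := hR hm
    rw [mem_ball_zero_iff, Real.norm_eq_abs] at this
    exact absurd this (not_lt.2 ((le_max_left _ _).trans hp))
  have hz : ∀ x : ℝ, R ≤ |x| → ζ (x, 0) = 0 := fun x hx =>
    image_eq_zero_of_notMem_tsupport (f := fun x : ℝ => ζ (x, 0)) (hR x hx)
  have hz' : ∀ x : ℝ, R ≤ |x| → boundaryDeriv ζ x = 0 := fun x hx => by
    rw [← (hasDerivAt_boundary hζ x).deriv]
    exact image_eq_zero_of_notMem_tsupport fun hm => hR x hx (tsupport_deriv_subset hm)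
  have hout : ∀ x, x ∉ Set.Ioc (-R) R → R ≤ |x| := by
    intro x hx
    by_contra hlt
    rw [not_le, abs_lt] at hlt
    exact hx ⟨hlt.1, hlt.2.le⟩
  have hle : -R ≤ R := by linarith
  have hζd : ∀ x, deriv (fun x : ℝ => ζ (x, 0)) x = boundaryDeriv ζ x := fun x =>
    (hasDerivAt_boundary hζ x).deriv
  have hζs : ContDiff ℝ 1 fun x : ℝ => ζ (x, 0) :=
    (hζ.1.of_le (by simp)).comp (by fun_prop)
  have hparts := ((hac (-R) R hle).sub
    (contDiffOn_const (c := h) (s := Set.uIcc (-R) R) (n := 1)).absolutelyContinuousOnInterval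
      ).integral_mul_deriv_eq_deriv_mul
    (hζs.contDiffOn (s := Set.uIcc (-R) R)).absolutelyContinuousOnInterval
  have hd : ∀ x, deriv (f - fun _ => h) x = deriv f x := fun x => deriv_sub_const (f := f) h
  simp only [hd, hζd, hz R (le_abs_self R), hz (-R) (by rw [abs_neg]; exact le_abs_self R),
    mul_zero, sub_zero, zero_sub, Pi.sub_apply] at hparts
  rw [intervalIntegral.integral_of_le hle, intervalIntegral.integral_of_le hle,
    setIntegral_eq_integral_of_forall_compl_eq_zero fun x hx => by rw [hz' x (hout x hx), mul_zero],
    setIntegral_eq_integral_of_forall_compl_eq_zero fun x hx => by rw [hz x (hout x hx), mul_zero]]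
    at hparts
  rw [hparts, neg_neg]

theorem strayFieldEnergy_eq_of_isStrayField {f : ℝ → ℝ} {v : Lp Plane 2 halfPlaneVolume}
    (hv : IsStrayField f v) : strayFieldEnergy f = 2⁻¹ * ENNReal.ofReal (‖v‖ ^ 2) := by
  rw [← lintegral_enorm_sq]
  refine le_antisymm (iInf₂_le v hv) (le_iInf₂ fun v' hv' => ?_)
  rw [hv.unique hv']

/-- The stray field energy is a multiple of the Gagliardo seminorm. -/
theorem strayFieldEnergy_eq {f : ℝ → ℝ} {h M : ℝ} (hf : Continuous f)
    (hac : ∀ a b : ℝ, a ≤ b → AbsolutelyContinuousOnInterval f a b) (hM : ∀ x, |f x| ≤ M)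
    (hlim : Tendsto f (cocompact ℝ) (𝓝 h)) (hG : gagliardo f < ⊤) :
    strayFieldEnergy f = ENNReal.ofReal (1 / (4 * Real.pi)) * gagliardo f := by
  have hGi := integrable_gagliardo hf hG
  obtain ⟨v, hv, hvn, hvi⟩ := exists_strayField (g := fun x => f x - h) (M := M + |h|)
    (hf.sub continuous_const)
    (fun x => (abs_sub _ _).trans (by linarith [hM x])) (by simpa using hlim.sub_const h)
    (by simpa only [sub_sub_sub_cancel_right] using hGi)
  simp only [sub_sub_sub_cancel_right] at hvn
  have hstray : IsStrayField f v := by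
    refine ⟨hv, fun ζ hζ => ?_⟩
    rw [integral_inner_eq hζ.memLp_grad, hvi ζ hζ, integral_deriv_mul_boundary hac h hζ]
  rw [strayFieldEnergy_eq_of_isStrayField hstray, hvn, gagliardo,
    ← ofReal_integral_eq_lintegral_ofReal hGi (Eventually.of_forall fun p => by positivity),
    ← ENNReal.ofReal_mul (by positivity), ← ENNReal.ofReal_ofNat, ← ENNReal.ofReal_inv_of_pos
    (by norm_num), ← ENNReal.ofReal_mul (by norm_num)]
  congr 1
  ring

/-! ### Functions of class `H¹` have finite Gagliardo seminorm -/

theorem sq_lintegral_le {X : Type*} [MeasurableSpace X] {μ : Measure X} {F : X → ℝ≥0∞}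
    (hF : AEMeasurable F μ) : (∫⁻ x, F x ∂μ) ^ 2 ≤ μ Set.univ * ∫⁻ x, F x ^ 2 ∂μ := by
  have h := ENNReal.lintegral_mul_le_Lp_mul_Lq μ Real.HolderConjugate.two_two
    (aemeasurable_const (b := (1 : ℝ≥0∞))) hF
  simp only [Pi.mul_apply, one_mul, lintegral_const, ENNReal.rpow_two, one_pow] at h
  have hroot : ∀ z : ℝ≥0∞, (z ^ (1 / 2 : ℝ)) ^ 2 = z := fun z => by
    rw [← ENNReal.rpow_natCast, ← ENNReal.rpow_mul]
    norm_num
  have h2 := pow_le_pow_left' h 2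
  rwa [mul_pow, hroot, hroot] at h2

theorem ofReal_sq_eq_enorm (x : ℝ) : ENNReal.ofReal (x ^ 2) = ‖x‖ₑ ^ 2 := by
  rw [Real.enorm_eq_ofReal_abs, ← ENNReal.ofReal_pow (abs_nonneg x), sq_abs]

theorem sq_increment_le {f : ℝ → ℝ} {x s : ℝ}
    (hac : AbsolutelyContinuousOnInterval f x (x + s)) :
    ENNReal.ofReal ((f (x + s) - f x) ^ 2) ≤ ENNReal.ofReal |s| *
      ∫⁻ t in Set.uIoc 0 s, ENNReal.ofReal (deriv f (x + t) ^ 2) := by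
  rw [ofReal_sq_eq_enorm, ← hac.integral_deriv_eq_sub]
  have hm : Measurable (deriv f) := measurable_deriv f
  have h1 : ‖∫ t in x..x + s, deriv f t‖ₑ ≤ ∫⁻ t in Set.uIoc 0 s, ‖deriv f (x + t)‖ₑ := by
    rw [intervalIntegral.intervalIntegral_eq_integral_uIoc, enorm_smul]
    have : ‖(if x ≤ x + s then 1 else -1 : ℝ)‖ₑ = 1 := by split_ifs <;> simp
    rw [this, one_mul]
    refine (enorm_integral_le_lintegral_enorm _).trans (le_of_eq ?_)
    rw [← lintegral_indicator measurableSet_uIoc, ← lintegral_indicator measurableSet_uIoc,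
      ← lintegral_add_left_eq_self _ x]
    refine lintegral_congr fun t => ?_
    have : x + t ∈ Set.uIoc x (x + s) ↔ t ∈ Set.uIoc 0 s := by
      simp only [Set.mem_uIoc]
      constructor <;> (rintro (⟨h1, h2⟩ | ⟨h1, h2⟩)) <;> [left; right; left; right] <;>
        constructor <;> linarith
    by_cases h : t ∈ Set.uIoc 0 s
    · rw [Set.indicator_of_mem h, Set.indicator_of_mem (this.2 h)]
    · rw [Set.indicator_of_notMem h, Set.indicator_of_notMem (fun h' => h (this.1 h'))]
  refine (pow_le_pow_left' h1 2).trans ((sq_lintegral_le (by fun_prop)).trans (le_of_eq ?_))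
  congr 1
  · rw [Measure.restrict_apply_univ, Real.volume_uIoc, sub_zero]
  · simp only [ofReal_sq_eq_enorm]

theorem lintegral_sq_increment_le {f : ℝ → ℝ}
    (hac : ∀ a b : ℝ, a ≤ b → AbsolutelyContinuousOnInterval f a b) (s : ℝ) :
    ∫⁻ x, ENNReal.ofReal ((f (x + s) - f x) ^ 2) ≤
      ENNReal.ofReal (s ^ 2) * ∫⁻ x, ENNReal.ofReal (deriv f x ^ 2) := by
  have hm : Measurable (deriv f) := measurable_deriv f
  have hac' : ∀ x, AbsolutelyContinuousOnInterval f x (x + s) := fun x => by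
    rcases le_total x (x + s) with h | h
    · exact hac _ _ h
    · exact (hac _ _ h).symm
  calc ∫⁻ x, ENNReal.ofReal ((f (x + s) - f x) ^ 2)
      ≤ ∫⁻ x, ENNReal.ofReal |s| * ∫⁻ t in Set.uIoc 0 s, ENNReal.ofReal (deriv f (x + t) ^ 2) :=
        lintegral_mono fun x => sq_increment_le (hac' x)
    _ = ENNReal.ofReal |s| * ∫⁻ t in Set.uIoc 0 s, ∫⁻ x, ENNReal.ofReal (deriv f (x + t) ^ 2) := by
        rw [lintegral_const_mul' _ _ ENNReal.ofReal_ne_top, lintegral_lintegral_swap]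
        exact Measurable.aemeasurable (by fun_prop)
    _ = _ := by
        simp_rw [fun t => lintegral_add_right_eq_self (μ := volume)
          (fun x => ENNReal.ofReal (deriv f x ^ 2)) t]
        rw [lintegral_const, mul_comm (lintegral _ _), ← mul_assoc]
        rw [Measure.restrict_apply_univ, Real.volume_uIoc, sub_zero,
          ← ENNReal.ofReal_mul (abs_nonneg s), abs_mul_abs_self, sq]

/-- The integral over the pairs at distance `|s|` is controlled by `f'` if `|s| ≤ 1`, and by `f - h`
otherwise. -/
theorem gagliardo_lt_top {f : ℝ → ℝ} {h : ℝ} (hf : Continuous f)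
    (hac : ∀ a b : ℝ, a ≤ b → AbsolutelyContinuousOnInterval f a b)
    (hd : ∫⁻ x, ENNReal.ofReal (deriv f x ^ 2) < ⊤) (hL : ∫⁻ x, ENNReal.ofReal ((f x - h) ^ 2) < ⊤) :
    gagliardo f < ⊤ := by
  have hfm := hf.measurable
  set D := ∫⁻ x, ENNReal.ofReal (deriv f x ^ 2)
  set L := ∫⁻ x, ENNReal.ofReal ((f x - h) ^ 2) with hLdef
  have hI : ∀ s : ℝ, ∫⁻ x, ENNReal.ofReal ((f (x + s) - f x) ^ 2) ≤ 4 * L := by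
    intro s
    calc ∫⁻ x, ENNReal.ofReal ((f (x + s) - f x) ^ 2)
        ≤ ∫⁻ x, (2 * ENNReal.ofReal ((f (x + s) - h) ^ 2) + 2 * ENNReal.ofReal ((f x - h) ^ 2)) := by
          refine lintegral_mono fun x => ?_
          rw [← ENNReal.ofReal_ofNat, ← ENNReal.ofReal_mul (by norm_num),
            ← ENNReal.ofReal_mul (by norm_num), ← ENNReal.ofReal_add (by positivity) (by positivity)]
          apply ENNReal.ofReal_le_ofReal
          nlinarith [sq_nonneg ((f (x + s) - h) + (f x - h))]
      _ = 4 * L := by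
          rw [lintegral_add_left (by fun_prop), lintegral_const_mul _ (by fun_prop),
            lintegral_const_mul _ (by fun_prop),
            lintegral_add_right_eq_self (fun x => ENNReal.ofReal ((f x - h) ^ 2)) s, ← hLdef,
            ← add_mul]
          norm_num
  have hbound : ∀ s : ℝ, ∫⁻ x, ENNReal.ofReal ((f x - f (x + s)) ^ 2 / (x - (x + s)) ^ 2) ≤
      (D + 4 * L) * ENNReal.ofReal (2 * (1 + s ^ 2)⁻¹) := by
    intro s
    rcases eq_or_ne s 0 with rfl | hs
    · simp
    have hs2 : 0 < s ^ 2 := by positivity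
    have e1 : ∫⁻ x, ENNReal.ofReal ((f x - f (x + s)) ^ 2 / (x - (x + s)) ^ 2) =
        ENNReal.ofReal (1 / s ^ 2) * ∫⁻ x, ENNReal.ofReal ((f (x + s) - f x) ^ 2) := by
      rw [← lintegral_const_mul _ (by fun_prop)]
      refine lintegral_congr fun x => ?_
      rw [← ENNReal.ofReal_mul (by positivity)]
      congr 1
      rw [sub_add_cancel_left]
      ring
    rw [e1]
    rcases le_total (s ^ 2) 1 with h1 | h1
    · calc _ ≤ ENNReal.ofReal (1 / s ^ 2) * (ENNReal.ofReal (s ^ 2) * D) := by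
            gcongr
            exact lintegral_sq_increment_le hac s
        _ = D * 1 := by
            rw [← mul_assoc, ← ENNReal.ofReal_mul (by positivity), one_div,
              inv_mul_cancel₀ hs2.ne', ENNReal.ofReal_one, one_mul, mul_one]
        _ ≤ _ := by
            refine mul_le_mul' le_self_add ?_
            rw [← ENNReal.ofReal_one]
            apply ENNReal.ofReal_le_ofReal
            rw [← div_eq_mul_inv, le_div_iff₀ (by positivity)]
            linarith
    · calc _ ≤ ENNReal.ofReal (1 / s ^ 2) * (4 * L) := by
            gcongr
            exact hI s
        _ = 4 * L * ENNReal.ofReal (1 / s ^ 2) := mul_comm _ _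
        _ ≤ _ := by
            refine mul_le_mul' le_add_self ?_
            apply ENNReal.ofReal_le_ofReal
            rw [← div_eq_mul_inv, div_le_div_iff₀ hs2 (by positivity)]
            linarith
  have hmeas := measurable_gagliardo_integrand hf
  have e : gagliardo f = ∫⁻ s : ℝ, ∫⁻ x : ℝ, ENNReal.ofReal ((f x - f (x + s)) ^ 2 /
      (x - (x + s)) ^ 2) := by
    calc gagliardo f = ∫⁻ x : ℝ, ∫⁻ y : ℝ, ENNReal.ofReal ((f x - f y) ^ 2 / (x - y) ^ 2) := by
          rw [gagliardo, Measure.volume_eq_prod, lintegral_prod _ (by fun_prop)]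
      _ = ∫⁻ x : ℝ, ∫⁻ s : ℝ, ENNReal.ofReal ((f x - f (x + s)) ^ 2 / (x - (x + s)) ^ 2) :=
          lintegral_congr fun x => (lintegral_add_left_eq_self (μ := volume)
            (fun y => ENNReal.ofReal ((f x - f y) ^ 2 / (x - y) ^ 2)) x).symm
      _ = _ := lintegral_lintegral_swap (Measurable.aemeasurable (by fun_prop))
  rw [e]
  refine (lintegral_mono hbound).trans_lt ?_
  rw [lintegral_const_mul _ (by fun_prop)]
  refine ENNReal.mul_lt_top ?_ ?_
  · exact ENNReal.add_lt_top.2 ⟨hd, ENNReal.mul_lt_top (by simp) hL⟩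
  · exact (integrable_inv_one_add_sq.const_mul 2).lintegral_lt_top

/-! ### Liftings and their energy -/

/-- The map into the circle with lifting `φ`. -/
def angleMap (φ : ℝ → ℝ) (x : ℝ) : Plane := !₂[Real.cos (φ x), Real.sin (φ x)]

/-- `φ` is locally absolutely continuous, tends to `a` and `b` at `∓∞`, and the local part of the
energy of `(cos φ, sin φ)` is finite. -/
structure IsProfile (h : ℝ) (φ : ℝ → ℝ) (a b : ℝ) : Prop where
  ac : ∀ x y : ℝ, x ≤ y → AbsolutelyContinuousOnInterval φ x y
  tendsto_atBot : Tendsto φ atBot (𝓝 a)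
  tendsto_atTop : Tendsto φ atTop (𝓝 b)
  lintegral_lt_top : ∫⁻ x, ENNReal.ofReal (deriv φ x ^ 2 + (Real.cos (φ x) - h) ^ 2) < ⊤

/-- The energy of `(cos φ, sin φ)` in terms of the lifting `φ`. -/
def liftEnergy (h : ℝ) (φ : ℝ → ℝ) : ℝ≥0∞ :=
  2⁻¹ * (∫⁻ x, ENNReal.ofReal (deriv φ x ^ 2 + (Real.cos (φ x) - h) ^ 2)) +
    ENNReal.ofReal (1 / (4 * Real.pi)) * gagliardo fun x => Real.cos (φ x)

section AbsolutelyContinuous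

theorem continuous_of_ac {φ : ℝ → ℝ}
    (hac : ∀ x y : ℝ, x ≤ y → AbsolutelyContinuousOnInterval φ x y) : Continuous φ := by
  rw [continuous_iff_continuousAt]
  intro x
  have h := (hac (x - 1) (x + 1) (by linarith)).continuousOn
  rw [Set.uIcc_of_le (by linarith)] at h
  exact h.continuousAt (Icc_mem_nhds (by linarith) (by linarith))

theorem ae_differentiableAt_of_ac {φ : ℝ → ℝ}
    (hac : ∀ x y : ℝ, x ≤ y → AbsolutelyContinuousOnInterval φ x y) :
    ∀ᵐ x, DifferentiableAt ℝ φ x := by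
  have h : ∀ n : ℕ, ∀ᵐ x : ℝ, x ∈ Set.uIcc (-(n : ℝ)) n → DifferentiableAt ℝ φ x := fun n =>
    (hac _ _ (by linarith [(Nat.cast_nonneg n : (0:ℝ) ≤ n)])).ae_differentiableAt
  filter_upwards [ae_all_iff.2 h] with x hx
  obtain ⟨n, hn⟩ := exists_nat_ge |x|
  refine hx n ?_
  rw [Set.uIcc_of_le (by linarith [(Nat.cast_nonneg n : (0:ℝ) ≤ n)])]
  exact abs_le.1 hn

/-- A function whose small increments are controlled by those of two absolutely continuous functions
is absolutely continuous. -/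
theorem absolutelyContinuous_of_dist_le {φ u v : ℝ → ℝ} {a b C δ : ℝ} (hδ : 0 < δ)
    (hu : AbsolutelyContinuousOnInterval u a b) (hv : AbsolutelyContinuousOnInterval v a b)
    (h : ∀ x ∈ Set.uIcc a b, ∀ y ∈ Set.uIcc a b, dist x y < δ →
      dist (φ x) (φ y) ≤ C * (dist (u x) (u y) + dist (v x) (v y))) :
    AbsolutelyContinuousOnInterval φ a b := by
  have hlim := (hu.add hv)
  have hlim : Tendsto (fun E : ℕ × (ℕ → ℝ × ℝ) => C *
      (∑ i ∈ Finset.range E.1, dist (u (E.2 i).1) (u (E.2 i).2) +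
        ∑ i ∈ Finset.range E.1, dist (v (E.2 i).1) (v (E.2 i).2)))
      (AbsolutelyContinuousOnInterval.totalLengthFilter ⊓
        𝓟 (AbsolutelyContinuousOnInterval.disjWithin a b)) (𝓝 0) := by
    simpa using (Tendsto.add hu hv).const_mul C
  refine squeeze_zero' (Eventually.of_forall fun E => Finset.sum_nonneg fun i _ => dist_nonneg) ?_
    hlim
  have hsmall : ∀ᶠ E in AbsolutelyContinuousOnInterval.totalLengthFilter (X := ℝ),
      ∑ i ∈ Finset.range E.1, dist (E.2 i).1 (E.2 i).2 < δ :=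
    AbsolutelyContinuousOnInterval.hasBasis_totalLengthFilter.mem_of_mem hδ
  filter_upwards [hsmall.filter_mono inf_le_left, mem_inf_of_right (mem_principal_self _)]
    with E hE hmem
  rw [← Finset.sum_add_distrib, Finset.mul_sum]
  refine Finset.sum_le_sum fun i hi => ?_
  refine h _ (hmem.1 i hi).1 _ (hmem.1 i hi).2 (lt_of_le_of_lt ?_ hE)
  exact Finset.single_le_sum (f := fun i => dist (E.2 i).1 (E.2 i).2) (fun i _ => dist_nonneg) hi

theorem ac_comp_of_dist_le {φ F : ℝ → ℝ} {K : ℝ} (hF : ∀ x y, |F x - F y| ≤ K * |x - y|)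
    (hac : ∀ x y : ℝ, x ≤ y → AbsolutelyContinuousOnInterval φ x y) (x y : ℝ) (hxy : x ≤ y) :
    AbsolutelyContinuousOnInterval (fun t => F (φ t)) x y := by
  have hK : 0 ≤ K := by
    have := (abs_nonneg _).trans (hF 1 0)
    simpa using this
  refine absolutelyContinuous_of_dist_le one_pos (hac x y hxy) (hac x y hxy) (C := K)
    fun s _ t _ _ => ?_
  rw [Real.dist_eq, Real.dist_eq]
  nlinarith [hF (φ s) (φ t), abs_nonneg (φ s - φ t)]

theorem abs_cos_sub_cos_le (x y : ℝ) : |Real.cos x - Real.cos y| ≤ 1 * |x - y| := by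
  have := Real.lipschitzWith_cos.dist_le_mul x y
  simpa [Real.dist_eq] using this

theorem abs_sin_sub_sin_le (x y : ℝ) : |Real.sin x - Real.sin y| ≤ 1 * |x - y| := by
  have := Real.lipschitzWith_sin.dist_le_mul x y
  simpa [Real.dist_eq] using this

theorem abs_sub_le_of_circle {x y : ℝ} (h : |x - y| ≤ Real.pi) :
    |x - y| ≤ Real.pi / 2 * (|Real.cos x - Real.cos y| + |Real.sin x - Real.sin y|) := by
  have hpi := Real.pi_pos
  set t := (x - y) / 2 with ht
  have h1 : 2 / Real.pi * |t| ≤ |Real.sin t| := by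
    have habs : |t| ≤ Real.pi / 2 := by
      rw [ht, abs_div, abs_two]
      linarith
    have := Real.mul_le_sin (abs_nonneg t) habs
    refine this.trans ?_
    rcases abs_cases t with ⟨h, _⟩ | ⟨h, _⟩ <;> rw [h]
    · exact le_abs_self _
    · rw [Real.sin_neg]; exact neg_le_abs _
  have hcos := Real.cos_sub_cos x y
  have hsin := Real.sin_sub_sin x y
  rw [← ht] at hcos hsin
  set s := (x + y) / 2
  have hsq : (2 * |Real.sin t|) ^ 2 ≤
      (|Real.cos x - Real.cos y| + |Real.sin x - Real.sin y|) ^ 2 := by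
    have e : (2 * |Real.sin t|) ^ 2 = |Real.cos x - Real.cos y| ^ 2 +
        |Real.sin x - Real.sin y| ^ 2 := by
      rw [sq_abs, sq_abs, mul_pow, sq_abs, hcos, hsin]
      linear_combination (-4) * Real.sin t ^ 2 * Real.sin_sq_add_cos_sq s
    rw [e]
    nlinarith [abs_nonneg (Real.cos x - Real.cos y), abs_nonneg (Real.sin x - Real.sin y)]
  have h2 := abs_le_of_sq_le_sq hsq (by positivity)
  rw [abs_of_nonneg (by positivity)] at h2
  have h3 : |x - y| = 2 * |t| := by
    rw [ht, abs_div, abs_two]; ring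
  rw [h3]
  have h4 : |t| ≤ Real.pi / 2 * |Real.sin t| := by
    have := mul_le_mul_of_nonneg_left h1 (by positivity : 0 ≤ Real.pi / 2)
    have e : Real.pi / 2 * (2 / Real.pi * |t|) = |t| := by field_simp
    linarith
  nlinarith

/-- A continuous lifting of an absolutely continuous map into the circle is absolutely continuous. -/
theorem ac_lift {φ : ℝ → ℝ} (hφ : Continuous φ)
    (hc : ∀ x y : ℝ, x ≤ y → AbsolutelyContinuousOnInterval (fun t => Real.cos (φ t)) x y)
    (hs : ∀ x y : ℝ, x ≤ y → AbsolutelyContinuousOnInterval (fun t => Real.sin (φ t)) x y)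
    (x y : ℝ) (hxy : x ≤ y) : AbsolutelyContinuousOnInterval φ x y := by
  have huc : UniformContinuousOn φ (Set.uIcc x y) :=
    isCompact_uIcc.uniformContinuousOn_of_continuous hφ.continuousOn
  obtain ⟨δ, hδ, h⟩ := Metric.uniformContinuousOn_iff.1 huc Real.pi Real.pi_pos
  refine absolutelyContinuous_of_dist_le hδ (hc x y hxy) (hs x y hxy) (C := Real.pi / 2)
    fun s hs' t ht' hst => ?_
  exact abs_sub_le_of_circle (h s hs' t ht' hst).le

end AbsolutelyContinuous

theorem eq_zero_of_tendsto_of_lintegral_lt_top {u : ℝ → ℝ} {c : ℝ} (hu : Tendsto u atTop (𝓝 c))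
    (hc : 0 ≤ c) (hi : ∫⁻ x, ENNReal.ofReal (u x) < ⊤) : c = 0 := by
  by_contra hne
  have hpos : 0 < c := lt_of_le_of_ne hc (Ne.symm hne)
  obtain ⟨R, hR⟩ := eventually_atTop.1 (hu.eventually (lt_mem_nhds (half_lt_self hpos)))
  have : ∫⁻ x in Set.Ici R, ENNReal.ofReal (c / 2) ≤ ∫⁻ x, ENNReal.ofReal (u x) :=
    (setLIntegral_mono' measurableSet_Ici fun x hx =>
      ENNReal.ofReal_le_ofReal (hR x hx).le).trans (setLIntegral_le_lintegral _ _)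
  rw [setLIntegral_const, Real.volume_Ici, ENNReal.mul_top (by simpa using hpos)] at this
  exact absurd hi (not_lt.2 this)

namespace IsProfile

variable {h a b : ℝ} {φ : ℝ → ℝ}

theorem continuous (hφ : IsProfile h φ a b) : Continuous φ := continuous_of_ac hφ.ac

theorem lintegral_cos_lt_top (hφ : IsProfile h φ a b) :
    ∫⁻ x, ENNReal.ofReal ((Real.cos (φ x) - h) ^ 2) < ⊤ :=
  (lintegral_mono fun x => ENNReal.ofReal_le_ofReal (by nlinarith [sq_nonneg (deriv φ x)])).trans_lt
    hφ.lintegral_lt_top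

theorem lintegral_deriv_lt_top (hφ : IsProfile h φ a b) :
    ∫⁻ x, ENNReal.ofReal (deriv φ x ^ 2) < ⊤ :=
  (lintegral_mono fun x => ENNReal.ofReal_le_ofReal
    (by nlinarith [sq_nonneg (Real.cos (φ x) - h)])).trans_lt hφ.lintegral_lt_top

/-- Finite energy forces the limits of a lifting to be wells of the anisotropy potential. -/
theorem cos_right (hφ : IsProfile h φ a b) : Real.cos b = h := by
  have h1 : Tendsto (fun x => (Real.cos (φ x) - h) ^ 2) atTop (𝓝 ((Real.cos b - h) ^ 2)) :=
    (((Real.continuous_cos.tendsto b).comp hφ.tendsto_atTop).sub_const h).pow 2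
  have := eq_zero_of_tendsto_of_lintegral_lt_top h1 (sq_nonneg _) hφ.lintegral_cos_lt_top
  exact sub_eq_zero.1 (pow_eq_zero_iff two_ne_zero |>.1 this)

theorem cos_left (hφ : IsProfile h φ a b) : Real.cos a = h := by
  have h1 : Tendsto (fun x => (Real.cos (φ (-x)) - h) ^ 2) atTop (𝓝 ((Real.cos a - h) ^ 2)) :=
    (((Real.continuous_cos.tendsto a).comp
      (hφ.tendsto_atBot.comp tendsto_neg_atTop_atBot)).sub_const h).pow 2
  have h2 : ∫⁻ x, ENNReal.ofReal ((Real.cos (φ (-x)) - h) ^ 2) < ⊤ := by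
    rw [lintegral_neg_eq_self (fun x => ENNReal.ofReal ((Real.cos (φ x) - h) ^ 2))]
    exact hφ.lintegral_cos_lt_top
  have := eq_zero_of_tendsto_of_lintegral_lt_top h1 (sq_nonneg _) h2
  exact sub_eq_zero.1 (pow_eq_zero_iff two_ne_zero |>.1 this)

theorem tendsto_cos (hφ : IsProfile h φ a b) :
    Tendsto (fun x => Real.cos (φ x)) (cocompact ℝ) (𝓝 h) := by
  rw [cocompact_eq_atBot_atTop]
  refine Tendsto.sup ?_ ?_
  · rw [← hφ.cos_left]
    exact (Real.continuous_cos.tendsto a).comp hφ.tendsto_atBot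
  · rw [← hφ.cos_right]
    exact (Real.continuous_cos.tendsto b).comp hφ.tendsto_atTop

theorem ac_cos (hφ : IsProfile h φ a b) (x y : ℝ) (hxy : x ≤ y) :
    AbsolutelyContinuousOnInterval (fun t => Real.cos (φ t)) x y :=
  ac_comp_of_dist_le abs_cos_sub_cos_le hφ.ac x y hxy

theorem ac_sin (hφ : IsProfile h φ a b) (x y : ℝ) (hxy : x ≤ y) :
    AbsolutelyContinuousOnInterval (fun t => Real.sin (φ t)) x y :=
  ac_comp_of_dist_le abs_sin_sub_sin_le hφ.ac x y hxy

theorem ae_deriv (hφ : IsProfile h φ a b) : ∀ᵐ x,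
    deriv (fun t => Real.cos (φ t)) x = -Real.sin (φ x) * deriv φ x ∧
      deriv (fun t => Real.sin (φ t)) x = Real.cos (φ x) * deriv φ x := by
  filter_upwards [ae_differentiableAt_of_ac hφ.ac] with x hx
  exact ⟨hx.hasDerivAt.cos.deriv, hx.hasDerivAt.sin.deriv⟩

theorem gagliardo_lt_top (hφ : IsProfile h φ a b) : gagliardo (fun x => Real.cos (φ x)) < ⊤ := by
  refine NeelWall.gagliardo_lt_top (h := h) (Real.continuous_cos.comp hφ.continuous) hφ.ac_cos ?_
    hφ.lintegral_cos_lt_top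
  refine (lintegral_mono_ae ?_).trans_lt hφ.lintegral_deriv_lt_top
  filter_upwards [hφ.ae_deriv] with x hx
  rw [hx.1]
  apply ENNReal.ofReal_le_ofReal
  rw [mul_pow, neg_sq]
  exact mul_le_of_le_one_left (sq_nonneg _) (Real.sin_sq_le_one _)

theorem isH1LocCircle (hφ : IsProfile h φ a b) : IsH1LocCircle (angleMap φ) := by
  have hL : Integrable (fun x => deriv φ x ^ 2) := by
    refine ⟨((measurable_deriv φ).pow_const 2).aestronglyMeasurable, ?_⟩
    rw [hasFiniteIntegral_iff_ofReal (Eventually.of_forall fun x => sq_nonneg _)]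
    exact hφ.lintegral_deriv_lt_top
  have hmem : ∀ u : ℝ → ℝ, (∀ᵐ x, deriv u x ^ 2 ≤ deriv φ x ^ 2) → MemLp (deriv u) 2 volume := by
    intro u hu
    rw [memLp_two_iff_integrable_sq (measurable_deriv u).aestronglyMeasurable]
    refine hL.mono' ((measurable_deriv u).pow_const 2).aestronglyMeasurable ?_
    filter_upwards [hu] with x hx
    rwa [Real.norm_of_nonneg (sq_nonneg _)]
  refine ⟨fun x => ?_, fun i x y hxy => ?_⟩
  · rw [mem_sphere_zero_iff_norm, angleMap, norm_plane_mk, Real.cos_sq_add_sin_sq, Real.sqrt_one]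
  · fin_cases i
    · refine ⟨by simpa [angleMap] using hφ.ac_cos x y hxy, ?_⟩
      refine MemLp.restrict _ (hmem _ ?_)
      filter_upwards [hφ.ae_deriv] with t ht
      simp only [angleMap, Fin.zero_eta, Matrix.cons_val_zero]
      rw [ht.1, mul_pow, neg_sq]
      exact mul_le_of_le_one_left (sq_nonneg _) (Real.sin_sq_le_one _)
    · refine ⟨by simpa [angleMap] using hφ.ac_sin x y hxy, ?_⟩
      refine MemLp.restrict _ (hmem _ ?_)
      filter_upwards [hφ.ae_deriv] with t ht
      simp only [angleMap, Fin.mk_one, Matrix.cons_val_one, Matrix.cons_val_fin_one]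
      rw [ht.2, mul_pow]
      exact mul_le_of_le_one_left (sq_nonneg _) (Real.cos_sq_le_one _)

end IsProfile

theorem W_angleMap {h : ℝ} (h1 : h < 1) (φ : ℝ → ℝ) (x : ℝ) :
    2 * W h (angleMap φ x) = (Real.cos (φ x) - h) ^ 2 := by
  simp only [W, angleMap, min_eq_left h1.le, Matrix.cons_val_zero, PiLp.toLp_apply]
  ring

theorem lintegral_local_eq {h : ℝ} (h1 : h < 1) {φ : ℝ → ℝ}
    (hac : ∀ x y : ℝ, x ≤ y → AbsolutelyContinuousOnInterval φ x y) :
    ∫⁻ x : ℝ, ENNReal.ofReal (deriv (fun y => angleMap φ y 0) x ^ 2 +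
      deriv (fun y => angleMap φ y 1) x ^ 2 + 2 * W h (angleMap φ x)) =
    ∫⁻ x, ENNReal.ofReal (deriv φ x ^ 2 + (Real.cos (φ x) - h) ^ 2) := by
  refine lintegral_congr_ae ?_
  filter_upwards [ae_differentiableAt_of_ac hac] with x hx
  rw [W_angleMap h1]
  have e0 : (fun y => angleMap φ y 0) = fun y => Real.cos (φ y) := by
    funext y; simp [angleMap]
  have e1 : (fun y => angleMap φ y 1) = fun y => Real.sin (φ y) := by
    funext y; simp [angleMap]
  rw [e0, e1, hx.hasDerivAt.cos.deriv, hx.hasDerivAt.sin.deriv]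
  congr 1
  linear_combination deriv φ x ^ 2 * Real.sin_sq_add_cos_sq (φ x)

theorem IsProfile.energy_eq {h a b : ℝ} (h1 : h < 1) {φ : ℝ → ℝ} (hφ : IsProfile h φ a b) :
    energy h (angleMap φ) = liftEnergy h φ := by
  unfold energy liftEnergy
  rw [lintegral_local_eq h1 hφ.ac]
  congr 1
  have e0 : (fun y => angleMap φ y 0) = fun y => Real.cos (φ y) := by
    funext y; simp [angleMap]
  rw [e0]
  exact strayFieldEnergy_eq (Real.continuous_cos.comp hφ.continuous) hφ.ac_cos
    (fun x => Real.abs_cos_le_one _) hφ.tendsto_cos hφ.gagliardo_lt_top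

theorem IsProfile.liftEnergy_lt_top {h a b : ℝ} {φ : ℝ → ℝ} (hφ : IsProfile h φ a b) :
    liftEnergy h φ < ⊤ :=
  ENNReal.add_lt_top.2 ⟨ENNReal.mul_lt_top (by simp) hφ.lintegral_lt_top,
    ENNReal.mul_lt_top ENNReal.ofReal_lt_top hφ.gagliardo_lt_top⟩

theorem IsProfile.mem_admissible {h a b : ℝ} (h1 : h < 1) {φ : ℝ → ℝ} (hφ : IsProfile h φ a b) :
    angleMap φ ∈ admissible h ((b - a) / (2 * Real.pi)) :=
  ⟨hφ.isH1LocCircle, (hφ.energy_eq h1).trans_lt hφ.liftEnergy_lt_top,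
    φ, a, b, hφ.continuous, fun _ => rfl, hφ.tendsto_atBot, hφ.tendsto_atTop, rfl⟩

theorem IsProfile.minEnergy_le {h a b d : ℝ} (h1 : h < 1) {φ : ℝ → ℝ} (hφ : IsProfile h φ a b)
    (hd : d = (b - a) / (2 * Real.pi)) : minEnergy h d ≤ liftEnergy h φ := by
  rw [← hφ.energy_eq h1, hd]
  exact iInf₂_le _ (hφ.mem_admissible h1)

/-- Every admissible map has a lifting of the same energy. -/
theorem exists_profile {h d : ℝ} (h1 : h < 1) {m : ℝ → Plane} (hm : m ∈ admissible h d) :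
    ∃ φ a b, IsProfile h φ a b ∧ d = (b - a) / (2 * Real.pi) ∧ energy h m = liftEnergy h φ := by
  obtain ⟨hH, hE, φ, a, b, hφ, hlift, ha, hb, hd⟩ := hm
  have hm : m = angleMap φ := funext hlift
  subst hm
  have hac := ac_lift hφ
    (fun x y hxy => by simpa [angleMap] using ((hH.2 0) x y hxy).1)
    (fun x y hxy => by simpa [angleMap] using ((hH.2 1) x y hxy).1)
  have hfin : ∫⁻ x, ENNReal.ofReal (deriv φ x ^ 2 + (Real.cos (φ x) - h) ^ 2) < ⊤ := by
    rw [← lintegral_local_eq h1 hac]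
    by_contra htop
    rw [not_lt, top_le_iff] at htop
    rw [energy, htop, ENNReal.mul_top (by simp), top_add] at hE
    exact lt_irrefl _ hE
  have hp : IsProfile h φ a b := ⟨hac, ha, hb, hfin⟩
  exact ⟨φ, a, b, hp, hd, hp.energy_eq h1⟩

/-! ### Folding the circle -/

/-- The triangle wave of slope `±1` and period `4π` that is the identity on `[-π, π]`. -/
def triangleWave (t : ℝ) : ℝ := 2 * Real.arcsin (Real.sin (t / 2))

theorem abs_triangleWave_le (t : ℝ) : |triangleWave t| ≤ Real.pi := by
  have h1 := Real.arcsin_le_pi_div_two (Real.sin (t / 2))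
  have h2 := Real.neg_pi_div_two_le_arcsin (Real.sin (t / 2))
  unfold triangleWave
  rw [abs_le]
  constructor <;> linarith

theorem cos_triangleWave (t : ℝ) : Real.cos (triangleWave t) = Real.cos t := by
  have h : Real.cos t = Real.cos (2 * (t / 2)) := by congr 1; ring
  rw [triangleWave, h, Real.cos_two_mul, Real.cos_two_mul, Real.cos_sq', Real.cos_sq',
    Real.sin_arcsin (Real.neg_one_le_sin _) (Real.sin_le_one _)]

theorem triangleWave_add_two_pi (t : ℝ) : triangleWave (t + 2 * Real.pi) = -triangleWave t := by
  rw [triangleWave, triangleWave, show (t + 2 * Real.pi) / 2 = t / 2 + Real.pi by ring,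
    Real.sin_add_pi, Real.arcsin_neg, mul_neg]

theorem triangleWave_of_abs_le {t : ℝ} (ht : |t| ≤ Real.pi) : triangleWave t = t := by
  rw [abs_le] at ht
  rw [triangleWave, Real.arcsin_sin (by linarith) (by linarith)]
  ring

theorem abs_triangleWave_sub_le (s t : ℝ) : |triangleWave s - triangleWave t| ≤ |s - t| := by
  set x := s / 2 with hx
  set y := t / 2 with hy
  have hX : ∀ z, Real.sin (Real.arcsin (Real.sin z)) = Real.sin z := fun z =>
    Real.sin_arcsin (Real.neg_one_le_sin _) (Real.sin_le_one _)
  have hC : ∀ z, Real.cos (Real.arcsin (Real.sin z)) = |Real.cos z| := fun z => by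
    rw [Real.cos_arcsin, ← Real.abs_cos_eq_sqrt_one_sub_sin_sq]
  set X := Real.arcsin (Real.sin x) with hXd
  set Y := Real.arcsin (Real.sin y) with hYd
  have h1 : |X - Y| ≤ |x - y| := by
    by_contra hlt
    rw [not_le] at hlt
    have hXY : |X - Y| ≤ Real.pi := by
      have h1 := Real.arcsin_le_pi_div_two (Real.sin x)
      have h2 := Real.neg_pi_div_two_le_arcsin (Real.sin x)
      have h3 := Real.arcsin_le_pi_div_two (Real.sin y)
      have h4 := Real.neg_pi_div_two_le_arcsin (Real.sin y)
      rw [abs_le]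
      constructor <;> linarith
    have hcos := Real.cos_lt_cos_of_nonneg_of_le_pi (abs_nonneg (x - y)) hXY hlt
    rw [Real.cos_abs, Real.cos_abs, Real.cos_sub, Real.cos_sub, hX, hX, hC, hC, ← abs_mul] at hcos
    linarith [le_abs_self (Real.cos x * Real.cos y)]
  have e1 : triangleWave s - triangleWave t = 2 * (X - Y) := by
    simp only [triangleWave, ← hx, ← hy, ← hXd, ← hYd]; ring
  have e2 : s - t = 2 * (x - y) := by rw [hx, hy]; ring
  rw [e1, e2, abs_mul, abs_mul]
  gcongr

/-- The triangle wave, stretched by the factor `s` and truncated at `±β`. -/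
def fold (s β t : ℝ) : ℝ := max (-β) (min β (s * triangleWave t))

section Fold

variable {s β : ℝ}

theorem abs_clamp_sub_clamp_le (β x y : ℝ) :
    |max (-β) (min β x) - max (-β) (min β y)| ≤ |x - y| := by
  rw [max_comm (-β), max_comm (-β)]
  exact (abs_max_sub_max_le_abs _ _ _).trans (by simpa using abs_min_sub_min_le_max β x β y)

theorem abs_fold_sub_fold_le (hs : 0 ≤ s) (t t' : ℝ) :
    |fold s β t - fold s β t'| ≤ s * |t - t'| := by
  refine (abs_clamp_sub_clamp_le _ _ _).trans ?_
  rw [← mul_sub, abs_mul, abs_of_nonneg hs]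
  exact mul_le_mul_of_nonneg_left (abs_triangleWave_sub_le t t') hs

theorem abs_fold (hs : 0 ≤ s) (hβ : 0 ≤ β) (t : ℝ) :
    |fold s β t| = min (s * |triangleWave t|) β := by
  rw [fold, ← abs_of_nonneg hs, ← abs_mul, abs_of_nonneg hs]
  set x := s * triangleWave t
  rcases max_cases (-β) (min β x) with ⟨h1, h1'⟩ | ⟨h1, h1'⟩ <;>
  rcases min_cases β x with ⟨h3, h3'⟩ | ⟨h3, h3'⟩ <;>
  rcases min_cases |x| β with ⟨h4, h4'⟩ | ⟨h4, h4'⟩ <;>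
  rcases abs_cases x with ⟨h5, h5'⟩ | ⟨h5, h5'⟩ <;>
  rw [h1, h4] <;> (try rw [h3]) <;> (try rw [h5]) <;> (try rw [abs_neg]) <;>
  (try rw [abs_of_nonneg hβ]) <;> linarith

theorem fold_add_two_pi (hβ : 0 ≤ β) (t : ℝ) :
    fold s β (t + 2 * Real.pi) = -fold s β t := by
  rw [fold, fold, triangleWave_add_two_pi, mul_neg]
  set x := s * triangleWave t
  rcases max_cases (-β) (min β x) with ⟨h1, h1'⟩ | ⟨h1, h1'⟩ <;>
  rcases min_cases β x with ⟨h3, h3'⟩ | ⟨h3, h3'⟩ <;>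
  rcases max_cases (-β) (min β (-x)) with ⟨h2, h2'⟩ | ⟨h2, h2'⟩ <;>
  rcases min_cases β (-x) with ⟨h4, h4'⟩ | ⟨h4, h4'⟩ <;>
  rw [h1, h2] <;> linarith

theorem cos_fold (hs : 0 ≤ s) (hβ : 0 ≤ β) (t : ℝ) :
    Real.cos (fold s β t) = Real.cos (min (s * |triangleWave t|) β) := by
  rw [← Real.cos_abs, abs_fold hs hβ]

theorem cos_fold_one (hβ : 0 ≤ β) (hβ' : β ≤ Real.pi) (t : ℝ) :
    Real.cos (fold 1 β t) = max (Real.cos t) (Real.cos β) := by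
  rw [cos_fold zero_le_one hβ, one_mul, ← cos_triangleWave t, ← Real.cos_abs (triangleWave t)]
  have h1 := abs_triangleWave_le t
  have h0 := abs_nonneg (triangleWave t)
  rcases le_total |triangleWave t| β with h | h
  · rw [min_eq_left h, max_eq_left (Real.cos_le_cos_of_nonneg_of_le_pi h0 hβ' h)]
  · rw [min_eq_right h, max_eq_right (Real.cos_le_cos_of_nonneg_of_le_pi hβ h1 h)]

theorem sin_mul_le {s x : ℝ} (hs : 1 ≤ s) (hx : 0 ≤ x) (hsx : s * x ≤ Real.pi) :
    Real.sin (s * x) ≤ s * Real.sin x := by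
  have hs0 : 0 < s := by linarith
  have hx1 : s * x ∈ Set.Icc 0 Real.pi := ⟨by positivity, hsx⟩
  have hx0 : (0 : ℝ) ∈ Set.Icc 0 Real.pi := ⟨le_rfl, Real.pi_pos.le⟩
  have hs1 : 0 ≤ 1 - 1 / s := by rw [sub_nonneg, div_le_one hs0]; exact hs
  have h := strictConcaveOn_sin_Icc.concaveOn.2 hx1 hx0 (one_div_nonneg.2 hs0.le) hs1 (by ring)
  simp only [smul_eq_mul, Real.sin_zero, mul_zero, add_zero] at h
  rw [← mul_assoc, one_div, inv_mul_cancel₀ hs0.ne', one_mul, inv_mul_le_iff₀ hs0] at h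
  exact h

/-- The substance of `abs_cos_fold_sub_cos_fold_le`: by the formula for the difference of two cosines
and concavity of the sine, stretching by `s` enlarges `cos a - cos b` by at most `s²`. -/
theorem cos_stretch_aux (hs : 1 ≤ s) (hβ : 0 ≤ β) (hβ' : β ≤ Real.pi) {a b : ℝ} (ha : 0 ≤ a)
    (hab : a ≤ b) (hb : b ≤ Real.pi) :
    |Real.cos (min (s * a) β) - Real.cos (min (s * b) β)| ≤ s ^ 2 * |Real.cos a - Real.cos b| := by
  have hs0 : 0 < s := by linarith
  set c := β / s with hc
  have hc0 : 0 ≤ c := by positivity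
  have hsc : s * c = β := by rw [hc]; field_simp
  have hmin : ∀ x, min (s * x) β = s * min x c := fun x => by
    rw [mul_min_of_nonneg _ _ hs0.le, hsc]
  rw [hmin, hmin]
  set a' := min a c
  set b' := min b c
  have ha0 : 0 ≤ a' := le_min ha hc0
  have hab' : a' ≤ b' := min_le_min_right c hab
  have hbc : s * b' ≤ β := by
    rw [← hsc]
    exact mul_le_mul_of_nonneg_left (min_le_right _ _) hs0.le
  have hsab : s * a' ≤ s * b' := mul_le_mul_of_nonneg_left hab' hs0.le
  have hb'b : b' ≤ b := min_le_left _ _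
  have hsa0 : 0 ≤ s * a' := by positivity
  have hb's : b' ≤ s * b' := le_mul_of_one_le_left (ha0.trans hab') hs
  have m1 : Real.cos (s * b') ≤ Real.cos (s * a') :=
    Real.cos_le_cos_of_nonneg_of_le_pi hsa0 (hbc.trans hβ') hsab
  have m2 : Real.cos b ≤ Real.cos a := Real.cos_le_cos_of_nonneg_of_le_pi ha hb hab
  rw [abs_of_nonneg (sub_nonneg.2 m1), abs_of_nonneg (sub_nonneg.2 m2)]
  have key : Real.cos (s * a') - Real.cos (s * b') ≤ s ^ 2 * (Real.cos a' - Real.cos b') := by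
    have e : ∀ x y : ℝ, Real.cos x - Real.cos y =
        2 * (Real.sin ((x + y) / 2) * Real.sin ((y - x) / 2)) := fun x y => by
      rw [Real.cos_sub_cos, show (y - x) / 2 = -((x - y) / 2) by ring, Real.sin_neg]
      ring
    rw [e, e]
    have p1 : Real.sin (s * ((a' + b') / 2)) ≤ s * Real.sin ((a' + b') / 2) :=
      sin_mul_le hs (by linarith) (by linarith)
    have p2 : Real.sin (s * ((b' - a') / 2)) ≤ s * Real.sin ((b' - a') / 2) :=
      sin_mul_le hs (by linarith) (by linarith)
    have p3 : 0 ≤ Real.sin (s * ((b' - a') / 2)) :=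
      Real.sin_nonneg_of_nonneg_of_le_pi (by nlinarith) (by linarith)
    have p4 : 0 ≤ Real.sin ((a' + b') / 2) :=
      Real.sin_nonneg_of_nonneg_of_le_pi (by linarith) (by linarith)
    rw [show (s * a' + s * b') / 2 = s * ((a' + b') / 2) by ring,
      show (s * b' - s * a') / 2 = s * ((b' - a') / 2) by ring]
    have := mul_le_mul p1 p2 p3 (by positivity)
    nlinarith
  have key2 : Real.cos a' - Real.cos b' ≤ Real.cos a - Real.cos b := by
    rcases le_total b c with h | h
    · have e1 : b' = b := min_eq_left h
      have e2 : a' = a := min_eq_left (hab.trans h)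
      rw [e1, e2]
    · have e1 : b' = c := min_eq_right h
      rcases le_total a c with h' | h'
      · have e2 : a' = a := min_eq_left h'
        have := Real.cos_le_cos_of_nonneg_of_le_pi hc0 hb h
        rw [e1, e2]; linarith
      · have e2 : a' = c := min_eq_right h'
        rw [e1, e2]; linarith
  exact key.trans (mul_le_mul_of_nonneg_left key2 (sq_nonneg s))

/-- In terms of the first component of the map, folding is Lipschitz with constant `s²`. -/
theorem abs_cos_fold_sub_cos_fold_le (hs : 1 ≤ s) (hβ : 0 ≤ β) (hβ' : β ≤ Real.pi) (t t' : ℝ) :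
    |Real.cos (fold s β t) - Real.cos (fold s β t')| ≤ s ^ 2 * |Real.cos t - Real.cos t'| := by
  have hs0 : 0 ≤ s := by linarith
  rw [cos_fold hs0 hβ, cos_fold hs0 hβ, ← cos_triangleWave t, ← cos_triangleWave t',
    ← Real.cos_abs (triangleWave t), ← Real.cos_abs (triangleWave t')]
  rcases le_total |triangleWave t| |triangleWave t'| with h | h
  · exact cos_stretch_aux hs hβ hβ' (abs_nonneg _) h (abs_triangleWave_le _)
  · rw [abs_sub_comm, abs_sub_comm (Real.cos |triangleWave t|)]
    exact cos_stretch_aux hs hβ hβ' (abs_nonneg _) h (abs_triangleWave_le _)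

theorem fold_self (hs : 1 ≤ s) (hβ : 0 ≤ β) (hβ' : β ≤ Real.pi) : fold s β β = β := by
  rw [fold, triangleWave_of_abs_le (by rwa [abs_of_nonneg hβ]), min_eq_left (by nlinarith),
    max_eq_right (by linarith)]

theorem fold_neg_self (hs : 1 ≤ s) (hβ : 0 ≤ β) (hβ' : β ≤ Real.pi) : fold s β (-β) = -β := by
  rw [fold, triangleWave_of_abs_le (by rwa [abs_neg, abs_of_nonneg hβ]), min_eq_right (by nlinarith),
    max_eq_left (by nlinarith)]

theorem continuous_triangleWave : Continuous triangleWave := by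
  unfold triangleWave
  fun_prop

/-- If `s > 1`, then folding is constant near `β`. It makes a profile that tends to `β` equal to `β`
from some point on. -/
theorem eventually_fold_eq (hs : 1 < s) (hβ : 0 < β) (hβ' : β ≤ Real.pi) :
    ∀ᶠ t in 𝓝 β, fold s β t = β := by
  have hc : ContinuousAt (fun t => s * triangleWave t) β :=
    (continuous_const.mul continuous_triangleWave).continuousAt
  have h0 : β < s * triangleWave β := by
    rw [triangleWave_of_abs_le (by rwa [abs_of_pos hβ])]
    nlinarith
  filter_upwards [hc.eventually (lt_mem_nhds h0)] with t ht
  rw [fold, min_eq_left ht.le, max_eq_right (by linarith)]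

theorem eventually_fold_eq_neg (hs : 1 < s) (hβ : 0 < β) (hβ' : β ≤ Real.pi) :
    ∀ᶠ t in 𝓝 (-β), fold s β t = -β := by
  have hc : ContinuousAt (fun t => s * triangleWave t) (-β) :=
    (continuous_const.mul continuous_triangleWave).continuousAt
  have h0 : s * triangleWave (-β) < -β := by
    rw [triangleWave_of_abs_le (by rwa [abs_neg, abs_of_pos hβ])]
    nlinarith
  filter_upwards [hc.eventually (gt_mem_nhds h0)] with t ht
  rw [fold, max_eq_left]
  exact (min_le_right _ _).trans ht.le

/-- Folding moves every angle whose cosine is `cos β` to `β` or `-β`. -/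
theorem abs_fold_of_cos_eq (hβ : 0 ≤ β) (hβ' : β ≤ Real.pi) {t : ℝ}
    (ht : Real.cos t = Real.cos β) : |fold 1 β t| = β := by
  have h1 := cos_fold_one hβ hβ' t
  rw [ht, max_self, ← Real.cos_abs] at h1
  have h2 : |fold 1 β t| ≤ β := by
    rw [abs_fold zero_le_one hβ]
    exact min_le_right _ _
  exact Real.injOn_cos ⟨abs_nonneg _, h2.trans hβ'⟩ ⟨hβ, hβ'⟩ h1

end Fold

/-! ### Effect of a change of the lifting on the energy -/

theorem abs_deriv_le_of_abs_sub_le {f g : ℝ → ℝ} {x K : ℝ} (hf : DifferentiableAt ℝ f x)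
    (hg : DifferentiableAt ℝ g x) (h : ∀ y, |g y - g x| ≤ K * |f y - f x|) :
    |deriv g x| ≤ K * |deriv f x| := by
  have h1 := (hasDerivAt_iff_tendsto_slope.1 hg.hasDerivAt).abs
  have h2 := (hasDerivAt_iff_tendsto_slope.1 hf.hasDerivAt).abs.const_mul K
  refine le_of_tendsto_of_tendsto' h1 h2 fun y => ?_
  rw [slope_def_field, slope_def_field, abs_div, abs_div, ← mul_div_assoc]
  gcongr
  exact h y

/-- Changing the lifting by a map that is Lipschitz with constant `s` for the angle and `s²` for
the first component. -/
theorem IsProfile.comp {h a b s : ℝ} {φ Θ : ℝ → ℝ} (hφ : IsProfile h φ a b) (hs : 1 ≤ s)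
    (h1 : ∀ t t', |Θ t - Θ t'| ≤ s * |t - t'|)
    (h2 : ∀ t t', |Real.cos (Θ t) - Real.cos (Θ t')| ≤ s ^ 2 * |Real.cos t - Real.cos t'|)
    (h3 : ∀ t, |Real.cos (Θ t) - h| ≤ s ^ 2 * |Real.cos t - h|) :
    IsProfile h (fun x => Θ (φ x)) (Θ a) (Θ b) ∧
      liftEnergy h (fun x => Θ (φ x)) ≤ ENNReal.ofReal (s ^ 4) * liftEnergy h φ := by
  have hs0 : 0 ≤ s := by linarith
  have hs4 : s ^ 2 ≤ s ^ 4 := pow_le_pow_right₀ hs (by norm_num)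
  have hsq : ∀ {x y : ℝ}, |x| ≤ s ^ 2 * |y| → x ^ 2 ≤ s ^ 4 * y ^ 2 := fun {x y} hxy => by
    have := pow_le_pow_left₀ (abs_nonneg x) hxy 2
    rwa [mul_pow, sq_abs, sq_abs, ← pow_mul] at this
  have hac := ac_comp_of_dist_le h1 hφ.ac
  have hΘ : Continuous Θ := by
    refine (LipschitzWith.of_dist_le_mul (K := ⟨s, hs0⟩) fun t t' => ?_).continuous
    exact h1 t t'
  have hloc : ∫⁻ x, ENNReal.ofReal (deriv (fun x => Θ (φ x)) x ^ 2 + (Real.cos (Θ (φ x)) - h) ^ 2) ≤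
      ENNReal.ofReal (s ^ 4) *
        ∫⁻ x, ENNReal.ofReal (deriv φ x ^ 2 + (Real.cos (φ x) - h) ^ 2) := by
    rw [← lintegral_const_mul' _ _ ENNReal.ofReal_ne_top]
    refine lintegral_mono_ae ?_
    filter_upwards [ae_differentiableAt_of_ac hφ.ac, ae_differentiableAt_of_ac hac] with x d1 d2
    rw [← ENNReal.ofReal_mul (by positivity)]
    apply ENNReal.ofReal_le_ofReal
    rw [mul_add]
    refine add_le_add ?_ (hsq (h3 _))
    have := abs_deriv_le_of_abs_sub_le d1 d2 fun y => h1 (φ y) (φ x)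
    refine hsq (this.trans ?_)
    gcongr
    nlinarith
  refine ⟨⟨hac, (hΘ.tendsto a).comp hφ.tendsto_atBot, (hΘ.tendsto b).comp hφ.tendsto_atTop,
    hloc.trans_lt (ENNReal.mul_lt_top ENNReal.ofReal_lt_top hφ.lintegral_lt_top)⟩, ?_⟩
  have hG : gagliardo (fun x => Real.cos (Θ (φ x))) ≤
      ENNReal.ofReal (s ^ 4) * gagliardo fun x => Real.cos (φ x) := by
    unfold gagliardo
    rw [← lintegral_const_mul' _ _ ENNReal.ofReal_ne_top]
    refine lintegral_mono fun p => ?_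
    rw [← ENNReal.ofReal_mul (by positivity), ← mul_div_assoc]
    apply ENNReal.ofReal_le_ofReal
    gcongr
    exact hsq (h2 _ _)
  unfold liftEnergy
  calc _ ≤ 2⁻¹ * (ENNReal.ofReal (s ^ 4) *
        ∫⁻ x, ENNReal.ofReal (deriv φ x ^ 2 + (Real.cos (φ x) - h) ^ 2)) +
        ENNReal.ofReal (1 / (4 * Real.pi)) * (ENNReal.ofReal (s ^ 4) *
          gagliardo fun x => Real.cos (φ x)) := by gcongr
    _ = _ := by ring

/-- Folding onto the arc `[β, 2π - β]`, with stretching factor `s`. -/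
def foldDown (s β t : ℝ) : ℝ := fold s (Real.pi - β) (t - Real.pi) + Real.pi

theorem cos_foldDown (s β t : ℝ) :
    Real.cos (foldDown s β t) = -Real.cos (fold s (Real.pi - β) (t - Real.pi)) := by
  rw [foldDown, Real.cos_add_pi]

theorem cos_foldDown_one {β : ℝ} (hβ : 0 ≤ β) (hβ' : β ≤ Real.pi) (t : ℝ) :
    Real.cos (foldDown 1 β t) = min (Real.cos t) (Real.cos β) := by
  rw [cos_foldDown, cos_fold_one (by linarith) (by linarith), Real.cos_sub_pi, Real.cos_pi_sub,
    max_neg_neg, neg_neg]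

theorem abs_foldDown_sub_foldDown_le {s : ℝ} (hs : 0 ≤ s) (β t t' : ℝ) :
    |foldDown s β t - foldDown s β t'| ≤ s * |t - t'| := by
  have := abs_fold_sub_fold_le (β := Real.pi - β) hs (t - Real.pi) (t' - Real.pi)
  simpa [foldDown] using this

theorem abs_cos_foldDown_sub_cos_foldDown_le {s β : ℝ} (hs : 1 ≤ s) (hβ : 0 ≤ β)
    (hβ' : β ≤ Real.pi) (t t' : ℝ) :
    |Real.cos (foldDown s β t) - Real.cos (foldDown s β t')| ≤
      s ^ 2 * |Real.cos t - Real.cos t'| := by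
  have := abs_cos_fold_sub_cos_fold_le (β := Real.pi - β) hs (by linarith) (by linarith)
    (t' - Real.pi) (t - Real.pi)
  rw [Real.cos_sub_pi, Real.cos_sub_pi] at this
  rw [cos_foldDown, cos_foldDown]
  convert! this using 2
  · ring_nf
  · ring_nf

theorem foldDown_self {s β : ℝ} (hs : 1 ≤ s) (hβ : 0 ≤ β) (hβ' : β ≤ Real.pi) :
    foldDown s β β = β := by
  rw [foldDown, show β - Real.pi = -(Real.pi - β) by ring,
    fold_neg_self hs (by linarith) (by linarith)]
  ring

theorem IsProfile.comp_fold {h a b s β : ℝ} {φ : ℝ → ℝ} (hφ : IsProfile h φ a b) (hs : 1 ≤ s)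
    (hβ : 0 ≤ β) (hβ' : β ≤ Real.pi) (hβh : Real.cos β = h) :
    IsProfile h (fun x => fold s β (φ x)) (fold s β a) (fold s β b) ∧
      liftEnergy h (fun x => fold s β (φ x)) ≤ ENNReal.ofReal (s ^ 4) * liftEnergy h φ := by
  refine hφ.comp hs (abs_fold_sub_fold_le (by linarith)) (abs_cos_fold_sub_cos_fold_le hs hβ hβ')
    fun t => ?_
  have := abs_cos_fold_sub_cos_fold_le hs hβ hβ' t β
  rwa [fold_self hs hβ hβ', hβh] at this

theorem IsProfile.comp_foldDown {h a b s β : ℝ} {φ : ℝ → ℝ} (hφ : IsProfile h φ a b) (hs : 1 ≤ s)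
    (hβ : 0 ≤ β) (hβ' : β ≤ Real.pi) (hβh : Real.cos β = h) :
    IsProfile h (fun x => foldDown s β (φ x)) (foldDown s β a) (foldDown s β b) ∧
      liftEnergy h (fun x => foldDown s β (φ x)) ≤ ENNReal.ofReal (s ^ 4) * liftEnergy h φ := by
  refine hφ.comp hs (abs_foldDown_sub_foldDown_le (by linarith) β)
    (abs_cos_foldDown_sub_cos_foldDown_le hs hβ hβ') fun t => ?_
  have := abs_cos_foldDown_sub_cos_foldDown_le hs hβ hβ' t β
  rwa [foldDown_self hs hβ hβ', hβh] at this

/-! ### Splitting a wall of degree one -/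

theorem deriv_eq_zero_of_isLocalExtr_cos {ψ : ℝ → ℝ} {x : ℝ} (hd : DifferentiableAt ℝ ψ x)
    (he : IsLocalExtr (fun y => Real.cos (ψ y)) x) (hs : Real.sin (ψ x) ≠ 0) : deriv ψ x = 0 := by
  have h1 := he.deriv_eq_zero
  rw [hd.hasDerivAt.cos.deriv] at h1
  simpa [hs] using h1

/-- A profile of degree one takes all values of the cosine, except possibly `h`. -/
theorem IsProfile.exists_cos_eq {h a : ℝ} {φ : ℝ → ℝ} (hφ : IsProfile h φ a (a + 2 * Real.pi))
    {c : ℝ} (hc : Real.cos c ≠ h) : ∃ x, Real.cos (φ x) = Real.cos c := by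
  have hm := toIcoMod_mem_Ico Real.two_pi_pos a c
  set t := toIcoMod Real.two_pi_pos a c with ht
  have htc : Real.cos t = Real.cos c := by
    rw [ht, toIcoMod, zsmul_eq_mul, Real.cos_sub_int_mul_two_pi]
  have hta : a < t := by
    refine lt_of_le_of_ne hm.1 fun h' => hc ?_
    rw [← htc, ← h', hφ.cos_left]
  obtain ⟨x, hx⟩ := mem_range_of_exists_le_of_exists_ge hφ.continuous
    ((hφ.tendsto_atBot.eventually (gt_mem_nhds hta)).exists.imp fun _ => le_of_lt)
    ((hφ.tendsto_atTop.eventually (lt_mem_nhds hm.2)).exists.imp fun _ => le_of_lt)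
  exact ⟨x, by rw [hx, htc]⟩

theorem IsProfile.measurable_local {h a b : ℝ} {φ : ℝ → ℝ} (hφ : IsProfile h φ a b) :
    Measurable fun x => ENNReal.ofReal (deriv φ x ^ 2 + (Real.cos (φ x) - h) ^ 2) :=
  (((measurable_deriv φ).pow_const 2).add
    (((Real.continuous_cos.comp hφ.continuous).measurable.sub_const h).pow_const 2)).ennreal_ofReal

/-- Two profiles with `cos T = max (cos φ) h` and `cos S = min (cos φ) h` have together less energy
than `φ`. The local parts split at almost every point, since at almost every point one of the two is
stationary; the interaction in the nonlocal part is repulsive. -/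
theorem IsProfile.liftEnergy_add_lt {h a b a₁ b₁ a₂ b₂ : ℝ} (h1 : h ^ 2 < 1) {φ T S : ℝ → ℝ}
    (hφ : IsProfile h φ a b) (hT : IsProfile h T a₁ b₁) (hS : IsProfile h S a₂ b₂)
    (hTφ : ∀ x y, |T y - T x| ≤ 1 * |φ y - φ x|) (hSφ : ∀ x y, |S y - S x| ≤ 1 * |φ y - φ x|)
    (hTc : ∀ x, Real.cos (T x) = max (Real.cos (φ x)) h)
    (hSc : ∀ x, Real.cos (S x) = min (Real.cos (φ x)) h)
    (hlt : ∃ x, Real.cos (φ x) < h) (hgt : ∃ x, h < Real.cos (φ x)) :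
    liftEnergy h T + liftEnergy h S < liftEnergy h φ := by
  have hsin : ∀ t, Real.cos t = h → Real.sin t ≠ 0 := fun t ht h0 => by
    have := Real.sin_sq_add_cos_sq t
    rw [ht, h0] at this
    linarith
  have hcT : Continuous fun x => Real.cos (T x) := Real.continuous_cos.comp hT.continuous
  have hloc : (∫⁻ x, ENNReal.ofReal (deriv T x ^ 2 + (Real.cos (T x) - h) ^ 2)) +
      ∫⁻ x, ENNReal.ofReal (deriv S x ^ 2 + (Real.cos (S x) - h) ^ 2) ≤
      ∫⁻ x, ENNReal.ofReal (deriv φ x ^ 2 + (Real.cos (φ x) - h) ^ 2) := by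
    rw [← lintegral_add_left hT.measurable_local]
    refine lintegral_mono_ae ?_
    filter_upwards [ae_differentiableAt_of_ac hφ.ac, ae_differentiableAt_of_ac hT.ac,
      ae_differentiableAt_of_ac hS.ac] with x dφ dT dS
    rw [← ENNReal.ofReal_add (by positivity) (by positivity)]
    apply ENNReal.ofReal_le_ofReal
    have bT := abs_deriv_le_of_abs_sub_le dφ dT fun y => hTφ x y
    have bS := abs_deriv_le_of_abs_sub_le dφ dS fun y => hSφ x y
    rw [one_mul] at bT bS
    have bT := sq_le_sq.2 bT
    have bS := sq_le_sq.2 bS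
    -- if `cos φ(x) ≥ h`, then `cos S` has its maximum at `x`, otherwise `cos T` its minimum
    rcases le_total h (Real.cos (φ x)) with hc | hc
    · have eS : Real.cos (S x) = h := by rw [hSc, min_eq_right hc]
      have eT : Real.cos (T x) = Real.cos (φ x) := by rw [hTc, max_eq_left hc]
      have d0 : deriv S x = 0 := by
        refine deriv_eq_zero_of_isLocalExtr_cos dS (Or.inr (Eventually.of_forall fun y => ?_))
          (hsin _ eS)
        change Real.cos (S y) ≤ Real.cos (S x)
        rw [eS, hSc]
        exact min_le_right _ _
      rw [eS, eT, d0]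
      linarith
    · have eS : Real.cos (S x) = Real.cos (φ x) := by rw [hSc, min_eq_left hc]
      have eT : Real.cos (T x) = h := by rw [hTc, max_eq_right hc]
      have d0 : deriv T x = 0 := by
        refine deriv_eq_zero_of_isLocalExtr_cos dT (Or.inl (Eventually.of_forall fun y => ?_))
          (hsin _ eT)
        change Real.cos (T x) ≤ Real.cos (T y)
        rw [eT, hTc]
        exact le_max_right _ _
      rw [eS, eT, d0]
      linarith
  have hG : gagliardo (fun x => Real.cos (T x)) + gagliardo (fun x => Real.cos (S x)) <
      gagliardo fun x => Real.cos (φ x) := by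
    unfold gagliardo
    rw [← lintegral_add_left (measurable_gagliardo_integrand hcT).ennreal_ofReal]
    have hopen : IsOpen ({x | h < Real.cos (φ x)} ×ˢ {x | Real.cos (φ x) < h}) :=
      (isOpen_lt continuous_const (Real.continuous_cos.comp hφ.continuous)).prod
        (isOpen_lt (Real.continuous_cos.comp hφ.continuous) continuous_const)
    have hne : ({x | h < Real.cos (φ x)} ×ˢ {x | Real.cos (φ x) < h}).Nonempty :=
      Set.Nonempty.prod hgt hlt
    refine lintegral_strict_mono_of_ae_le_of_ae_lt_on
      (s := {x | h < Real.cos (φ x)} ×ˢ {x | Real.cos (φ x) < h})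
      (measurable_gagliardo_integrand
        (Real.continuous_cos.comp hφ.continuous)).ennreal_ofReal.aemeasurable ?_ ?_
      (hopen.measure_pos volume hne).ne' ?_
    · rw [lintegral_add_left (measurable_gagliardo_integrand hcT).ennreal_ofReal]
      exact ENNReal.add_ne_top.2 ⟨hT.gagliardo_lt_top.ne, hS.gagliardo_lt_top.ne⟩
    · refine Eventually.of_forall fun p => ?_
      beta_reduce
      rw [← ENNReal.ofReal_add (by positivity) (by positivity), ← add_div]
      apply ENNReal.ofReal_le_ofReal
      refine div_le_div_of_nonneg_right ?_ (sq_nonneg _)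
      rw [hTc, hTc, hSc, hSc]
      rcases le_total (Real.cos (φ p.1)) h with h3 | h3 <;>
      rcases le_total (Real.cos (φ p.2)) h with h4 | h4 <;>
      simp only [max_eq_left, max_eq_right, min_eq_left, min_eq_right, h3, h4] <;> nlinarith
    · refine Eventually.of_forall fun p hp => ?_
      have h3 : h < Real.cos (φ p.1) := hp.1
      have h4 : Real.cos (φ p.2) < h := hp.2
      have hp12 : p.1 - p.2 ≠ 0 := fun h0 => by
        rw [sub_eq_zero.1 h0] at h3
        exact lt_asymm h3 h4
      have hpos : 0 < (p.1 - p.2) ^ 2 := by positivity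
      beta_reduce
      rw [← ENNReal.ofReal_add (by positivity) (by positivity), ← add_div]
      rw [hTc, hTc, hSc, hSc, max_eq_left h3.le, min_eq_right h3.le, max_eq_right h4.le,
        min_eq_left h4.le]
      refine (ENNReal.ofReal_lt_ofReal_iff_of_nonneg (by positivity)).2 ?_
      refine div_lt_div_of_pos_right ?_ hpos
      nlinarith [mul_pos (sub_pos.2 h3) (sub_pos.2 h4)]
  have hfin : 2⁻¹ * (∫⁻ x, ENNReal.ofReal (deriv φ x ^ 2 + (Real.cos (φ x) - h) ^ 2)) ≠ ⊤ :=
    (ENNReal.mul_lt_top (by simp) hφ.lintegral_lt_top).ne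
  have hfin' : 2⁻¹ * ((∫⁻ x, ENNReal.ofReal (deriv T x ^ 2 + (Real.cos (T x) - h) ^ 2)) +
      ∫⁻ x, ENNReal.ofReal (deriv S x ^ 2 + (Real.cos (S x) - h) ^ 2)) ≠ ⊤ :=
    ne_top_of_le_ne_top hfin (by gcongr)
  unfold liftEnergy
  calc _ = 2⁻¹ * ((∫⁻ x, ENNReal.ofReal (deriv T x ^ 2 + (Real.cos (T x) - h) ^ 2)) +
        ∫⁻ x, ENNReal.ofReal (deriv S x ^ 2 + (Real.cos (S x) - h) ^ 2)) +
        ENNReal.ofReal (1 / (4 * Real.pi)) *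
        (gagliardo (fun x => Real.cos (T x)) + gagliardo (fun x => Real.cos (S x))) := by ring
    _ < _ := by
      refine ENNReal.add_lt_add_of_le_of_lt hfin' (by gcongr) ?_
      exact (ENNReal.mul_lt_mul_iff_right (by simp [Real.pi_pos]) ENNReal.ofReal_ne_top).2 hG

theorem IsProfile.neg {h a b : ℝ} {φ : ℝ → ℝ} (hφ : IsProfile h φ a b) :
    IsProfile h (fun x => -φ x) (-a) (-b) := by
  refine ⟨ac_comp_of_dist_le (F := fun t => -t) (K := 1) (fun x y => ?_) hφ.ac,
    hφ.tendsto_atBot.neg, hφ.tendsto_atTop.neg, ?_⟩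
  · rw [one_mul, ← neg_sub', abs_neg]
  · simpa using hφ.lintegral_lt_top

/-- The sign of the total angle does not matter, since `φ` and `-φ` have the same energy. -/
theorem IsProfile.minEnergy_abs_le {h a b d : ℝ} (h1 : h < 1) {φ : ℝ → ℝ}
    (hφ : IsProfile h φ a b) (hd : d = |b - a| / (2 * Real.pi)) : minEnergy h d ≤ liftEnergy h φ := by
  rcases le_total 0 (b - a) with h0 | h0
  · exact hφ.minEnergy_le h1 (by rw [hd, abs_of_nonneg h0])
  · have h2 := hφ.neg.minEnergy_le (d := d) h1 (by rw [hd, abs_of_nonpos h0]; ring)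
    simpa [liftEnergy] using h2

theorem minEnergy_add_minEnergy_lt_liftEnergy {h α a : ℝ} {φ : ℝ → ℝ} (h1 : h < 1) (hα : 0 < α)
    (hα' : α < Real.pi) (hαh : Real.cos α = h) (hφ : IsProfile h φ a (a + 2 * Real.pi)) :
    minEnergy h (α / Real.pi) + minEnergy h (1 - α / Real.pi) < liftEnergy h φ := by
  have hpi := Real.pi_pos
  have hsin := Real.sin_pos_of_pos_of_lt_pi hα hα'
  have hsq : h ^ 2 < 1 := by
    have := Real.sin_sq_add_cos_sq α
    rw [hαh] at this
    nlinarith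
  have hT := (hφ.comp_fold le_rfl hα.le hα'.le hαh).1
  have hS := (hφ.comp_foldDown le_rfl hα.le hα'.le hαh).1
  have hlt := hφ.liftEnergy_add_lt hsq hT hS (fun x y => abs_fold_sub_fold_le zero_le_one _ _)
    (fun x y => abs_foldDown_sub_foldDown_le zero_le_one _ _ _)
    (fun x => by rw [cos_fold_one hα.le hα'.le, hαh])
    (fun x => by rw [cos_foldDown_one hα.le hα'.le, hαh]) ?_ ?_
  · refine lt_of_le_of_lt (add_le_add ?_ ?_) hlt
    · refine hT.minEnergy_abs_le h1 ?_
      rw [fold_add_two_pi hα.le, ← neg_add', ← two_mul, abs_neg, abs_mul, abs_two,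
        abs_fold_of_cos_eq hα.le hα'.le (hφ.cos_left.trans hαh.symm)]
      field_simp
    · refine hS.minEnergy_abs_le h1 ?_
      have e : foldDown 1 α (a + 2 * Real.pi) - foldDown 1 α a =
          -(2 * fold 1 (Real.pi - α) (a - Real.pi)) := by
        rw [foldDown, foldDown, show a + 2 * Real.pi - Real.pi = a - Real.pi + 2 * Real.pi by ring,
          fold_add_two_pi (by linarith)]
        ring
      rw [e, abs_neg, abs_mul, abs_two, abs_fold_of_cos_eq (by linarith) (by linarith)
        (by rw [Real.cos_sub_pi, Real.cos_pi_sub, hφ.cos_left, hαh])]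
      field_simp
  · obtain ⟨x, hx⟩ := hφ.exists_cos_eq (c := Real.pi) (by rw [Real.cos_pi]; nlinarith)
    exact ⟨x, by rw [hx, Real.cos_pi]; nlinarith⟩
  · obtain ⟨x, hx⟩ := hφ.exists_cos_eq (c := 0) (by rw [Real.cos_zero]; exact h1.ne')
    exact ⟨x, by rwa [hx, Real.cos_zero]⟩

/-- The strict lower bound for the energy in degree one. -/
theorem minEnergy_add_minEnergy_lt {h α : ℝ} {m : ℝ → Plane} (h1 : h < 1) (hα : 0 < α)
    (hα' : α < Real.pi) (hαh : Real.cos α = h) (hm : m ∈ admissible h 1) :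
    minEnergy h (α / Real.pi) + minEnergy h (1 - α / Real.pi) < energy h m := by
  obtain ⟨φ, a, b, hφ, hd, hE⟩ := exists_profile h1 hm
  have hb : b = a + 2 * Real.pi := by
    have := Real.pi_pos
    field_simp at hd
    linarith
  subst hb
  rw [hE]
  exact minEnergy_add_minEnergy_lt_liftEnergy h1 hα hα' hαh hφ

/-! ### Translations and rotations -/

theorem ac_translate {φ : ℝ → ℝ} (hac : ∀ x y : ℝ, x ≤ y → AbsolutelyContinuousOnInterval φ x y)
    (t x y : ℝ) (hxy : x ≤ y) : AbsolutelyContinuousOnInterval (fun z => φ (z + t)) x y := by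
  rw [absolutelyContinuousOnInterval_iff]
  intro ε hε
  obtain ⟨δ, hδ, hE⟩ :=
    (absolutelyContinuousOnInterval_iff φ (x + t) (y + t)).1 (hac _ _ (by linarith)) ε hε
  refine ⟨δ, hδ, fun E hmem hlen => ?_⟩
  have hxy' : x + t ≤ y + t := by linarith
  refine hE (E.1, fun i => ((E.2 i).1 + t, (E.2 i).2 + t)) ⟨fun i hi => ?_, ?_⟩ (by simpa using hlen)
  · have := hmem.1 i hi
    simp only [Set.uIcc_of_le hxy, Set.uIcc_of_le hxy', Set.mem_Icc] at this ⊢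
    refine ⟨⟨?_, ?_⟩, ⟨?_, ?_⟩⟩ <;> linarith [this.1.1, this.1.2, this.2.1, this.2.2]
  · intro i hi j hj hij
    have hd := hmem.2 hi hj hij
    simp only [Function.onFun, Set.disjoint_left] at hd ⊢
    have key : ∀ u v z : ℝ, z ∈ Set.uIoc (u + t) (v + t) → z - t ∈ Set.uIoc u v := fun u v z hz => by
      rw [Set.mem_uIoc] at hz ⊢
      rcases hz with hz | hz
      · exact Or.inl ⟨by linarith [hz.1], by linarith [hz.2]⟩
      · exact Or.inr ⟨by linarith [hz.1], by linarith [hz.2]⟩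
    exact fun z hz hz' => hd (key _ _ z hz) (key _ _ z hz')

theorem IsProfile.translate {h a b : ℝ} {φ : ℝ → ℝ} (hφ : IsProfile h φ a b) (t : ℝ) :
    IsProfile h (fun x => φ (x + t)) a b ∧ liftEnergy h (fun x => φ (x + t)) = liftEnergy h φ := by
  have hloc : ∫⁻ x, ENNReal.ofReal (deriv (fun x => φ (x + t)) x ^ 2 + (Real.cos (φ (x + t)) - h) ^ 2) =
      ∫⁻ x, ENNReal.ofReal (deriv φ x ^ 2 + (Real.cos (φ x) - h) ^ 2) := by
    simp only [deriv_comp_add_const]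
    exact lintegral_add_right_eq_self
      (fun x => ENNReal.ofReal (deriv φ x ^ 2 + (Real.cos (φ x) - h) ^ 2)) t
  refine ⟨⟨ac_translate hφ.ac t, hφ.tendsto_atBot.comp (tendsto_atBot_add_const_right _ t tendsto_id),
    hφ.tendsto_atTop.comp (tendsto_atTop_add_const_right _ t tendsto_id), ?_⟩, ?_⟩
  · rw [hloc]
    exact hφ.lintegral_lt_top
  · rw [liftEnergy, hloc, liftEnergy]
    congr 2
    unfold gagliardo
    rw [← lintegral_add_right_eq_self (μ := (volume : Measure (ℝ × ℝ)))
      (fun p => ENNReal.ofReal ((Real.cos (φ p.1) - Real.cos (φ p.2)) ^ 2 / (p.1 - p.2) ^ 2)) (t, t)]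
    simp

/-- Adding a constant to the lifting. Adding `π` is harmless only if `h = 0`. -/
theorem IsProfile.add_const {h a b c : ℝ} {φ : ℝ → ℝ} (hφ : IsProfile h φ a b)
    (hc : (∀ t, Real.cos (t + c) = Real.cos t) ∨ h = 0 ∧ ∀ t, Real.cos (t + c) = -Real.cos t) :
    IsProfile h (fun x => φ x + c) (a + c) (b + c) ∧
      liftEnergy h (fun x => φ x + c) = liftEnergy h φ := by
  have hloc : ∫⁻ x, ENNReal.ofReal (deriv (fun x => φ x + c) x ^ 2 + (Real.cos (φ x + c) - h) ^ 2) =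
      ∫⁻ x, ENNReal.ofReal (deriv φ x ^ 2 + (Real.cos (φ x) - h) ^ 2) := by
    refine lintegral_congr fun x => ?_
    rw [deriv_add_const]
    rcases hc with hc | ⟨h0, hc⟩
    · rw [hc]
    · rw [hc, h0, sub_zero, sub_zero, neg_sq]
  refine ⟨⟨ac_comp_of_dist_le (F := fun t => t + c) (K := 1) (fun x y => by simp) hφ.ac,
    hφ.tendsto_atBot.add_const c, hφ.tendsto_atTop.add_const c, ?_⟩, ?_⟩
  · rw [hloc]
    exact hφ.lintegral_lt_top
  · rw [liftEnergy, hloc, liftEnergy]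
    congr 2
    refine lintegral_congr fun p => ?_
    rcases hc with hc | ⟨-, hc⟩
    · simp only [hc]
    · simp only [hc]
      congr 2
      ring

theorem cos_add_int_mul (k : ℤ) (t : ℝ) : Real.cos (t + 2 * k * Real.pi) = Real.cos t := by
  rw [show t + 2 * k * Real.pi = t + k * (2 * Real.pi) by ring, Real.cos_add_int_mul_two_pi]

theorem eq_pi_div_two_of_cos_three_mul {α : ℝ} (hα : 0 < α) (hα' : α ≤ Real.pi / 2)
    (h3 : Real.cos (3 * α) = Real.cos α) : α = Real.pi / 2 := by
  refine le_antisymm hα' (le_of_not_gt fun hlt => ?_)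
  have h0 : 0 < Real.cos α := Real.cos_pos_of_mem_Ioo ⟨by linarith, hlt⟩
  have h1 : 0 < Real.sin α := Real.sin_pos_of_pos_of_lt_pi hα (by linarith)
  have h2 := Real.sin_sq_add_cos_sq α
  rw [Real.cos_three_mul] at h3
  have h4 : Real.cos α * Real.sin α ^ 2 = 0 := by
    linear_combination (-1 / 4) * h3 + Real.cos α * h2
  exact (mul_pos h0 (pow_pos h1 2)).ne' h4

/-- A profile of angle `2α` may be taken from `-α` to `α`. For `h = 0`, when there are the further
profiles from `π / 2` to `3π / 2`, this requires a rotation by `π`. -/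
theorem IsProfile.exists_normalized_small {h α a b : ℝ} {φ : ℝ → ℝ} (hφ : IsProfile h φ a b)
    (hα : 0 < α) (hα' : α ≤ Real.pi / 2) (hαh : Real.cos α = h) (hab : b - a = 2 * α) :
    ∃ ψ, IsProfile h ψ (-α) α ∧ liftEnergy h ψ = liftEnergy h φ := by
  obtain ⟨k, hk | hk⟩ := Real.cos_eq_cos_iff.1 (hφ.cos_left.trans hαh.symm)
  · have h3 : α = Real.pi / 2 := by
      refine eq_pi_div_two_of_cos_three_mul hα hα' ?_
      rw [hαh, ← hφ.cos_right, ← cos_add_int_mul k b]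
      congr 1
      linarith
    have h0 : h = 0 := by rw [← hαh, h3, Real.cos_pi_div_two]
    have := hφ.add_const (c := 2 * k * Real.pi - Real.pi) (Or.inr ⟨h0, fun t => by
      rw [← add_sub_assoc, Real.cos_sub_pi, cos_add_int_mul]⟩)
    rw [show a + (2 * k * Real.pi - Real.pi) = -α by linarith,
      show b + (2 * k * Real.pi - Real.pi) = α by linarith] at this
    exact ⟨_, this⟩
  · have := hφ.add_const (c := 2 * (-k : ℤ) * Real.pi) (Or.inl fun t => cos_add_int_mul _ t)
    rw [show a + 2 * (-k : ℤ) * Real.pi = -α by push_cast; linarith,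
      show b + 2 * (-k : ℤ) * Real.pi = α by push_cast; linarith] at this
    exact ⟨_, this⟩

/-- A profile of angle `2π - 2α` may be taken from `α` to `2π - α`. -/
theorem IsProfile.exists_normalized_large {h α a b : ℝ} {φ : ℝ → ℝ} (hφ : IsProfile h φ a b)
    (hα : 0 < α) (hα' : α ≤ Real.pi / 2) (hαh : Real.cos α = h)
    (hab : b - a = 2 * Real.pi - 2 * α) :
    ∃ ψ, IsProfile h ψ α (2 * Real.pi - α) ∧ liftEnergy h ψ = liftEnergy h φ := by
  obtain ⟨k, hk | hk⟩ := Real.cos_eq_cos_iff.1 (hφ.cos_left.trans hαh.symm)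
  · have := hφ.add_const (c := 2 * k * Real.pi) (Or.inl fun t => cos_add_int_mul _ t)
    rw [show a + 2 * k * Real.pi = α by linarith,
      show b + 2 * k * Real.pi = 2 * Real.pi - α by linarith] at this
    exact ⟨_, this⟩
  · have h3 : α = Real.pi / 2 := by
      refine eq_pi_div_two_of_cos_three_mul hα hα' ?_
      rw [hαh, ← hφ.cos_right, ← Real.cos_neg b, ← cos_add_int_mul (k + 1) (-b)]
      congr 1
      push_cast
      linarith
    have h0 : h = 0 := by rw [← hαh, h3, Real.cos_pi_div_two]
    have := hφ.add_const (c := 2 * (-k : ℤ) * Real.pi + Real.pi) (Or.inr ⟨h0, fun t => by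
      rw [← add_assoc, Real.cos_add_pi, cos_add_int_mul]⟩)
    rw [show a + (2 * (-k : ℤ) * Real.pi + Real.pi) = α by push_cast; linarith,
      show b + (2 * (-k : ℤ) * Real.pi + Real.pi) = 2 * Real.pi - α by push_cast; linarith] at this
    exact ⟨_, this⟩

/-! ### Gluing two walls -/

/-- Two bounded functions with supports at distance `D` interact weakly. -/
theorem gagliardo_add_le {f g : ℝ → ℝ} {A B : Set ℝ} {D : ℝ} (hf : Continuous f)
    (hg : Continuous g) (hD : 0 < D) (hA : MeasurableSet A) (hB : MeasurableSet B)
    (hfA : ∀ x, x ∉ A → f x = 0) (hgB : ∀ x, x ∉ B → g x = 0) (hf2 : ∀ x, |f x| ≤ 2)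
    (hg2 : ∀ x, |g x| ≤ 2) (hAB : ∀ x ∈ A, ∀ y ∈ B, D ≤ |x - y|) :
    gagliardo (fun x => f x + g x) ≤
      gagliardo f + gagliardo g + ENNReal.ofReal (8 / D ^ 2) * (2 * (volume A * volume B)) := by
  set K := ENNReal.ofReal (8 / D ^ 2) with hK
  have hfg : ∀ x y, ENNReal.ofReal (2 * |f x * g y| / (x - y) ^ 2) ≤
      (A ×ˢ B).indicator (fun _ => K) (x, y) := by
    intro x y
    by_cases hx : x ∈ A
    · by_cases hy : y ∈ B
      · rw [Set.indicator_of_mem (show (x, y) ∈ A ×ˢ B from ⟨hx, hy⟩), hK]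
        apply ENNReal.ofReal_le_ofReal
        have h1 : |f x * g y| ≤ 2 * 2 := by
          rw [abs_mul]
          exact mul_le_mul (hf2 x) (hg2 y) (abs_nonneg _) (by norm_num)
        have h2 : D ^ 2 ≤ (x - y) ^ 2 := by
          rw [← sq_abs (x - y)]
          exact pow_le_pow_left₀ hD.le (hAB x hx y hy) 2
        exact div_le_div₀ (by norm_num) (by linarith) (by positivity) h2
      · simp [hgB y hy]
    · simp [hfA x hx]
  have hdisj : ∀ x, f x * g x = 0 := by
    intro x
    by_cases hx : x ∈ A
    · by_cases hy : x ∈ B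
      · have := hAB x hx x hy
        rw [sub_self, abs_zero] at this
        linarith
      · rw [hgB x hy, mul_zero]
    · rw [hfA x hx, zero_mul]
  have key : ∀ p : ℝ × ℝ,
      ENNReal.ofReal ((f p.1 + g p.1 - (f p.2 + g p.2)) ^ 2 / (p.1 - p.2) ^ 2) ≤
      ENNReal.ofReal ((f p.1 - f p.2) ^ 2 / (p.1 - p.2) ^ 2) +
      (ENNReal.ofReal ((g p.1 - g p.2) ^ 2 / (p.1 - p.2) ^ 2) +
      ((A ×ˢ B).indicator (fun _ => K) p + (B ×ˢ A).indicator (fun _ => K) p)) := by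
    rintro ⟨x, y⟩
    have e : (B ×ˢ A).indicator (fun _ => K) (x, y) = (A ×ˢ B).indicator (fun _ => K) (y, x) := by
      by_cases hx : x ∈ B <;> by_cases hy : y ∈ A <;> simp [Set.indicator, hx, hy]
    rw [e]
    refine le_trans ?_ (add_le_add le_rfl (add_le_add le_rfl (add_le_add (hfg x y) (hfg y x))))
    rw [← ENNReal.ofReal_add (by positivity) (by positivity),
      ← ENNReal.ofReal_add (by positivity) (by positivity),
      ← ENNReal.ofReal_add (by positivity) (by positivity), ← neg_sub x y, neg_sq, ← add_div,
      ← add_div, ← add_div]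
    apply ENNReal.ofReal_le_ofReal
    refine div_le_div_of_nonneg_right ?_ (sq_nonneg _)
    nlinarith [hdisj x, hdisj y, neg_abs_le (f x * g y), neg_abs_le (f y * g x)]
  have hmf := (measurable_gagliardo_integrand hf).ennreal_ofReal
  have hmg := (measurable_gagliardo_integrand hg).ennreal_ofReal
  calc gagliardo (fun x => f x + g x) ≤ _ := lintegral_mono key
    _ = gagliardo f + (gagliardo g + (K * volume (A ×ˢ B) + K * volume (B ×ˢ A))) := by
      rw [lintegral_add_left hmf, lintegral_add_left hmg,
        lintegral_add_left (measurable_const.indicator (hA.prod hB)),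
        lintegral_indicator_const (hA.prod hB), lintegral_indicator_const (hB.prod hA)]
      rfl
    _ = _ := by
      rw [Measure.volume_eq_prod, Measure.prod_prod, Measure.prod_prod]
      ring

theorem gagliardo_sub_const (f : ℝ → ℝ) (c : ℝ) : gagliardo (fun x => f x - c) = gagliardo f := by
  simp [gagliardo]

/-- Gluing two profiles of which the first is constant to the right of `-D / 2`, and the second to
the left of `D / 2`. -/
theorem IsProfile.glue {h a b c D M : ℝ} {u v : ℝ → ℝ} (hu : IsProfile h u a c)
    (hv : IsProfile h v c b) (h0 : 0 ≤ h) (h1 : h < 1) (hD : 0 < D)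
    (hu1 : ∀ x, x ≤ -(D / 2) - M → u x = a) (hu2 : ∀ x, -(D / 2) ≤ x → u x = c)
    (hv1 : ∀ x, x ≤ D / 2 → v x = c) (hv2 : ∀ x, D / 2 + M ≤ x → v x = b) :
    IsProfile h (fun x => u x + v x - c) a b ∧
      liftEnergy h (fun x => u x + v x - c) ≤ liftEnergy h u + liftEnergy h v +
        ENNReal.ofReal (1 / (4 * Real.pi)) *
          (ENNReal.ofReal (8 / D ^ 2) * (2 * (ENNReal.ofReal M * ENNReal.ofReal M))) := by
  have hc := hv.cos_left
  have hcos : ∀ x, Real.cos (u x + v x - c) - h = (Real.cos (u x) - h) + (Real.cos (v x) - h) := by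
    intro x
    rcases le_total x 0 with hx | hx
    · rw [hv1 x (by linarith), add_sub_cancel_right, hc]
      ring
    · rw [hu2 x (by linarith), add_sub_cancel_left, hc]
      ring
  have hpt : ∀ x, ENNReal.ofReal (deriv (fun x => u x + v x - c) x ^ 2 +
      (Real.cos (u x + v x - c) - h) ^ 2) =
      ENNReal.ofReal (deriv u x ^ 2 + (Real.cos (u x) - h) ^ 2) +
      ENNReal.ofReal (deriv v x ^ 2 + (Real.cos (v x) - h) ^ 2) := by
    intro x
    rw [← ENNReal.ofReal_add (by positivity) (by positivity), hcos]
    rcases lt_or_ge x (D / 2) with hx | hx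
    · have hev : v =ᶠ[𝓝 x] fun _ => c := by
        filter_upwards [gt_mem_nhds hx] with y hy using hv1 y hy.le
      have hew : (fun x => u x + v x - c) =ᶠ[𝓝 x] u := by
        filter_upwards [hev] with y hy
        rw [hy, add_sub_cancel_right]
      rw [hew.deriv_eq, hev.deriv_eq, hev.eq_of_nhds, deriv_const, hc]
      ring_nf
    · have heu : u =ᶠ[𝓝 x] fun _ => c := by
        filter_upwards [lt_mem_nhds (show -(D / 2) < x by linarith)] with y hy using hu2 y hy.le
      have hew : (fun x => u x + v x - c) =ᶠ[𝓝 x] v := by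
        filter_upwards [heu] with y hy
        rw [hy, add_sub_cancel_left]
      rw [hew.deriv_eq, heu.deriv_eq, heu.eq_of_nhds, deriv_const, hc]
      ring_nf
  have hloc : ∫⁻ x, ENNReal.ofReal (deriv (fun x => u x + v x - c) x ^ 2 +
      (Real.cos (u x + v x - c) - h) ^ 2) =
      (∫⁻ x, ENNReal.ofReal (deriv u x ^ 2 + (Real.cos (u x) - h) ^ 2)) +
      ∫⁻ x, ENNReal.ofReal (deriv v x ^ 2 + (Real.cos (v x) - h) ^ 2) := by
    rw [← lintegral_add_left hu.measurable_local]
    exact lintegral_congr hpt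
  have hb2 : ∀ t, |Real.cos t - h| ≤ 2 := fun t => by
    rw [abs_le]
    constructor <;> linarith [Real.neg_one_le_cos t, Real.cos_le_one t]
  have hG : gagliardo (fun x => Real.cos (u x + v x - c)) ≤
      gagliardo (fun x => Real.cos (u x)) + gagliardo (fun x => Real.cos (v x)) +
      ENNReal.ofReal (8 / D ^ 2) * (2 * (ENNReal.ofReal M * ENNReal.ofReal M)) := by
    rw [← gagliardo_sub_const _ h, ← gagliardo_sub_const (fun x => Real.cos (u x)) h,
      ← gagliardo_sub_const (fun x => Real.cos (v x)) h]
    simp only [hcos]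
    have hvol : volume (Set.Icc (-(D / 2) - M) (-(D / 2))) = ENNReal.ofReal M := by
      rw [Real.volume_Icc]; congr 1; ring
    have hvol' : volume (Set.Icc (D / 2) (D / 2 + M)) = ENNReal.ofReal M := by
      rw [Real.volume_Icc]; congr 1; ring
    rw [← congrArg₂ (· * ·) hvol hvol']
    refine gagliardo_add_le ((Real.continuous_cos.comp hu.continuous).sub continuous_const)
      ((Real.continuous_cos.comp hv.continuous).sub continuous_const) hD measurableSet_Icc
      measurableSet_Icc (fun x hx => ?_) (fun x hx => ?_) (fun x => hb2 _) (fun x => hb2 _)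
      fun x hx y hy => ?_
    · rw [Set.mem_Icc, not_and_or, not_le, not_le] at hx
      rcases hx with hx | hx
      · rw [hu1 x hx.le, hu.cos_left, sub_self]
      · rw [hu2 x hx.le, hc, sub_self]
    · rw [Set.mem_Icc, not_and_or, not_le, not_le] at hx
      rcases hx with hx | hx
      · rw [hv1 x hx.le, hc, sub_self]
      · rw [hv2 x hx.le, hv.cos_right, sub_self]
    · rw [abs_sub_comm]
      exact le_trans (by linarith [hx.2, hy.1]) (le_abs_self _)
  refine ⟨⟨fun x y hxy => ?_, ?_, ?_, ?_⟩, ?_⟩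
  · refine ac_comp_of_dist_le (F := fun t => t - c) (K := 1) (φ := fun t => u t + v t)
      (fun x y => by simp) (fun x y hxy => (hu.ac x y hxy).add (hv.ac x y hxy)) x y hxy
  · simpa using (hu.tendsto_atBot.add hv.tendsto_atBot).sub_const c
  · simpa using (hu.tendsto_atTop.add hv.tendsto_atTop).sub_const c
  · rw [hloc]
    exact ENNReal.add_lt_top.2 ⟨hu.lintegral_lt_top, hv.lintegral_lt_top⟩
  · unfold liftEnergy
    rw [hloc]
    refine (add_le_add le_rfl (mul_le_mul_right hG _)).trans (le_of_eq ?_)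
    ring

/-- Profiles that are constant outside an interval can be glued at a large distance. -/
theorem IsProfile.minEnergy_le_add {h a b c d : ℝ} {φ ψ : ℝ → ℝ} (h0 : 0 ≤ h) (h1 : h < 1)
    (hφ : IsProfile h φ a c) (hψ : IsProfile h ψ c b)
    (hφ1 : ∀ᶠ x in atBot, φ x = a) (hφ2 : ∀ᶠ x in atTop, φ x = c)
    (hψ1 : ∀ᶠ x in atBot, ψ x = c) (hψ2 : ∀ᶠ x in atTop, ψ x = b)
    (hd : d = (b - a) / (2 * Real.pi)) :
    minEnergy h d ≤ liftEnergy h φ + liftEnergy h ψ := by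
  obtain ⟨p₁, hp₁⟩ := eventually_atBot.1 hφ1
  obtain ⟨p₂, hp₂⟩ := eventually_atTop.1 hφ2
  obtain ⟨q₁, hq₁⟩ := eventually_atBot.1 hψ1
  obtain ⟨q₂, hq₂⟩ := eventually_atTop.1 hψ2
  set M := max (p₂ - p₁) (q₂ - q₁)
  have hM1 : p₂ - p₁ ≤ M := le_max_left _ _
  have hM2 : q₂ - q₁ ≤ M := le_max_right _ _
  have hlim : Tendsto (fun D : ℝ => liftEnergy h φ + liftEnergy h ψ +
      ENNReal.ofReal (1 / (4 * Real.pi)) *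
          (ENNReal.ofReal (8 / D ^ 2) * (2 * (ENNReal.ofReal M * ENNReal.ofReal M)))) atTop
      (𝓝 (liftEnergy h φ + liftEnergy h ψ + ENNReal.ofReal (1 / (4 * Real.pi)) *
          (ENNReal.ofReal 0 * (2 * (ENNReal.ofReal M * ENNReal.ofReal M))))) := by
    refine tendsto_const_nhds.add (ENNReal.Tendsto.const_mul (ENNReal.Tendsto.mul_const
      (ENNReal.tendsto_ofReal ?_) (Or.inr ?_)) (Or.inr ENNReal.ofReal_ne_top))
    · exact tendsto_const_nhds.div_atTop (tendsto_pow_atTop two_ne_zero)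
    · finiteness
  rw [ENNReal.ofReal_zero, zero_mul, mul_zero, add_zero] at hlim
  refine ge_of_tendsto hlim ?_
  filter_upwards [eventually_gt_atTop 0] with D hD
  obtain ⟨hu, hu'⟩ := hφ.translate (p₂ + D / 2)
  obtain ⟨hv, hv'⟩ := hψ.translate (q₁ - D / 2)
  obtain ⟨hw, hw'⟩ := hu.glue (M := M) hv h0 h1 hD (fun x hx => hp₁ _ (by linarith))
    (fun x hx => hp₂ _ (by linarith)) (fun x hx => hq₁ _ (by linarith))
    (fun x hx => hq₂ _ (by linarith))
  rw [← hu', ← hv']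
  exact (hw.minEnergy_le h1 hd).trans hw'

/-- The competitor of degree one is obtained by gluing `φ` and `ψ`, which are first stretched and
folded so that they become constant outside an interval. -/
theorem IsProfile.minEnergy_one_le {h α : ℝ} {φ ψ : ℝ → ℝ} (h0 : 0 ≤ h) (h1 : h < 1) (hα : 0 < α)
    (hα' : α < Real.pi) (hαh : Real.cos α = h) (hφ : IsProfile h φ (-α) α)
    (hψ : IsProfile h ψ α (2 * Real.pi - α)) :
    minEnergy h 1 ≤ liftEnergy h φ + liftEnergy h ψ := by
  have hpi := Real.pi_pos
  have key : ∀ s : ℝ, 1 < s →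
      minEnergy h 1 ≤ ENNReal.ofReal (s ^ 4) * (liftEnergy h φ + liftEnergy h ψ) := by
    intro s hs
    obtain ⟨hu, hu'⟩ := hφ.comp_fold hs.le hα.le hα'.le hαh
    obtain ⟨hv, hv'⟩ := hψ.comp_foldDown hs.le hα.le hα'.le hαh
    have e : foldDown s α (2 * Real.pi - α) = 2 * Real.pi - α := by
      rw [foldDown, show 2 * Real.pi - α - Real.pi = Real.pi - α by ring,
        fold_self hs.le (by linarith) (by linarith)]
      ring
    have tl : Tendsto (fun x => ψ x - Real.pi) atBot (𝓝 (-(Real.pi - α))) := by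
      rw [neg_sub]
      exact hψ.tendsto_atBot.sub_const _
    have tr : Tendsto (fun x => ψ x - Real.pi) atTop (𝓝 (Real.pi - α)) := by
      rw [show Real.pi - α = 2 * Real.pi - α - Real.pi by ring]
      exact hψ.tendsto_atTop.sub_const _
    rw [fold_neg_self hs.le hα.le hα'.le, fold_self hs.le hα.le hα'.le] at hu
    rw [e, foldDown_self hs.le hα.le hα'.le] at hv
    rw [mul_add]
    refine le_trans ?_ (add_le_add hu' hv')
    refine hu.minEnergy_le_add h0 h1 hv
      (hφ.tendsto_atBot.eventually (eventually_fold_eq_neg hs hα hα'.le))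
      (hφ.tendsto_atTop.eventually (eventually_fold_eq hs hα hα'.le)) ?_ ?_ (by field_simp; ring)
    · filter_upwards [tl.eventually (eventually_fold_eq_neg hs (sub_pos.2 hα') (by linarith))]
        with x hx
      rw [foldDown, hx]
      ring
    · filter_upwards [tr.eventually (eventually_fold_eq hs (sub_pos.2 hα') (by linarith))]
        with x hx
      rw [foldDown, hx]
      ring
  have hlim : Tendsto (fun s : ℝ => ENNReal.ofReal (s ^ 4) * (liftEnergy h φ + liftEnergy h ψ))
      (𝓝[>] 1) (𝓝 (ENNReal.ofReal (1 ^ 4) * (liftEnergy h φ + liftEnergy h ψ))) :=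
    (ENNReal.Tendsto.mul_const (ENNReal.tendsto_ofReal ((continuous_pow 4).tendsto 1))
      (Or.inl (by simp))).mono_left nhdsWithin_le_nhds
  rw [one_pow, ENNReal.ofReal_one, one_mul] at hlim
  exact ge_of_tendsto hlim (eventually_mem_nhdsWithin.mono key)

theorem minEnergy_one_le {h α : ℝ} (h0 : 0 ≤ h) (h1 : h < 1) (hα : 0 < α)
    (hα' : α ≤ Real.pi / 2) (hαh : Real.cos α = h) :
    minEnergy h 1 ≤ minEnergy h (α / Real.pi) + minEnergy h (1 - α / Real.pi) := by
  have hpi := Real.pi_pos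
  refine ENNReal.le_iInf₂_add_iInf₂ fun m hm n hn => ?_
  obtain ⟨φ, a, b, hφ, hd, hE⟩ := exists_profile h1 hm
  obtain ⟨ψ, a', b', hψ, hd', hE'⟩ := exists_profile h1 hn
  obtain ⟨φ₁, hφ₁, e₁⟩ := hφ.exists_normalized_small hα hα' hαh (by
    field_simp at hd
    linarith)
  obtain ⟨ψ₁, hψ₁, e₂⟩ := hψ.exists_normalized_large hα hα' hαh (by
    field_simp at hd'
    linarith)
  rw [hE, hE', ← e₁, ← e₂]
  exact hφ₁.minEnergy_one_le h0 h1 hα (by linarith) hαh hψ₁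

/-- A linear wall of degree one. -/
theorem isProfile_ramp {h α : ℝ} (hαh : Real.cos α = h) :
    IsProfile h (fun x => max (-α) (min (2 * Real.pi - α) x)) (-α) (2 * Real.pi - α) := by
  have hpi := Real.pi_pos
  set φ : ℝ → ℝ := fun x => max (-α) (min (2 * Real.pi - α) x) with hφ
  have hlip : LipschitzWith 1 φ := (LipschitzWith.id.const_min _).const_max _
  have hl : ∀ x, x ≤ -α → φ x = -α := fun x hx => by
    rw [hφ]
    exact max_eq_left ((min_le_right _ _).trans hx)
  have hr : ∀ x, 2 * Real.pi - α ≤ x → φ x = 2 * Real.pi - α := fun x hx => by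
    rw [hφ]
    dsimp only
    rw [min_eq_left hx, max_eq_right (by linarith)]
  refine ⟨fun x y _ => (hlip.lipschitzOnWith).absolutelyContinuousOnInterval,
    tendsto_const_nhds.congr' ?_, tendsto_const_nhds.congr' ?_, ?_⟩
  · filter_upwards [eventually_le_atBot (-α)] with x hx using (hl x hx).symm
  · filter_upwards [eventually_ge_atTop (2 * Real.pi - α)] with x hx using (hr x hx).symm
  · have hb : ∀ x, ENNReal.ofReal (deriv φ x ^ 2 + (Real.cos (φ x) - h) ^ 2) ≤
        (Set.Icc (-α) (2 * Real.pi - α)).indicator (fun _ => ENNReal.ofReal 5) x := by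
      intro x
      by_cases hx : x ∈ Set.Icc (-α) (2 * Real.pi - α)
      · rw [Set.indicator_of_mem hx]
        apply ENNReal.ofReal_le_ofReal
        -- `5 = 1² + 2²`, with the bounds for `φ'` and for `cos φ - h`
        have hd : |deriv φ x| ≤ 1 := by simpa using norm_deriv_le_of_lipschitz hlip (x₀ := x)
        have hd2 : deriv φ x ^ 2 ≤ 1 := by rwa [sq_le_one_iff_abs_le_one]
        have hc : |Real.cos (φ x) - Real.cos α| ≤ 2 := by
          rw [abs_le]
          constructor <;> linarith [Real.neg_one_le_cos (φ x), Real.cos_le_one (φ x),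
            Real.neg_one_le_cos α, Real.cos_le_one α]
        rw [hαh] at hc
        have hc2 := sq_le_sq' (abs_le.1 hc).1 (abs_le.1 hc).2
        linarith
      · rw [Set.indicator_of_notMem hx]
        rw [Set.mem_Icc, not_and_or, not_le, not_le] at hx
        have hzero : ∀ c, φ =ᶠ[𝓝 x] (fun _ => c) → Real.cos c = h →
            deriv φ x ^ 2 + (Real.cos (φ x) - h) ^ 2 = 0 := fun c hc hch => by
          rw [hc.deriv_eq, hc.eq_of_nhds, deriv_const, hch]
          ring
        rw [nonpos_iff_eq_zero, ENNReal.ofReal_eq_zero]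
        rcases hx with hx | hx
        · refine (hzero (-α) ?_ (by rw [Real.cos_neg, hαh])).le
          filter_upwards [gt_mem_nhds hx] with y hy using hl y hy.le
        · refine (hzero (2 * Real.pi - α) ?_ (by rw [Real.cos_two_pi_sub, hαh])).le
          filter_upwards [lt_mem_nhds hx] with y hy using hr y hy.le
    refine (lintegral_mono hb).trans_lt ?_
    rw [lintegral_indicator_const measurableSet_Icc, Real.volume_Icc]
    exact ENNReal.mul_lt_top ENNReal.ofReal_lt_top ENNReal.ofReal_lt_top

end NeelWall

end

theorem theorem1p2 (h : ℝ) (h_nonneg : 0 ≤ h) (h_lt_one : h < 1) :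
    NeelWall.minEnergy h 1 ≠ ⊤ ∧
    NeelWall.minEnergy h 1 =
      NeelWall.minEnergy h (NeelWall.wellAngle h / Real.pi) +
        NeelWall.minEnergy h (1 - NeelWall.wellAngle h / Real.pi) ∧
    ¬ NeelWall.IsAttained h 1 := by
  have hw : NeelWall.wellAngle h = Real.arccos h := by
    rw [NeelWall.wellAngle, min_eq_left h_lt_one.le]
  have hcos : Real.cos (NeelWall.wellAngle h) = h := by
    rw [hw, Real.cos_arccos (by linarith) h_lt_one.le]
  have hα : 0 < NeelWall.wellAngle h := by rw [hw]; exact Real.arccos_pos.2 h_lt_one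
  have hα' : NeelWall.wellAngle h ≤ Real.pi / 2 := by
    rw [hw]; exact Real.arccos_le_pi_div_two.2 h_nonneg
  have hpi : NeelWall.wellAngle h < Real.pi := by linarith [Real.pi_pos]
  have hramp := NeelWall.isProfile_ramp hcos
  have heq := le_antisymm (NeelWall.minEnergy_one_le h_nonneg h_lt_one hα hα' hcos)
    (le_iInf₂ fun m hm =>
      (NeelWall.minEnergy_add_minEnergy_lt h_lt_one hα hpi hcos hm).le)
  refine ⟨ne_top_of_le_ne_top hramp.liftEnergy_lt_top.ne (hramp.minEnergy_le h_lt_one ?_), heq, ?_⟩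
  · field_simp [Real.pi_ne_zero]
    ring
  · rintro ⟨m, hm, hmin⟩
    have := NeelWall.minEnergy_add_minEnergy_lt h_lt_one hα hpi hcos hm
    rw [← heq, hmin] at this
    exact lt_irrefl _ this
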